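/- **Invalidity of naïve plug-in methods.** *Setting.* Let $d\ge 0$ be fixed, $\Theta\subset\mathbb R^d$, and let $s_i:\mathbb R^d\to\mathbb R$, $i=1,2,\dots$ For $\theta\in\Theta$ let $P_\theta$ be the law under which the counts $N_1,\dots,N_n$ are independent, $N_i\sim\mathrm{Poisson}(s_i(\theta))$; write $\mathbb E_\theta,\mathrm{Var}_\theta,\mathrm{Cov}_\theta$ for its moments. Let $$C_n(\theta)=2\sum_{i=1}^n\big[s_i(\theta)-N_i\log s_i(\theta)-N_i+N_i\log N_i\big]\qquad(0\log 0=0),$$ let $\ell(\theta)$ be the log-likelihood, $D\ell$ its gradient, $J_n(\theta)=\mathrm{Cov}_\theta(D\ell(\theta))$, and let $\hat\theta=\hat\theta_n\in\Theta$ be the maximum likelihood estimate, i.e. a minimizer of $C_n$ over $\Theta$. Put $\boldsymbol c(\theta)=\mathrm{Cov}_\theta\{C_n(\theta),D\ell(\theta)\}$, $Q(\theta)=\boldsymbol c(\theta)^\top J_n(\theta)^{-1}\boldsymbol c(\theta)$ and $\mu(\theta)=\mathbb E_\theta[C_n(\theta)]$. Assume $H_0$: the data have law $P_{\theta^\star}$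 with $\theta^\star$ in the interior of $\Theta$, and * (B1) $\frac1n J_n(\theta^\star)\to I(\theta^\star)$ with $I(\theta^\star)$ positive definite, and $\sqrt n(\hat\theta-\theta^\star)\to N(0,I^{-1}(\theta^\star))$ in distribution; * (B2) there is $\epsilon>0$ with $s_i(\theta)\ge\epsilon$ for all $i$ and all $\theta\in\Theta$; * (standard regularity) $\Theta$ is bounded; the functions $\sqrt{s_i}$ are Lipschitz on $\Theta$ with a common constant; on some ball around $\theta^\star$ all $s_i$ are three times continuously differentiable, with derivatives of order $1,2,3$ bounded by $L\sqrt{s_i}$ for a constant $L$ that does not depend on $i$. The naïve plug-in method replaces $\theta^\star$ by $\hat\theta$ in the mean and the variance of the $C$ statistic $C_n(\hat\theta)$ (parametric bootstrap moments): with $m_n(\theta)=\mathbb E_\theta[C_n(\hat\theta)]$ and $v_n(\theta)=\mathrm{Var}_\theta[C_n(\hat\theta)]$, where $\hat\theta$ inside the moments is recomputed from each data set, $$T_{\rm naive}=\frac{C_n(\hat\theta)-m_n(\hat\theta)}{\sqrt{v_n(\hat\theta)}},\qquad\text{whereas the correct standardization is}\qquad T_1=\frac{C_n(\hat\theta)-\mu(\hat\theta)}{\sqrt{\mathrm{Var}_{\theta}[C_n(\theta)]\big|_{\theta=\hat\theta}-Q(\hat\theta)}}.$$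 Let $\mathrm{bias}_n=T_{\rm naive}-T_1$. *Statement.* As $n\to\infty$, under $P_{\theta^\star}$: 1. $Q(\hat\theta)=O_p(n)$. 2. $\mathrm{bias}_n=O_p(1)$. 3. The bias comes from omitting $Q(\hat\theta)$: $\displaystyle \frac{C_n(\hat\theta)-m_n(\hat\theta)}{\sqrt{v_n(\hat\theta)-Q(\hat\theta)}}-T_1\to0$ in probability; and along any subsequence of sample sizes, $\mathrm{bias}_n\to0$ in probability if and only if $Q(\hat\theta)/n\to0$ in probability. (So the bias is not $o_p(1)$ unless $Q(\hat\theta)$ is $o_p(n)$.) 4. The bias decreases to $0$ as $s_i\to\infty$ uniformly: for every $\delta>0$ there is $S$, depending only on $\delta$ and $d$, such that in every setting as above with $s_i(\theta^\star)\ge S$ for all but finitely many $i$, one has $P_{\theta^\star}(|\mathrm{bias}_n|>\delta)\le\delta$ for all sufficiently large $n$. -/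

import Mathlib

open MeasureTheory ProbabilityTheory Filter Topology Matrix

namespace CStat

noncomputable section

/-- The parameter vectors: `ℝ^d` with its Euclidean norm. -/
abbrev Param (d : ℕ) : Type := EuclideanSpace ℝ (Fin d)

/-- `P_θ`, the joint law of `(N_1, …, N_n)`: independent counts, the `i`-th one Poisson with
mean `s_i(θ)`. The data set is the point `x : Fin n → ℕ`. -/
def law {d : ℕ} (s : ℕ → Param d → ℝ) (n : ℕ) (θ : Param d) : Measure (Fin n → ℕ) :=
  Measure.pi (fun i : Fin n => poissonMeasure (s i θ).toNNReal)

instance instIsProbabilityMeasureLaw {d : ℕ} (s : ℕ → Param d → ℝ) (n : ℕ) (θ : Param d) :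
    IsProbabilityMeasure (law s n θ) := by
  unfold law
  infer_instance

/-- The `C` function `C_n(θ) = 2 ∑ [s_i(θ) - N_i log s_i(θ) - N_i + N_i log N_i]`
(with `0 log 0 = 0`). -/
def cash {d : ℕ} (s : ℕ → Param d → ℝ) (n : ℕ) (θ : Param d) (x : Fin n → ℕ) : ℝ :=
  2 * ∑ i : Fin n,
    (s i θ - (x i : ℝ) * Real.log (s i θ) - (x i : ℝ) + (x i : ℝ) * Real.log (x i : ℝ))

/-- The log-likelihood: the sum of the logarithms of the Poisson probabilities
`exp(-s_i(θ)) s_i(θ)^{N_i} / N_i!`. -/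
def logLik {d : ℕ} (s : ℕ → Param d → ℝ) (n : ℕ) (θ : Param d) (x : Fin n → ℕ) : ℝ :=
  ∑ i : Fin n,
    Real.log (Real.exp (-(s i θ)) * (s i θ) ^ (x i) / ((x i).factorial : ℝ))

/-- The score vector: the partial derivatives of the log-likelihood in `θ`. -/
def score {d : ℕ} (s : ℕ → Param d → ℝ) (n : ℕ) (θ : Param d) (j : Fin d) (x : Fin n → ℕ) : ℝ :=
  fderiv ℝ (fun t : Param d => logLik s n t x) θ (EuclideanSpace.single j 1)

/-- The information matrix of all `n` bins: the covariance matrix of the score under `P_θ`. -/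
def info {d : ℕ} (s : ℕ → Param d → ℝ) (n : ℕ) (θ : Param d) : Matrix (Fin d) (Fin d) ℝ :=
  Matrix.of fun j k => cov[score s n θ j, score s n θ k; law s n θ]

/-- `c(θ) = Cov_θ(C_n(θ), score)`. -/
def crossCov {d : ℕ} (s : ℕ → Param d → ℝ) (n : ℕ) (θ : Param d) : Fin d → ℝ :=
  fun j => cov[cash s n θ, score s n θ j; law s n θ]

/-- `Q(θ) = c(θ)ᵀ Cov_θ(score)⁻¹ c(θ)`. -/
def quadQ {d : ℕ} (s : ℕ → Param d → ℝ) (n : ℕ) (θ : Param d) : ℝ :=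
  crossCov s n θ ⬝ᵥ ((info s n θ)⁻¹ *ᵥ crossCov s n θ)

/-- `θhat n` maps every data set of size `n` to a maximum likelihood estimate over `Θ`,
that is, to a minimizer of `C_n` over `Θ`. -/
def IsMLE {d : ℕ} (Θ : Set (Param d)) (s : ℕ → Param d → ℝ)
    (θhat : (n : ℕ) → (Fin n → ℕ) → Param d) : Prop :=
  ∀ (n : ℕ) (x : Fin n → ℕ), θhat n x ∈ Θ ∧ ∀ θ ∈ Θ, cash s n (θhat n x) x ≤ cash s n θ x

/-- Asymptotic normality of the estimator: the information per bin at the true parameter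
converges to a positive definite matrix `I`, and `√n (θhat - θ₀)` converges in distribution,
under `θ₀`, to the centred normal law with covariance matrix `I⁻¹`. -/
def ConditionB1 {d : ℕ} (s : ℕ → Param d → ℝ) (θ₀ : Param d)
    (θhat : (n : ℕ) → (Fin n → ℕ) → Param d) : Prop :=
  ∃ I : Matrix (Fin d) (Fin d) ℝ,
    (∀ j k : Fin d, Tendsto (fun n : ℕ => info s n θ₀ j k / (n : ℝ)) atTop (𝓝 (I j k))) ∧
    I.PosDef ∧
    TendstoInDistribution
      (fun (n : ℕ) (x : Fin n → ℕ) => Real.sqrt (n : ℝ) • (θhat n x - θ₀)) atTop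
      (fun y : Param d => y) (fun n => law s n θ₀) (multivariateGaussian 0 I⁻¹)

/-- The expected counts are bounded away from `0`, uniformly in the bin and the parameter. -/
def ConditionB2 {d : ℕ} (Θ : Set (Param d)) (s : ℕ → Param d → ℝ) : Prop :=
  ∃ ε : ℝ, 0 < ε ∧ ∀ (i : ℕ), ∀ θ ∈ Θ, ε ≤ s i θ

/-- Standing regularity of the spectral model. The bounds are relative to `√(s_i)`, so that for
expected counts that are bounded above they are the usual uniform bounds, while expected counts
that tend to infinity are not excluded. -/
structure Standing {d : ℕ} (Θ : Set (Param d)) (s : ℕ → Param d → ℝ) (θ₀ : Param d) : Prop where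
  bounded : Bornology.IsBounded Θ
  interior_mem : θ₀ ∈ interior Θ
  lipschitz : ∃ L : ℝ, ∀ (i : ℕ), ∀ θ ∈ Θ, ∀ θ' ∈ Θ,
    |Real.sqrt (s i θ) - Real.sqrt (s i θ')| ≤ L * ‖θ - θ'‖
  smooth : ∃ r : ℝ, 0 < r ∧ ∃ L : ℝ, ∀ i : ℕ,
    ContDiffOn ℝ 3 (s i) (Metric.ball θ₀ r) ∧
    ∀ θ ∈ Metric.ball θ₀ r, ∀ k : ℕ, 1 ≤ k → k ≤ 3 →
      ‖iteratedFDeriv ℝ k (s i) θ‖ ≤ L * Real.sqrt (s i θ)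

/-- The whole set-up under the null hypothesis: the true parameter is `θ₀ ∈ Θ` (an interior
point), the data have law `P_{θ₀}`, `θhat` is the MLE, and the regularity conditions hold. -/
structure Setting {d : ℕ} (Θ : Set (Param d)) (s : ℕ → Param d → ℝ) (θ₀ : Param d)
    (θhat : (n : ℕ) → (Fin n → ℕ) → Param d) : Prop where
  standing : Standing Θ s θ₀
  mle : IsMLE Θ s θhat
  b1 : ConditionB1 s θ₀ θhat
  b2 : ConditionB2 Θ s

/-- The `C` statistic `C_n(θhat)`. -/
def cStat {d : ℕ} (s : ℕ → Param d → ℝ) (θhat : (n : ℕ) → (Fin n → ℕ) → Param d)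
    (n : ℕ) (x : Fin n → ℕ) : ℝ :=
  cash s n (θhat n x) x

/-- `E_θ[C_n(θhat)]`: the mean of the `C` statistic (the estimate being recomputed from each
data set) when the true parameter is `θ`. -/
def statMean {d : ℕ} (s : ℕ → Param d → ℝ) (θhat : (n : ℕ) → (Fin n → ℕ) → Param d)
    (n : ℕ) (θ : Param d) : ℝ :=
  ∫ y, cStat s θhat n y ∂(law s n θ)

/-- `Var_θ[C_n(θhat)]`. -/
def statVar {d : ℕ} (s : ℕ → Param d → ℝ) (θhat : (n : ℕ) → (Fin n → ℕ) → Param d)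
    (n : ℕ) (θ : Param d) : ℝ :=
  variance (cStat s θhat n) (law s n θ)

/-- `μ(θ) = E_θ[C_n(θ)]`, the mean of the `C` function. -/
def funMean {d : ℕ} (s : ℕ → Param d → ℝ) (n : ℕ) (θ : Param d) : ℝ :=
  ∫ y, cash s n θ y ∂(law s n θ)

/-- `Var_θ[C_n(θ)]`, the variance of the `C` function. -/
def funVar {d : ℕ} (s : ℕ → Param d → ℝ) (n : ℕ) (θ : Param d) : ℝ :=
  variance (cash s n θ) (law s n θ)

/-- The correct standardization
`T₁ = (C_n(θhat) - μ(θhat)) / √(Var_θ[C_n(θ)] - Q(θ))`, with `θ = θhat` in the denominator. -/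
def zCorrect {d : ℕ} (s : ℕ → Param d → ℝ) (θhat : (n : ℕ) → (Fin n → ℕ) → Param d)
    (n : ℕ) (x : Fin n → ℕ) : ℝ :=
  (cStat s θhat n x - funMean s n (θhat n x)) /
    Real.sqrt (funVar s n (θhat n x) - quadQ s n (θhat n x))

/-- The naive plug-in standardization: the mean and the variance of the `C` statistic, computed
as if the true parameter were `θhat` (the exact parametric bootstrap moments). -/
def zNaive {d : ℕ} (s : ℕ → Param d → ℝ) (θhat : (n : ℕ) → (Fin n → ℕ) → Param d)
    (n : ℕ) (x : Fin n → ℕ) : ℝ :=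
  (cStat s θhat n x - statMean s θhat n (θhat n x)) /
    Real.sqrt (statVar s θhat n (θhat n x))

/-- The naive standardization with the omitted term `Q(θhat)` put back into the variance. -/
def zRestored {d : ℕ} (s : ℕ → Param d → ℝ) (θhat : (n : ℕ) → (Fin n → ℕ) → Param d)
    (n : ℕ) (x : Fin n → ℕ) : ℝ :=
  (cStat s θhat n x - statMean s θhat n (θhat n x)) /
    Real.sqrt (statVar s θhat n (θhat n x) - quadQ s n (θhat n x))

/-- The bias of the naive `Z` statistic. -/
def bias {d : ℕ} (s : ℕ → Param d → ℝ) (θhat : (n : ℕ) → (Fin n → ℕ) → Param d)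
    (n : ℕ) (x : Fin n → ℕ) : ℝ :=
  zNaive s θhat n x - zCorrect s θhat n x

/-- `X_n = O_p(1)` under the true parameter `θ₀`, as `n → ∞`. -/
def BoundedInProb {d : ℕ} (s : ℕ → Param d → ℝ) (θ₀ : Param d)
    (X : (n : ℕ) → (Fin n → ℕ) → ℝ) : Prop :=
  ∀ δ : ℝ, 0 < δ → ∃ K : ℝ, ∀ᶠ n : ℕ in atTop, (law s n θ₀).real {x | K < |X n x|} ≤ δ

/-- `X_n = o_p(1)` under the true parameter `θ₀`, as `n` runs through the sample sizes
`φ 0, φ 1, …`. -/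
def VanishesInProb {d : ℕ} (s : ℕ → Param d → ℝ) (θ₀ : Param d) (φ : ℕ → ℕ)
    (X : (n : ℕ) → (Fin n → ℕ) → ℝ) : Prop :=
  ∀ δ : ℝ, 0 < δ →
    Tendsto (fun k : ℕ => (law s (φ k) θ₀).real {x | δ ≤ |X (φ k) x|}) atTop (𝓝 0)

end

end CStat

/-! Write V for the variance of C_n(θ) and μ for its mean, both under P_θ. The excess C_n(θ) -
C_n(θhat) is the likelihood ratio statistic. It is nonnegative on Θ, and its second moment under P_θ
is O(log² n) uniformly in θ ∈ Θ: the likelihood ratio of any fixed t to θ has mean one, a polynomial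
number of points t forms a net of mesh of order 1/n, and C_n moves by O(1) in mean square between
θhat and the nearest net point (`Setting.exists_excess_bound`). Hence the bootstrap moments m_n and
v_n equal μ and V up to o(√n) and o(n), uniformly on Θ. The naive method therefore divides by √V
where √(V - Q) is right, and with W = (C_n(θhat) - μ(θhat)) / √n,

bias = -W · gap + o_p(1), gap = ((V - Q)/n)^(-1/2) - (V/n)^(-1/2).

Here V/n is bounded, and (V - Q)/n stays away from 0: regression on the score explains no more than
regression of each bin's deviance on its own count, and the second Charlier coefficient of that
deviance survives the latter (`charlier_le_residual`, `quadQ_bounds`). So `gap` is comparable to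
Q/n. Since W is bounded in probability, this gives the O_p claims, the restored statistic, and one
direction of the equivalence.

For the converse W must not vanish along any subsequence. Because c is the gradient of μ, W is the
centred C function at θ₀ over √n, minus a linear form in √n (θhat - θ₀) whose limiting variance is
lim Q/n along subsequences. If W vanished, the centred C function would share the truncated second
moments of that linear form, hence at most lim Q/n. Its second moment V/n exceeds Q/n by a fixed
amount, and a bounded fourth moment makes truncation lose less than that
(`Setting.not_plugStat_vanishes`). No joint limit law is needed.

For large counts Q ≤ ∑ 4/s_i makes `gap` of order 1/S, while the tails of W are controlled by
absolute constants. -/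

namespace CStat

/-! ### Functions of one count with geometric growth -/

/-- A function of a count that grows at most geometrically. -/
def ExpGrowth (f : ℕ → ℝ) : Prop :=
  ∃ A B : ℝ, 0 ≤ A ∧ 1 ≤ B ∧ ∀ k, |f k| ≤ A * B ^ k

namespace ExpGrowth

variable {f g : ℕ → ℝ}

lemma of_abs_le (hg : ExpGrowth g) (h : ∀ k, |f k| ≤ |g k|) : ExpGrowth f := by
  obtain ⟨A, B, hA, hB, hg⟩ := hg
  exact ⟨A, B, hA, hB, fun k => (h k).trans (hg k)⟩

lemma const (c : ℝ) : ExpGrowth (fun _ => c) :=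
  ⟨|c|, 1, abs_nonneg c, le_rfl, fun k => by simp⟩

lemma cast : ExpGrowth (fun k => (k : ℝ)) := by
  refine ⟨1, 2, by norm_num, by norm_num, fun k => ?_⟩
  rw [abs_of_nonneg (by positivity), one_mul]
  have : k ≤ 2 ^ k := Nat.lt_two_pow_self.le
  show (k : ℝ) ≤ 2 ^ k
  exact_mod_cast this

lemma geom (b : ℝ) : ExpGrowth (fun k => b ^ k) := by
  refine ⟨1, max 1 |b|, by norm_num, le_max_left _ _, fun k => ?_⟩
  rw [abs_pow, one_mul]
  exact pow_le_pow_left₀ (abs_nonneg b) (le_max_right _ _) k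

lemma add (hf : ExpGrowth f) (hg : ExpGrowth g) : ExpGrowth (fun k => f k + g k) := by
  obtain ⟨A, B, hA, hB, hf⟩ := hf
  obtain ⟨A', B', hA', hB', hg⟩ := hg
  refine ⟨A + A', max B B', by positivity, hB.trans (le_max_left _ _), fun k => ?_⟩
  calc |f k + g k| ≤ |f k| + |g k| := abs_add_le _ _
    _ ≤ A * B ^ k + A' * B' ^ k := add_le_add (hf k) (hg k)
    _ ≤ A * (max B B') ^ k + A' * (max B B') ^ k := by
        gcongr
        · exact le_max_left _ _
        · exact le_max_right _ _
    _ = _ := by ring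

lemma mul (hf : ExpGrowth f) (hg : ExpGrowth g) : ExpGrowth (fun k => f k * g k) := by
  obtain ⟨A, B, hA, hB, hf⟩ := hf
  obtain ⟨A', B', hA', hB', hg⟩ := hg
  refine ⟨A * A', B * B', by positivity, one_le_mul_of_one_le_of_one_le hB hB', fun k => ?_⟩
  rw [abs_mul, mul_pow]
  calc |f k| * |g k| ≤ (A * B ^ k) * (A' * B' ^ k) :=
        mul_le_mul (hf k) (hg k) (abs_nonneg _) (by positivity)
    _ = _ := by ring

lemma const_mul (c : ℝ) (hf : ExpGrowth f) : ExpGrowth (fun k => c * f k) := (const c).mul hf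

lemma neg (hf : ExpGrowth f) : ExpGrowth (fun k => - f k) := by
  simpa using hf.const_mul (-1)

lemma sub (hf : ExpGrowth f) (hg : ExpGrowth g) : ExpGrowth (fun k => f k - g k) := by
  simpa [sub_eq_add_neg] using hf.add hg.neg

lemma pow (hf : ExpGrowth f) (p : ℕ) : ExpGrowth (fun k => f k ^ p) := by
  induction p with
  | zero => simpa using const 1
  | succ p ih => simpa [pow_succ] using ih.mul hf

lemma shift (hf : ExpGrowth f) : ExpGrowth (fun k => f (k + 1)) := by
  obtain ⟨A, B, hA, hB, hf⟩ := hf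
  refine ⟨A * B, B, by positivity, hB, fun k => (hf (k + 1)).trans_eq (by ring)⟩

lemma abs (hf : ExpGrowth f) : ExpGrowth (fun k => |f k|) := by
  obtain ⟨A, B, hA, hB, hf⟩ := hf
  exact ⟨A, B, hA, hB, fun k => by simpa using hf k⟩

lemma summable (hf : ExpGrowth f) (t : ℝ) :
    Summable (fun k : ℕ => t ^ k / (k.factorial : ℝ) * f k) := by
  obtain ⟨A, B, hA, hB, hf⟩ := hf
  refine Summable.of_norm_bounded
    (g := fun k : ℕ => A * ((|t| * B) ^ k / (k.factorial : ℝ))) ?_ fun k => ?_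
  · exact (Real.summable_pow_div_factorial _).mul_left A
  · rw [norm_mul, norm_div, norm_pow, Real.norm_eq_abs, Real.norm_eq_abs, Real.norm_eq_abs,
      abs_of_nonneg (show (0 : ℝ) ≤ (k.factorial : ℝ) by positivity), mul_pow]
    calc |t| ^ k / (k.factorial : ℝ) * |f k| ≤ |t| ^ k / (k.factorial : ℝ) * (A * B ^ k) := by
          gcongr; exact hf k
      _ = _ := by ring

lemma integrable (hf : ExpGrowth f) (r : NNReal) : Integrable f (poissonMeasure r) := by
  rw [integrable_poissonMeasure_iff]
  have := (hf.abs.summable (r : ℝ)).mul_left (Real.exp (-r))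
  refine this.congr fun k => ?_
  rw [Real.norm_eq_abs]; ring

lemma memLp_two (hf : ExpGrowth f) (r : NNReal) : MemLp f 2 (poissonMeasure r) :=
  (memLp_two_iff_integrable_sq (measurable_of_countable f).aestronglyMeasurable).2
    ((hf.pow 2).integrable r)

end ExpGrowth

/-! ### Poisson expectations and their derivative in the mean -/

/-- The mean of `f` under the Poisson law with mean `s`. -/
noncomputable def pmean (s : ℝ) (f : ℕ → ℝ) : ℝ := ∫ k, f k ∂(poissonMeasure s.toNNReal)

section pmean

variable {s : ℝ} {f g : ℕ → ℝ}

lemma pmean_eq_tsum (hs : 0 ≤ s) (f : ℕ → ℝ) :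
    pmean s f = Real.exp (-s) * ∑' k : ℕ, s ^ k / (k.factorial : ℝ) * f k := by
  rw [pmean, integral_poissonMeasure, ← tsum_mul_left, Real.coe_toNNReal s hs]
  exact tsum_congr fun k => by rw [smul_eq_mul]; ring

lemma pmean_const (c : ℝ) : pmean s (fun _ => c) = c := by simp [pmean]

lemma pmean_add (hf : ExpGrowth f) (hg : ExpGrowth g) :
    pmean s (fun k => f k + g k) = pmean s f + pmean s g :=
  integral_add (hf.integrable _) (hg.integrable _)

lemma pmean_sub (hf : ExpGrowth f) (hg : ExpGrowth g) :
    pmean s (fun k => f k - g k) = pmean s f - pmean s g :=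
  integral_sub (hf.integrable _) (hg.integrable _)

lemma pmean_const_mul (c : ℝ) (f : ℕ → ℝ) :
    pmean s (fun k => c * f k) = c * pmean s f := integral_const_mul _ _

lemma pmean_mono (hf : ExpGrowth f) (hg : ExpGrowth g) (h : ∀ k, f k ≤ g k) :
    pmean s f ≤ pmean s g :=
  integral_mono (hf.integrable _) (hg.integrable _) h

lemma pmean_nonneg (h : ∀ k, 0 ≤ f k) : 0 ≤ pmean s f := integral_nonneg h

/-- The Stein-Chen identity: k s^k / k! = s · s^(k-1) / (k-1)!, and the term k = 0 vanishes. -/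
lemma pmean_mul_cast (hs : 0 ≤ s) (hf : ExpGrowth f) :
    pmean s (fun k => (k : ℝ) * f k) = s * pmean s (fun k => f (k + 1)) := by
  rw [pmean_eq_tsum hs, pmean_eq_tsum hs, (ExpGrowth.cast.mul hf).summable s |>.tsum_eq_zero_add,
    mul_left_comm s, ← tsum_mul_left]
  refine congrArg _ ?_
  simp only [pow_zero, Nat.cast_zero, zero_mul, mul_zero, zero_add]
  refine tsum_congr fun k => ?_
  rw [Nat.factorial_succ]
  push_cast
  have h1 : (k : ℝ) + 1 ≠ 0 := by positivity
  have h2 : (k.factorial : ℝ) ≠ 0 := by positivity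
  field_simp
  ring

lemma pmean_geom (hs : 0 ≤ s) (b : ℝ) :
    pmean s (fun k => b ^ k) = Real.exp (s * (b - 1)) := by
  rw [pmean_eq_tsum hs]
  have : ∀ k : ℕ, s ^ k / (k.factorial : ℝ) * b ^ k = (s * b) ^ k / (k.factorial : ℝ) :=
    fun k => by rw [mul_pow]; ring
  simp_rw [this]
  have h : ∑' k : ℕ, (s * b) ^ k / (k.factorial : ℝ) = Real.exp (s * b) := by
    rw [Real.exp_eq_exp_ℝ, NormedSpace.exp_eq_tsum_div]
  rw [h, ← Real.exp_add]
  congr 1; ring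

/-- Termwise differentiation of the power series shifts the argument of `f` by one; the factor
exp(-s) contributes the term -f(k). -/
lemma hasDerivAt_pmean (hs : 0 < s) (hf : ExpGrowth f) :
    HasDerivAt (fun t => pmean t f) (pmean s (fun k => f (k + 1) - f k)) s := by
  obtain ⟨A, B, hA, hB, hfb⟩ := id hf
  have key : HasDerivAt (fun t : ℝ => ∑' k : ℕ, t ^ k / (k.factorial : ℝ) * f k)
      (∑' k : ℕ, ((k : ℝ) * s ^ (k - 1)) / (k.factorial : ℝ) * f k) s := by
    -- The ball may contain negative t. This is harmless for the power series, which is identified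
    -- with `pmean` only near s > 0, in `heq` below.
    refine hasDerivAt_tsum_of_isPreconnected (t := Metric.ball s 1) (y₀ := s)
      (u := fun k : ℕ => ((k : ℝ) * (s + 1) ^ (k - 1)) / (k.factorial : ℝ) * (A * B ^ k))
      ?_ Metric.isOpen_ball (convex_ball s 1).isPreconnected
      (fun k t _ => ((hasDerivAt_pow k t).div_const _).mul_const _) (fun k t ht => ?_)
      (Metric.mem_ball_self one_pos) (hf.summable s) (Metric.mem_ball_self one_pos)
    · rw [← summable_nat_add_iff 1]
      refine ((Real.summable_pow_div_factorial ((s + 1) * B)).mul_left (A * B)).congr fun k => ?_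
      rw [Nat.factorial_succ, Nat.add_sub_cancel, mul_pow]
      push_cast
      have h1 : (k : ℝ) + 1 ≠ 0 := by positivity
      have h2 : (k.factorial : ℝ) ≠ 0 := by positivity
      field_simp
      ring
    · have htb : |t| ≤ s + 1 := by
        rw [Metric.mem_ball, Real.dist_eq, abs_lt] at ht
        rw [abs_le]; constructor <;> linarith
      rw [norm_mul, norm_div, norm_mul, norm_pow, Real.norm_eq_abs, Real.norm_eq_abs,
        Real.norm_eq_abs, Real.norm_eq_abs,
        abs_of_nonneg (show (0 : ℝ) ≤ (k.factorial : ℝ) by positivity),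
        abs_of_nonneg (show (0 : ℝ) ≤ (k : ℝ) by positivity)]
      gcongr
      exact hfb k
  have hshift : (∑' k : ℕ, ((k : ℝ) * s ^ (k - 1)) / (k.factorial : ℝ) * f k)
      = ∑' k : ℕ, s ^ k / (k.factorial : ℝ) * f (k + 1) := by
    have hsum : Summable fun k : ℕ => ((k : ℝ) * s ^ (k - 1)) / (k.factorial : ℝ) * f k := by
      rw [← summable_nat_add_iff 1]
      refine (hf.shift.summable s).congr fun k => ?_
      rw [Nat.factorial_succ, Nat.add_sub_cancel]
      push_cast
      have h1 : (k : ℝ) + 1 ≠ 0 := by positivity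
      have h2 : (k.factorial : ℝ) ≠ 0 := by positivity
      field_simp
    rw [hsum.tsum_eq_zero_add]
    simp only [Nat.cast_zero, zero_mul, zero_div, zero_add]
    refine tsum_congr fun k => ?_
    rw [Nat.factorial_succ, Nat.add_sub_cancel]
    push_cast
    have h1 : (k : ℝ) + 1 ≠ 0 := by positivity
    have h2 : (k.factorial : ℝ) ≠ 0 := by positivity
    field_simp
  rw [hshift] at key
  have h3 := ((hasDerivAt_neg s).exp).mul key
  have heq : (fun t => pmean t f) =ᶠ[𝓝 s]
      fun t => Real.exp (-t) * ∑' k : ℕ, t ^ k / (k.factorial : ℝ) * f k := by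
    filter_upwards [lt_mem_nhds hs] with t ht using pmean_eq_tsum ht.le f
  refine (h3.congr_of_eventuallyEq heq).congr_deriv ?_
  rw [pmean_sub hf.shift hf, pmean_eq_tsum hs.le, pmean_eq_tsum hs.le]
  ring

end pmean

/-! ### Moments of the count and of 1/(k+1) -/

section moments

variable {s : ℝ}

lemma pmean_cast (hs : 0 ≤ s) : pmean s (fun k => (k : ℝ)) = s := by
  have := pmean_mul_cast hs (ExpGrowth.const 1)
  simpa [pmean_const] using this

lemma pmean_cast_sq (hs : 0 ≤ s) : pmean s (fun k => (k : ℝ) ^ 2) = s ^ 2 + s := by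
  have h := pmean_mul_cast hs ExpGrowth.cast
  have e : ∀ k : ℕ, ((k + 1 : ℕ) : ℝ) = (k : ℝ) + 1 := fun k => by push_cast; ring
  simp only [e, pmean_add ExpGrowth.cast (ExpGrowth.const 1), pmean_cast hs, pmean_const] at h
  simp only [pow_two] at *
  linarith

lemma growth_inv : ExpGrowth (fun k => ((k : ℝ))⁻¹) := by
  refine (ExpGrowth.const 1).of_abs_le fun k => ?_
  rw [abs_one, abs_of_nonneg (by positivity)]
  rcases Nat.eq_zero_or_pos k with rfl | hk
  · simp
  · exact inv_le_one_of_one_le₀ (by exact_mod_cast hk)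

lemma growth_inv_succ : ExpGrowth (fun k => ((k : ℝ) + 1)⁻¹) := by
  simpa using growth_inv.shift

/-- By the Stein-Chen identity, s E[1/(k+1)] = E[k · k⁻¹], the probability of a nonzero count. -/
lemma pmean_inv_succ_le (hs : 0 < s) : pmean s (fun k => ((k : ℝ) + 1)⁻¹) ≤ 1 / s := by
  have h := pmean_mul_cast hs.le growth_inv
  have h1 : pmean s (fun k => (k : ℝ) * (k : ℝ)⁻¹) ≤ 1 := by
    rw [← pmean_const (s := s) 1]
    refine pmean_mono (ExpGrowth.cast.mul growth_inv) (ExpGrowth.const 1) fun k => ?_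
    exact mul_inv_le_one
  rw [h] at h1
  rw [le_div_iff₀ hs, mul_comm]
  simpa using h1

/-- Jensen's inequality for 1/x, through the tangent line at x = s + 1; the difference from the
tangent is an explicit square. -/
lemma le_pmean_inv_succ (hs : 0 < s) : 1 / (s + 1) ≤ pmean s (fun k => ((k : ℝ) + 1)⁻¹) := by
  have h : pmean s (fun k => (2 / (s + 1) - 1 / (s + 1) ^ 2) - 1 / (s + 1) ^ 2 * (k : ℝ))
      = 1 / (s + 1) := by
    rw [pmean_sub (ExpGrowth.const _) (ExpGrowth.cast.const_mul _), pmean_const, pmean_const_mul,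
      pmean_cast hs.le]
    field_simp; ring
  rw [← h]
  refine pmean_mono ((ExpGrowth.const _).sub (ExpGrowth.cast.const_mul _)) growth_inv_succ
    fun k => ?_
  have hk : (0 : ℝ) < (k : ℝ) + 1 := by positivity
  have hs1 : 0 < s + 1 := by positivity
  rw [← sub_nonneg]
  have : ((k : ℝ) + 1)⁻¹ - ((2 / (s + 1) - 1 / (s + 1) ^ 2) - 1 / (s + 1) ^ 2 * (k : ℝ))
      = ((k : ℝ) - s) ^ 2 / ((s + 1) ^ 2 * ((k : ℝ) + 1)) := by
    field_simp; ring
  rw [this]; positivity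

end moments

/-! ### Differences of k log k -/

section xlog

/-- `k log k`. -/
noncomputable def xlog (k : ℕ) : ℝ := (k : ℝ) * Real.log (k : ℝ)

lemma growth_log : ExpGrowth (fun k => Real.log (k : ℝ)) := by
  refine ExpGrowth.cast.of_abs_le fun k => ?_
  rw [abs_of_nonneg (Real.log_natCast_nonneg k), abs_of_nonneg (by positivity)]
  rcases Nat.eq_zero_or_pos k with rfl | hk
  · simp
  · have : (0 : ℝ) < k := by exact_mod_cast hk
    linarith [Real.log_le_sub_one_of_pos this]

lemma growth_xlog : ExpGrowth xlog := ExpGrowth.cast.mul growth_log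

lemma growth_log_succ : ExpGrowth (fun k => Real.log ((k : ℝ) + 1)) := by
  simpa using growth_log.shift

/-- The difference is log(k+1) + k log((k+1)/k). The last term is at most 1, and at least 1 -
1/(k+1) for k ≥ 1; `le_xlog_diff` gives the other side. -/
lemma xlog_diff_le (k : ℕ) : xlog (k + 1) - xlog k ≤ Real.log ((k : ℝ) + 1) + 1 := by
  rcases Nat.eq_zero_or_pos k with rfl | hk
  · simp [xlog]
  · have hk' : (0 : ℝ) < k := by exact_mod_cast hk
    have h := Real.log_le_sub_one_of_pos (show 0 < ((k : ℝ) + 1) / k by positivity)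
    rw [Real.log_div (by positivity) hk'.ne'] at h
    have h2 : (k : ℝ) * (Real.log ((k : ℝ) + 1) - Real.log k) ≤ 1 := by
      calc _ ≤ (k : ℝ) * (((k : ℝ) + 1) / k - 1) := by gcongr
        _ = 1 := by field_simp; ring
    simp only [xlog]; push_cast
    linarith

lemma le_xlog_diff (k : ℕ) :
    Real.log ((k : ℝ) + 1) + (1 - ((k : ℝ) + 1)⁻¹) ≤ xlog (k + 1) - xlog k := by
  rcases Nat.eq_zero_or_pos k with rfl | hk
  · simp [xlog]
  · have hk' : (0 : ℝ) < k := by exact_mod_cast hk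
    have h := Real.one_sub_inv_le_log_of_pos (show 0 < ((k : ℝ) + 1) / k by positivity)
    rw [Real.log_div (by positivity) hk'.ne'] at h
    have h2 : 1 - ((k : ℝ) + 1)⁻¹ ≤ (k : ℝ) * (Real.log ((k : ℝ) + 1) - Real.log k) := by
      calc _ = (k : ℝ) * (1 - (((k : ℝ) + 1) / k)⁻¹) := by field_simp; ring
        _ ≤ _ := by gcongr
    simp only [xlog]; push_cast
    linarith

lemma xlog_second_diff (k : ℕ) :
    xlog (k + 2) - xlog (k + 1) - (xlog (k + 1) - xlog k)
      = ((k : ℝ) + 2) * Real.log (1 + ((k : ℝ) + 1)⁻¹)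
        + (k : ℝ) * Real.log ((k : ℝ) / ((k : ℝ) + 1)) := by
  have e : 1 + ((k : ℝ) + 1)⁻¹ = ((k : ℝ) + 2) / ((k : ℝ) + 1) := by field_simp; ring
  rw [e, Real.log_div (by positivity) (by positivity)]
  rcases Nat.eq_zero_or_pos k with rfl | hk
  · simp [xlog]
  · have hk' : (0 : ℝ) < k := by exact_mod_cast hk
    rw [Real.log_div hk'.ne' (by positivity)]
    simp only [xlog]; push_cast
    ring

lemma xlog_second_diff_le (k : ℕ) :
    xlog (k + 2) - xlog (k + 1) - (xlog (k + 1) - xlog k) ≤ 2 * ((k : ℝ) + 1)⁻¹ := by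
  rw [xlog_second_diff]
  have h1 : ((k : ℝ) + 2) * Real.log (1 + ((k : ℝ) + 1)⁻¹)
      ≤ ((k : ℝ) + 2) * ((k : ℝ) + 1)⁻¹ := by
    gcongr
    linarith [Real.log_le_sub_one_of_pos (show 0 < 1 + ((k : ℝ) + 1)⁻¹ by positivity)]
  have h2 : (k : ℝ) * Real.log ((k : ℝ) / ((k : ℝ) + 1)) ≤ (k : ℝ) * (- ((k : ℝ) + 1)⁻¹) := by
    rcases Nat.eq_zero_or_pos k with rfl | hk
    · simp
    · have hk' : (0 : ℝ) < k := by exact_mod_cast hk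
      gcongr
      refine (Real.log_le_sub_one_of_pos (by positivity)).trans_eq ?_
      field_simp; ring
  refine (add_le_add h1 h2).trans_eq ?_
  field_simp; ring

/-- The bound log(1+x) ≥ x/(1+x) would only give 0 here. The sharper log(1+x) ≥ 2x/(x+2) at x =
1/(k+1) leaves 1/(2k+3). Strict convexity of k log k at this rate is what keeps V - Q of order n. -/
lemma le_xlog_second_diff (k : ℕ) :
    1 / 3 * ((k : ℝ) + 1)⁻¹ ≤ xlog (k + 2) - xlog (k + 1) - (xlog (k + 1) - xlog k) := by
  rw [xlog_second_diff]
  have hx : (0 : ℝ) < ((k : ℝ) + 1)⁻¹ := by positivity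
  have h1 : ((k : ℝ) + 2) * (2 * ((k : ℝ) + 1)⁻¹ / (((k : ℝ) + 1)⁻¹ + 2))
      ≤ ((k : ℝ) + 2) * Real.log (1 + ((k : ℝ) + 1)⁻¹) := by
    gcongr
    exact Real.le_log_one_add_of_nonneg hx.le
  -- Written with k/k so that the bound is also true at k = 0, where k/k = 0.
  have h2 : -((k : ℝ) / k) ≤ (k : ℝ) * Real.log ((k : ℝ) / ((k : ℝ) + 1)) := by
    rcases Nat.eq_zero_or_pos k with rfl | hk
    · simp
    · have hk' : (0 : ℝ) < k := by exact_mod_cast hk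
      calc -((k : ℝ) / k) = (k : ℝ) * (1 - ((k : ℝ) / ((k : ℝ) + 1))⁻¹) := by field_simp; ring
        _ ≤ _ := by
          gcongr
          exact Real.one_sub_inv_le_log_of_pos (by positivity)
  have h3 : (k : ℝ) / k ≤ 1 := div_self_le_one _
  have h4 : ((k : ℝ) + 2) * (2 * ((k : ℝ) + 1)⁻¹ / (((k : ℝ) + 1)⁻¹ + 2)) - 1
      = 1 / (2 * (k : ℝ) + 3) := by field_simp; ring
  have h5 : 1 / 3 * ((k : ℝ) + 1)⁻¹ ≤ 1 / (2 * (k : ℝ) + 3) := by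
    rw [← one_div, one_div_mul_one_div]
    apply one_div_le_one_div_of_le <;> nlinarith [(Nat.cast_nonneg k : (0 : ℝ) ≤ k)]
  linarith

end xlog

/-! ### Projection on the first two Charlier polynomials -/

section charlier

variable {s : ℝ} {f : ℕ → ℝ}

lemma pmean_mul_sub (hs : 0 ≤ s) (hf : ExpGrowth f) :
    pmean s (fun k => f k * ((k : ℝ) - s)) = s * pmean s (fun k => f (k + 1) - f k) := by
  have e : ∀ k : ℕ, f k * ((k : ℝ) - s) = (k : ℝ) * f k - s * f k := fun k => by ring
  simp only [e]
  rw [pmean_sub (ExpGrowth.cast.mul hf) (hf.const_mul s), pmean_sub hf.shift hf,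
    pmean_mul_cast hs hf, pmean_const_mul]
  ring

/-- Two applications of the Stein-Chen identity: pairing with the second Charlier polynomial takes
the mean of the second difference. -/
lemma pmean_mul_charlier (hs : 0 ≤ s) (hf : ExpGrowth f) :
    pmean s (fun k => f k * (((k : ℝ) - s) ^ 2 - k))
      = s ^ 2 * pmean s (fun k => f (k + 2) - f (k + 1) - (f (k + 1) - f k)) := by
  have hc := ExpGrowth.cast
  have e : ∀ k : ℕ, f k * (((k : ℝ) - s) ^ 2 - k)
      = (k : ℝ) * ((k : ℝ) * f k) - (2 * s + 1) * ((k : ℝ) * f k) + s ^ 2 * f k :=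
    fun k => by ring
  have e2 : ∀ k : ℕ, ((k + 1 : ℕ) : ℝ) * f (k + 1) = (k : ℝ) * f (k + 1) + f (k + 1) :=
    fun k => by push_cast; ring
  have h1 := pmean_mul_cast hs (hc.mul hf)
  have h2 := pmean_mul_cast hs hf.shift
  simp only [e2] at h1
  simp only [e]
  rw [pmean_add ((hc.mul (hc.mul hf)).sub ((hc.mul hf).const_mul _)) (hf.const_mul _),
    pmean_sub (hc.mul (hc.mul hf)) ((hc.mul hf).const_mul _), pmean_const_mul, pmean_const_mul,
    h1, pmean_add (hc.mul hf.shift) hf.shift, h2, pmean_mul_cast hs hf,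
    pmean_sub (hf.shift.shift.sub hf.shift) (hf.shift.sub hf), pmean_sub hf.shift.shift hf.shift,
    pmean_sub hf.shift hf]
  ring

lemma growth_sub : ExpGrowth (fun k => (k : ℝ) - s) := ExpGrowth.cast.sub (ExpGrowth.const s)

lemma pmean_sub_sq (hs : 0 ≤ s) : pmean s (fun k => ((k : ℝ) - s) ^ 2) = s := by
  have h := pmean_mul_sub hs (growth_sub (s := s))
  have e : ∀ k : ℕ, ((k + 1 : ℕ) : ℝ) - s - ((k : ℝ) - s) = 1 := fun k => by push_cast; ring
  simp only [e, pmean_const, mul_one, ← pow_two] at h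
  exact h

/-- The residual of a function of a Poisson count, after regression on the count, has variance at
least the part explained by the second Charlier polynomial. -/
lemma charlier_le_residual (hs : 0 < s) (hf : ExpGrowth f) :
    s ^ 2 * pmean s (fun k => f (k + 2) - f (k + 1) - (f (k + 1) - f k)) ^ 2 / 2
      ≤ Var[f; poissonMeasure s.toNNReal] - s * pmean s (fun k => f (k + 1) - f k) ^ 2 := by
  set a := pmean s (fun k => f (k + 1) - f k) with ha
  set b := pmean s (fun k => f (k + 2) - f (k + 1) - (f (k + 1) - f k)) with hb
  set m := pmean s f with hm
  have hu : ExpGrowth (fun k => f k - m) := hf.sub (ExpGrowth.const m)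
  have hp := growth_sub (s := s)
  have hq : ExpGrowth (fun k => ((k : ℝ) - s) ^ 2 - k) := (hp.pow 2).sub ExpGrowth.cast
  have hvar : Var[f; poissonMeasure s.toNNReal] = pmean s (fun k => (f k - m) ^ 2) :=
    variance_eq_integral (measurable_of_countable f).aemeasurable
  have h1 : pmean s (fun k => (f k - m) * ((k : ℝ) - s)) = s * a := by
    rw [pmean_mul_sub hs.le hu, ha]; simp
  have h2 : pmean s (fun k => (f k - m) * (((k : ℝ) - s) ^ 2 - k)) = s ^ 2 * b := by
    rw [pmean_mul_charlier hs.le hu, hb]; simp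
  have h3 : pmean s (fun k => ((k : ℝ) - s) * (((k : ℝ) - s) ^ 2 - k)) = 0 := by
    rw [pmean_mul_charlier hs.le hp]
    have e : ∀ k : ℕ, ((k + 2 : ℕ) : ℝ) - s - (((k + 1 : ℕ) : ℝ) - s)
      - (((k + 1 : ℕ) : ℝ) - s - ((k : ℝ) - s)) = 0 := fun k => by push_cast; ring
    simp only [e, pmean_const, mul_zero]
  have h4 : pmean s (fun k => (((k : ℝ) - s) ^ 2 - k) * (((k : ℝ) - s) ^ 2 - k)) = 2 * s ^ 2 := by
    rw [pmean_mul_charlier hs.le hq]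
    have e : ∀ k : ℕ, (((k + 2 : ℕ) : ℝ) - s) ^ 2 - ((k + 2 : ℕ) : ℝ)
      - ((((k + 1 : ℕ) : ℝ) - s) ^ 2 - ((k + 1 : ℕ) : ℝ))
      - ((((k + 1 : ℕ) : ℝ) - s) ^ 2 - ((k + 1 : ℕ) : ℝ) - (((k : ℝ) - s) ^ 2 - k)) = 2 :=
      fun k => by push_cast; ring
    simp only [e, pmean_const]; ring
  -- Bessel's inequality. The polynomials k - s and (k-s)² - k are orthogonal with squared norms s
  -- and 2s², and their products with f - m have means s·a and s²·b; hence the coefficients a and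
  -- b/2.
  have h0 : 0 ≤ pmean s (fun k => ((f k - m) - a * ((k : ℝ) - s)
      - b / 2 * (((k : ℝ) - s) ^ 2 - k)) ^ 2) := pmean_nonneg fun k => sq_nonneg _
  have e : ∀ k : ℕ, ((f k - m) - a * ((k : ℝ) - s) - b / 2 * (((k : ℝ) - s) ^ 2 - k)) ^ 2
      = (f k - m) ^ 2 + (a ^ 2 * (((k : ℝ) - s) ^ 2) +
        ((b / 2) ^ 2 * ((((k : ℝ) - s) ^ 2 - k) * (((k : ℝ) - s) ^ 2 - k))
        + (-(2 * a) * ((f k - m) * ((k : ℝ) - s))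
        + (-b * ((f k - m) * (((k : ℝ) - s) ^ 2 - k))
        + (a * b) * (((k : ℝ) - s) * (((k : ℝ) - s) ^ 2 - k)))))) := fun k => by ring
  have g6 := (hp.mul hq).const_mul (a * b)
  have g5 := (hu.mul hq).const_mul (-b)
  have g4 := (hu.mul hp).const_mul (-(2 * a))
  have g3 := (hq.mul hq).const_mul ((b / 2) ^ 2)
  have g2 := (hp.pow 2).const_mul (a ^ 2)
  simp only [e] at h0
  rw [pmean_add (hu.pow 2) (g2.add (g3.add (g4.add (g5.add g6)))),
    pmean_add g2 (g3.add (g4.add (g5.add g6))), pmean_add g3 (g4.add (g5.add g6)),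
    pmean_add g4 (g5.add g6), pmean_add g5 g6, pmean_const_mul, pmean_const_mul, pmean_const_mul,
    pmean_const_mul, pmean_const_mul, h1, h2, h3, h4, pmean_sub_sq hs.le, ← hvar] at h0
  nlinarith [h0]

end charlier

/-! ### The deviance of one bin: mean, slope, residual variance and moments -/

section dev

/-- The contribution of one bin to the `C` function. -/
noncomputable def dev (s : ℝ) (k : ℕ) : ℝ :=
  2 * (s - (k : ℝ) * Real.log s - (k : ℝ) + (k : ℝ) * Real.log (k : ℝ))

/-- The derivative in `s` of the mean of `dev s` under the Poisson law with mean `s`. -/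
noncomputable def slope (s : ℝ) : ℝ :=
  2 * (pmean s (fun k => xlog (k + 1) - xlog k) - (Real.log s + 1))

variable {s : ℝ}

lemma growth_dev (s : ℝ) : ExpGrowth (dev s) := by
  have h := ((((ExpGrowth.const s).sub (ExpGrowth.cast.mul (ExpGrowth.const (Real.log s)))).sub
    ExpGrowth.cast).add growth_xlog).const_mul 2
  exact h

lemma dev_nonneg (hs : 0 < s) (k : ℕ) : 0 ≤ dev s k := by
  rcases Nat.eq_zero_or_pos k with rfl | hk
  · simp [dev, hs.le]
  · have hk' : (0 : ℝ) < k := by exact_mod_cast hk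
    have h := Real.one_sub_inv_le_log_of_pos (show 0 < (k : ℝ) / s by positivity)
    rw [Real.log_div hk'.ne' hs.ne', inv_div] at h
    have h2 : (k : ℝ) - s ≤ k * (Real.log k - Real.log s) := by
      calc (k : ℝ) - s = k * (1 - s / k) := by field_simp
        _ ≤ _ := by gcongr
    unfold dev
    nlinarith

/-- From log x ≤ x - 1 at x = k/s; the resulting expression is exactly twice the Pearson statistic.
This reduces moments of the deviance to those of the standardized count. -/
lemma dev_le (hs : 0 < s) (k : ℕ) : dev s k ≤ 2 * (((k : ℝ) - s) / Real.sqrt s) ^ 2 := by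
  rw [div_pow, Real.sq_sqrt hs.le]
  have h2 : (k : ℝ) * (Real.log k - Real.log s) ≤ k * (k / s - 1) := by
    rcases Nat.eq_zero_or_pos k with rfl | hk
    · simp
    · have hk' : (0 : ℝ) < k := by exact_mod_cast hk
      have h := Real.log_le_sub_one_of_pos (show 0 < (k : ℝ) / s by positivity)
      rw [Real.log_div hk'.ne' hs.ne'] at h
      gcongr
  have h3 : ((k : ℝ) - s) ^ 2 / s = s - k + k * (k / s - 1) := by field_simp; ring
  rw [h3]; unfold dev
  nlinarith

lemma pmean_dev (hs : 0 ≤ s) : pmean s (dev s) = 2 * (pmean s xlog - s * Real.log s) := by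
  have e : ∀ k, dev s k = 2 * ((s - (Real.log s + 1) * (k : ℝ)) + xlog k) := fun k => by
    unfold dev xlog; ring
  rw [funext e, pmean_const_mul, pmean_add ((ExpGrowth.const s).sub (ExpGrowth.cast.const_mul _))
    growth_xlog, pmean_sub (ExpGrowth.const s) (ExpGrowth.cast.const_mul _), pmean_const,
    pmean_const_mul, pmean_cast hs]
  ring

lemma hasDerivAt_pmean_dev (hs : 0 < s) :
    HasDerivAt (fun t => pmean t (dev t)) (slope s) s := by
  have h1 := ((hasDerivAt_pmean hs growth_xlog).sub (Real.hasDerivAt_mul_log hs.ne')).const_mul 2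
  refine h1.congr_of_eventuallyEq ?_
  filter_upwards [lt_mem_nhds hs] with t ht using pmean_dev ht.le

lemma hasDerivAt_slope (hs : 0 < s) :
    HasDerivAt slope
      (2 * (pmean s (fun k => xlog (k + 2) - xlog (k + 1) - (xlog (k + 1) - xlog k)) - s⁻¹)) s := by
  exact ((hasDerivAt_pmean hs (growth_xlog.shift.sub growth_xlog)).sub
    ((Real.hasDerivAt_log hs.ne').add_const 1)).const_mul 2

lemma growth_xlog_second : ExpGrowth
    (fun k => xlog (k + 2) - xlog (k + 1) - (xlog (k + 1) - xlog k)) :=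
  (growth_xlog.shift.shift.sub growth_xlog.shift).sub (growth_xlog.shift.sub growth_xlog)

lemma le_pmean_second (hs : 0 < s) : 1 / (3 * (s + 1)) ≤
    pmean s (fun k => xlog (k + 2) - xlog (k + 1) - (xlog (k + 1) - xlog k)) := by
  have h := pmean_mono (s := s) (growth_inv_succ.const_mul (1 / 3)) growth_xlog_second
    le_xlog_second_diff
  rw [pmean_const_mul] at h
  have h2 := le_pmean_inv_succ hs
  calc 1 / (3 * (s + 1)) = 1 / 3 * (1 / (s + 1)) := by field_simp
    _ ≤ 1 / 3 * _ := by gcongr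
    _ ≤ _ := h

/-- The mean second difference of k log k lies between 0 and 2/s, so it is within 1/s of 1/s. -/
lemma abs_deriv_slope_le (hs : 0 < s) :
    |2 * (pmean s (fun k => xlog (k + 2) - xlog (k + 1) - (xlog (k + 1) - xlog k)) - s⁻¹)|
      ≤ 2 / s := by
  have h1 := le_pmean_second hs
  have h0 : 0 < 1 / (3 * (s + 1)) := by positivity
  have h := pmean_mono (s := s) growth_xlog_second (growth_inv_succ.const_mul 2)
    xlog_second_diff_le
  rw [pmean_const_mul] at h
  have h2 := pmean_inv_succ_le hs
  rw [inv_eq_one_div]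
  have : 2 / s = 2 * (1 / s) := by ring
  rw [this, abs_le]
  constructor <;> linarith

/-- The mean first difference of k log k is E[log(k+1)] + 1 up to an error in [-E[1/(k+1)], 0], and
E[log(k+1)] lies between log s and log s + 1/s. -/
lemma abs_slope_le (hs : 0 < s) : |slope s| ≤ 2 / s := by
  have hl := growth_log_succ
  have h1 := pmean_mono (s := s) (growth_xlog.shift.sub growth_xlog)
    (hl.add (ExpGrowth.const 1)) xlog_diff_le
  have h2 := pmean_mono (s := s) (hl.add ((ExpGrowth.const 1).sub growth_inv_succ))
    (growth_xlog.shift.sub growth_xlog) le_xlog_diff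
  rw [pmean_add hl (ExpGrowth.const 1), pmean_const] at h1
  rw [pmean_add hl ((ExpGrowth.const 1).sub growth_inv_succ),
    pmean_sub (ExpGrowth.const 1) growth_inv_succ, pmean_const] at h2
  have h3 := pmean_inv_succ_le hs
  have h4 : pmean s (fun k => Real.log ((k : ℝ) + 1)) ≤ Real.log s + 1 / s := by
    have : pmean s (fun k => (Real.log s + (1 / s - 1)) + 1 / s * (k : ℝ))
        = Real.log s + 1 / s := by
      rw [pmean_add (ExpGrowth.const _) (ExpGrowth.cast.const_mul _), pmean_const,
        pmean_const_mul, pmean_cast hs.le]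
      field_simp; ring
    rw [← this]
    refine pmean_mono hl ((ExpGrowth.const _).add (ExpGrowth.cast.const_mul _)) fun k => ?_
    have h := Real.log_le_sub_one_of_pos (show 0 < ((k : ℝ) + 1) / s by positivity)
    rw [Real.log_div (by positivity) hs.ne'] at h
    have e : ((k : ℝ) + 1) / s - 1 = (1 / s - 1) + 1 / s * (k : ℝ) := by ring
    linarith
  have h5 : Real.log s ≤ pmean s (fun k => Real.log ((k : ℝ) + 1)) := by
    have h6 : pmean s (fun k => (Real.log s + 1) - s * ((k : ℝ) + 1)⁻¹)
        ≤ pmean s (fun k => Real.log ((k : ℝ) + 1)) := by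
      refine pmean_mono ((ExpGrowth.const _).sub (growth_inv_succ.const_mul _)) hl fun k => ?_
      have h := Real.one_sub_inv_le_log_of_pos (show 0 < ((k : ℝ) + 1) / s by positivity)
      rw [Real.log_div (by positivity) hs.ne', inv_div, div_eq_mul_inv] at h
      linarith
    rw [pmean_sub (ExpGrowth.const _) (growth_inv_succ.const_mul _), pmean_const,
      pmean_const_mul] at h6
    have : s * pmean s (fun k => ((k : ℝ) + 1)⁻¹) ≤ 1 := by
      calc _ ≤ s * (1 / s) := by gcongr
        _ = 1 := by field_simp
    linarith
  have e : 2 / s = 2 * (1 / s) := by ring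
  unfold slope
  rw [e, abs_le]
  constructor <;> linarith

/-- The link between the two roles of `slope`: by `hasDerivAt_pmean_dev` it is the derivative of the
mean deviance, and through this identity it is the regression coefficient of the deviance on the
count. -/
lemma pmean_dev_diff : pmean s (fun k => dev s (k + 1) - dev s k) = slope s := by
  have e : ∀ k, dev s (k + 1) - dev s k
      = 2 * ((xlog (k + 1) - xlog k) - (Real.log s + 1)) := fun k => by
    unfold dev xlog; push_cast; ring
  rw [funext e, pmean_const_mul, pmean_sub (growth_xlog.shift.sub growth_xlog)
    (ExpGrowth.const _), pmean_const, slope]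

/-- The covariance of the deviance and the count. -/
lemma cov_dev_cast (hs : 0 ≤ s) :
    cov[dev s, fun k => (k : ℝ); poissonMeasure s.toNNReal] = s * slope s := by
  rw [covariance_eq_sub ((growth_dev s).memLp_two _) (ExpGrowth.cast.memLp_two _)]
  have h := pmean_mul_cast hs (growth_dev s)
  have h1 := pmean_sub (s := s) (growth_dev s).shift (growth_dev s)
  rw [pmean_dev_diff] at h1
  have h2 := pmean_cast hs
  unfold pmean at h h1 h2
  have e : (dev s * fun k : ℕ => (k : ℝ)) = fun k : ℕ => (k : ℝ) * dev s k := by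
    ext k; simp [mul_comm]
  rw [e, h, h1, h2]; ring

/-- The second difference of `dev` is twice that of k log k, so its mean is at least 2/(3(s+1));
this goes into the Charlier bound. -/
lemma residual_dev_ge (hs : 0 < s) :
    2 / 9 * (s / (s + 1)) ^ 2 ≤ Var[dev s; poissonMeasure s.toNNReal] - s * slope s ^ 2 := by
  have h := charlier_le_residual hs (growth_dev s)
  rw [pmean_dev_diff] at h
  refine le_trans ?_ h
  have e : ∀ k, dev s (k + 2) - dev s (k + 1) - (dev s (k + 1) - dev s k)
      = 2 * (xlog (k + 2) - xlog (k + 1) - (xlog (k + 1) - xlog k)) := fun k => by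
    unfold dev xlog; push_cast; ring
  rw [funext e, pmean_const_mul]
  have h1 := le_pmean_second hs
  calc 2 / 9 * (s / (s + 1)) ^ 2 = s ^ 2 * (2 * (1 / (3 * (s + 1)))) ^ 2 / 2 := by
        field_simp; ring
    _ ≤ _ := by gcongr

/-- The standardized count has bounded eighth moment, uniformly in means bounded away from `0`. -/
lemma exists_pmean_pow_eight_le {ε : ℝ} (hε : 0 < ε) : ∃ K : ℝ, 0 ≤ K ∧ ∀ s, ε ≤ s →
    pmean s (fun k => (((k : ℝ) - s) / Real.sqrt s) ^ 8) ≤ K := by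
  -- With u = t/√s this gives u ≤ 1 and s u² ≤ 1. For |v| = u the exponential moment exp(s(e^v - 1 -
  -- v)) is then at most exp(s v²) ≤ e, and the eighth power is dominated through y⁸/8! ≤ e^y.
  set t := min 1 (Real.sqrt ε) with ht
  have ht0 : 0 < t := lt_min one_pos (Real.sqrt_pos.2 hε)
  refine ⟨(Nat.factorial 8 : ℝ) / t ^ 8 * (2 * Real.exp 1), by positivity, fun s hs => ?_⟩
  have hs0 : 0 < s := hε.trans_le hs
  have hr : 0 < Real.sqrt s := Real.sqrt_pos.2 hs0
  set u := t / Real.sqrt s with hu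
  have hu0 : 0 < u := by positivity
  have hu1 : u ≤ 1 := by
    rw [hu, div_le_one hr]
    exact (min_le_right _ _).trans (Real.sqrt_le_sqrt hs)
  have hsu : s * u ^ 2 ≤ 1 := by
    rw [hu, div_pow, Real.sq_sqrt hs0.le, mul_div_cancel₀ _ hs0.ne']
    exact pow_le_one₀ ht0.le (min_le_left _ _)
  have hexp : ∀ v : ℝ, |v| = u → pmean s (fun k => Real.exp (v * ((k : ℝ) - s))) ≤ Real.exp 1 := by
    intro v hv
    have e : ∀ k : ℕ, Real.exp (v * ((k : ℝ) - s)) = Real.exp (-(v * s)) * Real.exp v ^ k :=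
      fun k => by rw [← Real.exp_nat_mul, ← Real.exp_add]; congr 1; ring
    simp only [e]
    rw [pmean_const_mul, pmean_geom hs0.le, ← Real.exp_add]
    apply Real.exp_le_exp.2
    have h := (abs_le.1 (Real.abs_exp_sub_one_sub_id_le (x := v) (hv.le.trans hu1))).2
    have hv2 : v ^ 2 = u ^ 2 := by rw [← hv, sq_abs]
    rw [hv2] at h
    nlinarith
  have hgrow : ∀ v : ℝ, ExpGrowth (fun k => Real.exp (v * ((k : ℝ) - s))) := fun v => by
    have e : ∀ k : ℕ, Real.exp (v * ((k : ℝ) - s)) = Real.exp (-(v * s)) * Real.exp v ^ k :=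
      fun k => by rw [← Real.exp_nat_mul, ← Real.exp_add]; congr 1; ring
    simp only [e]
    exact (ExpGrowth.geom _).const_mul _
  have hz : ExpGrowth (fun k => (((k : ℝ) - s) / Real.sqrt s) ^ 8) := by
    simp only [div_eq_mul_inv]
    exact ((growth_sub (s := s)).mul (ExpGrowth.const _)).pow 8
  have hle : ∀ k : ℕ, (((k : ℝ) - s) / Real.sqrt s) ^ 8 ≤ (Nat.factorial 8 : ℝ) / t ^ 8 *
      (Real.exp (u * ((k : ℝ) - s)) + Real.exp (-u * ((k : ℝ) - s))) := fun k => by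
    set z := ((k : ℝ) - s) / Real.sqrt s with hz
    have h1 := Real.pow_div_factorial_le_exp |t * z| (abs_nonneg _) 8
    have h2 : Real.exp |t * z| ≤ Real.exp (u * ((k : ℝ) - s)) + Real.exp (-u * ((k : ℝ) - s)) := by
      have e : u * ((k : ℝ) - s) = t * z := by rw [hu, hz]; ring
      rw [neg_mul, e]
      rcases abs_cases (t * z) with h | h <;> rw [h.1]
      · linarith [Real.exp_pos (-(t * z))]
      · linarith [Real.exp_pos (t * z)]
    have h3 : |t * z| ^ 8 = t ^ 8 * z ^ 8 := by
      rw [Even.pow_abs (by decide), mul_pow]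
    rw [h3] at h1
    have h4 : z ^ 8 = (Nat.factorial 8 : ℝ) / t ^ 8 * (t ^ 8 * z ^ 8 / (Nat.factorial 8 : ℝ)) := by
      field_simp
    rw [h4]
    gcongr
    exact h1.trans h2
  refine (pmean_mono hz (((hgrow u).add (hgrow (-u))).const_mul _) hle).trans ?_
  rw [pmean_const_mul, pmean_add (hgrow u) (hgrow (-u))]
  gcongr
  linarith [hexp u (abs_of_pos hu0), hexp (-u) (by rw [abs_neg, abs_of_pos hu0])]

lemma exists_pmean_dev_pow_four_le {ε : ℝ} (hε : 0 < ε) : ∃ K : ℝ, 0 ≤ K ∧ ∀ s, ε ≤ s →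
    pmean s (fun k => dev s k ^ 4) ≤ K := by
  obtain ⟨K, hK, h⟩ := exists_pmean_pow_eight_le hε
  refine ⟨16 * K, by positivity, fun s hs => ?_⟩
  have hs0 : 0 < s := hε.trans_le hs
  have hz : ExpGrowth (fun k => (((k : ℝ) - s) / Real.sqrt s) ^ 8) := by
    simp only [div_eq_mul_inv]
    exact ((growth_sub (s := s)).mul (ExpGrowth.const _)).pow 8
  refine (pmean_mono ((growth_dev s).pow 4) (hz.const_mul 16) fun k => ?_).trans ?_
  · calc dev s k ^ 4 ≤ (2 * (((k : ℝ) - s) / Real.sqrt s) ^ 2) ^ 4 :=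
          pow_le_pow_left₀ (dev_nonneg hs0 k) (dev_le hs0 k) 4
      _ = _ := by ring
  · rw [pmean_const_mul]
    gcongr
    exact h s hs

end dev

/-! ### Functions of the whole data set -/

/-- A function of a data set that grows at most geometrically in the total count. -/
def DataGrowth {n : ℕ} (X : (Fin n → ℕ) → ℝ) : Prop :=
  ∃ A B : ℝ, 0 ≤ A ∧ 1 ≤ B ∧ ∀ x, |X x| ≤ A * B ^ (∑ i, x i)

namespace DataGrowth

variable {n : ℕ} {X Y : (Fin n → ℕ) → ℝ}

lemma of_abs_le (hY : DataGrowth Y) (h : ∀ x, |X x| ≤ |Y x|) : DataGrowth X := by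
  obtain ⟨A, B, hA, hB, hY⟩ := hY
  exact ⟨A, B, hA, hB, fun k => (h k).trans (hY k)⟩

lemma const (c : ℝ) : DataGrowth (fun _ : Fin n → ℕ => c) :=
  ⟨|c|, 1, abs_nonneg c, le_rfl, fun k => by simp⟩

lemma add (hX : DataGrowth X) (hY : DataGrowth Y) : DataGrowth (fun x => X x + Y x) := by
  obtain ⟨A, B, hA, hB, hX⟩ := hX
  obtain ⟨A', B', hA', hB', hY⟩ := hY
  refine ⟨A + A', max B B', by positivity, hB.trans (le_max_left _ _), fun x => ?_⟩
  calc |X x + Y x| ≤ |X x| + |Y x| := abs_add_le _ _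
    _ ≤ A * B ^ (∑ i, x i) + A' * B' ^ (∑ i, x i) := add_le_add (hX x) (hY x)
    _ ≤ A * (max B B') ^ (∑ i, x i) + A' * (max B B') ^ (∑ i, x i) := by
        gcongr
        · exact le_max_left _ _
        · exact le_max_right _ _
    _ = _ := by ring

lemma mul (hX : DataGrowth X) (hY : DataGrowth Y) : DataGrowth (fun x => X x * Y x) := by
  obtain ⟨A, B, hA, hB, hX⟩ := hX
  obtain ⟨A', B', hA', hB', hY⟩ := hY
  refine ⟨A * A', B * B', by positivity, one_le_mul_of_one_le_of_one_le hB hB', fun x => ?_⟩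
  rw [abs_mul, mul_pow]
  calc |X x| * |Y x| ≤ (A * B ^ (∑ i, x i)) * (A' * B' ^ (∑ i, x i)) :=
        mul_le_mul (hX x) (hY x) (abs_nonneg _) (by positivity)
    _ = _ := by ring

lemma const_mul (c : ℝ) (hX : DataGrowth X) : DataGrowth (fun x => c * X x) := (const c).mul hX

lemma neg (hX : DataGrowth X) : DataGrowth (fun x => - X x) := by
  simpa using hX.const_mul (-1)

lemma sub (hX : DataGrowth X) (hY : DataGrowth Y) : DataGrowth (fun x => X x - Y x) := by
  simpa [sub_eq_add_neg] using hX.add hY.neg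

lemma pow (hX : DataGrowth X) (p : ℕ) : DataGrowth (fun x => X x ^ p) := by
  induction p with
  | zero => simpa using const 1
  | succ p ih => simpa [pow_succ] using ih.mul hX

lemma sum {ι : Type*} (T : Finset ι) {F : ι → (Fin n → ℕ) → ℝ} (hF : ∀ i, DataGrowth (F i)) :
    DataGrowth (fun x => ∑ i ∈ T, F i x) := by
  classical
  induction T using Finset.induction_on with
  | empty => simpa using const 0
  | insert i T hi ih => simpa [Finset.sum_insert hi] using (hF i).add ih

lemma eval (i : Fin n) {f : ℕ → ℝ} (hf : ExpGrowth f) : DataGrowth (fun x => f (x i)) := by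
  obtain ⟨A, B, hA, hB, hf⟩ := hf
  refine ⟨A, B, hA, hB, fun x => (hf _).trans ?_⟩
  gcongr
  exact Finset.single_le_sum (f := x) (fun _ _ => Nat.zero_le _) (Finset.mem_univ i)

variable {d : ℕ} (s : ℕ → Param d → ℝ) (θ : Param d)

lemma integrable (hX : DataGrowth X) : Integrable X (law s n θ) := by
  obtain ⟨A, B, hA, hB, hX⟩ := hX
  -- A geometric function of the total count factors over the independent bins.
  have h1 : Integrable (fun x : Fin n → ℕ => ∏ i, B ^ (x i)) (law s n θ) :=
    Integrable.fintype_prod fun i => (ExpGrowth.geom B).integrable _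
  simp only [Finset.prod_pow_eq_pow_sum] at h1
  exact (h1.const_mul A).mono' Measurable.of_discrete.aestronglyMeasurable
    (Eventually.of_forall hX)

lemma integral_add (hX : DataGrowth X) (hY : DataGrowth Y) :
    ∫ x, (X x + Y x) ∂(law s n θ) = (∫ x, X x ∂(law s n θ)) + ∫ x, Y x ∂(law s n θ) :=
  MeasureTheory.integral_add (hX.integrable s θ) (hY.integrable s θ)

lemma memLp_two (hX : DataGrowth X) : MemLp X 2 (law s n θ) :=
  (memLp_two_iff_integrable_sq Measurable.of_discrete.aestronglyMeasurable).2
    ((hX.pow 2).integrable s θ)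

end DataGrowth

/-! ### Independence across bins and additive statistics -/

section law

variable {d n : ℕ} (s : ℕ → Param d → ℝ) (θ : Param d)

lemma integral_eval (i : Fin n) (f : ℕ → ℝ) :
    ∫ x, f (x i) ∂(law s n θ) = pmean (s i θ) f :=
  integral_comp_eval (μ := fun i : Fin n => poissonMeasure (s i θ).toNNReal) (i := i)
    (measurable_of_countable f).aestronglyMeasurable

lemma iIndepFun_eval (f : Fin n → ℕ → ℝ) :
    iIndepFun (fun i (x : Fin n → ℕ) => f i (x i)) (law s n θ) :=
  iIndepFun_pi (μ := fun i : Fin n => poissonMeasure (s i θ).toNNReal)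
    fun i => (measurable_of_countable (f i)).aemeasurable

lemma cov_eval (i : Fin n) (f g : ℕ → ℝ) :
    cov[fun x => f (x i), fun x => g (x i); law s n θ]
      = cov[f, g; poissonMeasure (s i θ).toNNReal] := by
  have h := (measurePreserving_eval (fun i : Fin n => poissonMeasure (s i θ).toNNReal) i)
  have e : poissonMeasure (s i θ).toNNReal = (law s n θ).map (Function.eval i) := h.map_eq.symm
  rw [e, covariance_map_fun Measurable.of_discrete.aestronglyMeasurable
    Measurable.of_discrete.aestronglyMeasurable h.measurable.aemeasurable]

/-- Covariances of additive statistics add up over the bins. -/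
lemma cov_sum {f g : Fin n → ℕ → ℝ} (hf : ∀ i, ExpGrowth (f i)) (hg : ∀ i, ExpGrowth (g i)) :
    cov[fun x => ∑ i, f i (x i), fun x => ∑ i, g i (x i); law s n θ]
      = ∑ i : Fin n, cov[f i, g i; poissonMeasure (s i θ).toNNReal] := by
  rw [covariance_fun_sum_fun_sum
    (fun i => (DataGrowth.eval i (hf i)).memLp_two s θ)
    (fun i => (DataGrowth.eval i (hg i)).memLp_two s θ)]
  refine Finset.sum_congr rfl fun i _ => ?_
  rw [Finset.sum_eq_single i, cov_eval]
  · intro j _ hj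
    have h := (iIndepFun_eval (n := n) s θ (fun _ k => (k : ℝ))).indepFun hj.symm
    have h2 : IndepFun (fun x : Fin n → ℕ => f i (x i)) (fun x => g j (x j)) (law s n θ) := by
      -- The independence at hand is that of the real-valued counts; the floor recovers the natural
      -- number.
      have := h.comp (φ := fun r : ℝ => f i ⌊r⌋₊) (ψ := fun r : ℝ => g j ⌊r⌋₊)
        ((measurable_of_countable (f i)).comp Nat.measurable_floor)
        ((measurable_of_countable (g j)).comp Nat.measurable_floor)
      simpa [Function.comp_def] using this
    exact h2.covariance_eq_zero ((DataGrowth.eval i (hf i)).memLp_two s θ)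
      ((DataGrowth.eval j (hg j)).memLp_two s θ)
  · simp

lemma var_sum {f : Fin n → ℕ → ℝ} (hf : ∀ i, ExpGrowth (f i)) :
    Var[fun x => ∑ i, f i (x i); law s n θ]
      = ∑ i : Fin n, Var[f i; poissonMeasure (s i θ).toNNReal] := by
  rw [← covariance_self Measurable.of_discrete.aemeasurable, cov_sum s θ hf hf]
  exact Finset.sum_congr rfl fun i _ => covariance_self Measurable.of_discrete.aemeasurable

/-- The fourth moment of a sum of independent centred contributions is of order `n ^ 2`. -/
lemma integral_sum_pow_four_le {f : Fin n → ℕ → ℝ} (hf : ∀ i, ExpGrowth (f i))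
    (h0 : ∀ i : Fin n, pmean (s i θ) (f i) = 0) {K : ℝ} (hK : 0 ≤ K)
    (h2 : ∀ i : Fin n, pmean (s i θ) (fun k => f i k ^ 2) ≤ K)
    (h4 : ∀ i : Fin n, pmean (s i θ) (fun k => f i k ^ 4) ≤ K) :
    ∫ x, (∑ i, f i (x i)) ^ 4 ∂(law s n θ) ≤ (3 * K ^ 2 + K) * (n : ℝ) ^ 2 := by
  have hg : ∀ i, DataGrowth (fun x : Fin n → ℕ => f i (x i)) := fun i => DataGrowth.eval i (hf i)
  have hind := iIndepFun_eval (n := n) s θ f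
  -- Induction over bins. In the expansion of (S + f)⁴ every term with a first power of S or f has
  -- mean zero. The term 6 E[S²] E[f²] ≤ 6K²|T| is absorbed by the increment of 3K²|T|², which is
  -- why the second moment is carried along.
  have key : ∀ T : Finset (Fin n),
      (∫ x, (∑ i ∈ T, f i (x i)) ^ 2 ∂(law s n θ) ≤ K * (T.card : ℝ)) ∧
      (∫ x, (∑ i ∈ T, f i (x i)) ^ 4 ∂(law s n θ)
        ≤ 3 * K ^ 2 * (T.card : ℝ) ^ 2 + K * (T.card : ℝ)) := by
    intro T
    induction T using Finset.induction_on with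
    | empty => simp
    | insert i T hi ih =>
      obtain ⟨ih2, ih4⟩ := ih
      have hS : DataGrowth (fun x : Fin n → ℕ => ∑ j ∈ T, f j (x j)) := DataGrowth.sum T hg
      have hI : IndepFun (fun x : Fin n → ℕ => ∑ j ∈ T, f j (x j)) (fun x => f i (x i))
          (law s n θ) := by
        have := hind.indepFun_finsetSum_of_notMem (fun _ => Measurable.of_discrete) hi
        convert! this using 1
        ext x; simp
      have hm : ∀ a b : ℕ, ∫ x, (∑ j ∈ T, f j (x j)) ^ a * f i (x i) ^ b ∂(law s n θ)
          = (∫ x, (∑ j ∈ T, f j (x j)) ^ a ∂(law s n θ)) * pmean (s i θ) (fun k => f i k ^ b) := by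
        intro a b
        rw [← integral_eval s θ i (fun k => f i k ^ b)]
        exact hI.integral_fun_comp_mul_comp (f := fun r => r ^ a) (g := fun r => r ^ b)
          Measurable.of_discrete.aemeasurable Measurable.of_discrete.aemeasurable
          (by fun_prop) (by fun_prop)
      have hab : ∀ a b : ℕ, DataGrowth
          (fun x : Fin n → ℕ => (∑ j ∈ T, f j (x j)) ^ a * f i (x i) ^ b) :=
        fun a b => (hS.pow a).mul ((hg i).pow b)
      have hb1 : pmean (s i θ) (fun k => f i k ^ 1) = 0 := by simpa using h0 i
      have hb0 : pmean (s i θ) (fun k => f i k ^ 0) = 1 := by simp [pmean_const]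
      have e2 : ∀ x : Fin n → ℕ, (∑ j ∈ insert i T, f j (x j)) ^ 2
          = (∑ j ∈ T, f j (x j)) ^ 2 * f i (x i) ^ 0
            + (2 * ((∑ j ∈ T, f j (x j)) ^ 1 * f i (x i) ^ 1)
            + (∑ j ∈ T, f j (x j)) ^ 0 * f i (x i) ^ 2) := fun x => by
        rw [Finset.sum_insert hi]; ring
      have e4 : ∀ x : Fin n → ℕ, (∑ j ∈ insert i T, f j (x j)) ^ 4
          = (∑ j ∈ T, f j (x j)) ^ 4 * f i (x i) ^ 0
            + (4 * ((∑ j ∈ T, f j (x j)) ^ 3 * f i (x i) ^ 1)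
            + (6 * ((∑ j ∈ T, f j (x j)) ^ 2 * f i (x i) ^ 2)
            + (4 * ((∑ j ∈ T, f j (x j)) ^ 1 * f i (x i) ^ 3)
            + (∑ j ∈ T, f j (x j)) ^ 0 * f i (x i) ^ 4))) := fun x => by
        rw [Finset.sum_insert hi]; ring
      have hS1 : ∫ x, (∑ j ∈ T, f j (x j)) ^ 1 ∂(law s n θ) = 0 := by
        simp only [pow_one]
        rw [integral_finsetSum _ fun j _ => (hg j).integrable s θ]
        refine Finset.sum_eq_zero fun j _ => ?_
        rw [integral_eval, h0 j]
      have hT2 : 0 ≤ ∫ x, (∑ j ∈ T, f j (x j)) ^ 2 ∂(law s n θ) :=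
        integral_nonneg fun x => sq_nonneg _
      have hp2 : 0 ≤ pmean (s i θ) (fun k => f i k ^ 2) := pmean_nonneg fun k => sq_nonneg _
      rw [Finset.card_insert_of_notMem hi]
      push_cast
      constructor
      · simp only [e2]
        rw [DataGrowth.integral_add s θ (hab 2 0) (((hab 1 1).const_mul 2).add (hab 0 2)),
          DataGrowth.integral_add s θ ((hab 1 1).const_mul 2) (hab 0 2), integral_const_mul, hm, hm, hm, hb1, hb0]
        simp only [pow_zero, integral_const, probReal_univ, smul_eq_mul]
        linarith [h2 i]
      · simp only [e4]
        rw [DataGrowth.integral_add s θ (hab 4 0) (((hab 3 1).const_mul 4).add (((hab 2 2).const_mul 6).add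
            (((hab 1 3).const_mul 4).add (hab 0 4)))),
          DataGrowth.integral_add s θ ((hab 3 1).const_mul 4) (((hab 2 2).const_mul 6).add
            (((hab 1 3).const_mul 4).add (hab 0 4))),
          DataGrowth.integral_add s θ ((hab 2 2).const_mul 6) (((hab 1 3).const_mul 4).add (hab 0 4)),
          DataGrowth.integral_add s θ ((hab 1 3).const_mul 4) (hab 0 4), integral_const_mul, integral_const_mul,
          integral_const_mul, hm, hm, hm, hm, hm, hb1, hb0, hS1]
        simp only [pow_zero, integral_const, probReal_univ, smul_eq_mul]
        have h6 : (∫ x, (∑ j ∈ T, f j (x j)) ^ 2 ∂(law s n θ)) * pmean (s i θ) (fun k => f i k ^ 2)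
            ≤ (K * (T.card : ℝ)) * K := mul_le_mul ih2 (h2 i) hp2 (by positivity)
        nlinarith [h4 i, sq_nonneg K]
  have h := (key Finset.univ).2
  rw [Finset.card_univ, Fintype.card_fin] at h
  refine h.trans ?_
  have hn : (n : ℝ) ≤ (n : ℝ) ^ 2 := by
    rcases Nat.eq_zero_or_pos n with rfl | hn
    · simp
    · have : (1 : ℝ) ≤ n := by exact_mod_cast hn
      nlinarith
  nlinarith

end law

/-! ### The moments of the C function and of the score as sums over bins -/

section formulas

variable {d n : ℕ} {s : ℕ → Param d → ℝ} {θ : Param d}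

lemma cash_eq_sum (s : ℕ → Param d → ℝ) (θ : Param d) :
    cash s n θ = fun x => ∑ i : Fin n, dev (s i θ) (x i) := by
  ext x; simp only [cash, dev, Finset.mul_sum]

lemma growth_cash (s : ℕ → Param d → ℝ) (θ : Param d) : DataGrowth (cash s n θ) := by
  rw [cash_eq_sum]
  exact DataGrowth.sum _ fun i => DataGrowth.eval i (growth_dev _)

lemma funMean_eq_sum (s : ℕ → Param d → ℝ) (θ : Param d) :
    funMean s n θ = ∑ i : Fin n, pmean (s i θ) (dev (s i θ)) := by
  rw [funMean, cash_eq_sum,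
    integral_finsetSum _ fun i _ => (DataGrowth.eval i (growth_dev _)).integrable s θ]
  exact Finset.sum_congr rfl fun i _ => integral_eval s θ i _

lemma funVar_eq_sum (s : ℕ → Param d → ℝ) (θ : Param d) :
    funVar s n θ = ∑ i : Fin n, Var[dev (s i θ); poissonMeasure (s i θ).toNNReal] := by
  rw [funVar, cash_eq_sum, var_sum s θ fun i => growth_dev _]

/-- The gradient direction of the `i`-th expected count. -/
noncomputable def grad (s : ℕ → Param d → ℝ) (i : ℕ) (θ : Param d) (j : Fin d) : ℝ :=
  fderiv ℝ (s i) θ (EuclideanSpace.single j 1)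

/-- The score is affine in the counts, so covariances with it reduce to covariances with single
counts. -/
lemma score_eq (hpos : ∀ i, 0 < s i θ) (hd : ∀ i, DifferentiableAt ℝ (s i) θ) (j : Fin d) :
    score s n θ j = fun x => ∑ i : Fin n, grad s i θ j * ((s i θ)⁻¹ * (x i : ℝ) - 1) := by
  ext x
  have hev : (fun t : Param d => logLik s n t x) =ᶠ[𝓝 θ] fun t => ∑ i : Fin n,
      (-(s i t) + (x i : ℝ) * Real.log (s i t) - Real.log ((x i).factorial : ℝ)) := by
    have : ∀ᶠ t in 𝓝 θ, ∀ i : Fin n, 0 < s i t :=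
      eventually_all.2 fun i => (hd i).continuousAt.eventually (lt_mem_nhds (hpos i))
    filter_upwards [this] with t ht
    refine Finset.sum_congr rfl fun i _ => ?_
    have := (ht i).ne'
    rw [Real.log_div (by positivity) (by positivity), Real.log_mul (by positivity) (by positivity),
      Real.log_exp, Real.log_pow]
  rw [score, hev.fderiv_eq]
  have h1 : HasFDerivAt (fun t => ∑ i : Fin n,
      (-(s i t) + (x i : ℝ) * Real.log (s i t) - Real.log ((x i).factorial : ℝ)))
      (∑ i : Fin n, (-(fderiv ℝ (s i) θ) + (x i : ℝ) • ((s i θ)⁻¹ • fderiv ℝ (s i) θ))) θ :=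
    HasFDerivAt.fun_sum fun i _ => (((hd i).hasFDerivAt.fun_neg).fun_add
      (((hd i).hasFDerivAt.log (hpos i).ne').const_mul _)).sub_const _
  rw [h1.fderiv]
  simp only [grad, _root_.sum_apply, _root_.add_apply,
    _root_.neg_apply, _root_.smul_apply, smul_eq_mul]
  exact Finset.sum_congr rfl fun i _ => by ring

lemma growth_score_term (a b : ℝ) : ExpGrowth (fun k => a * (b * (k : ℝ) - 1)) :=
  ((ExpGrowth.cast.const_mul b).sub (ExpGrowth.const 1)).const_mul a

lemma var_cast {r : ℝ} (hr : 0 ≤ r) : cov[fun k : ℕ => (k : ℝ), fun k : ℕ => (k : ℝ);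
    poissonMeasure r.toNNReal] = r := by
  rw [covariance_eq_sub (ExpGrowth.cast.memLp_two _) (ExpGrowth.cast.memLp_two _)]
  have h1 := pmean_cast hr
  have h2 := pmean_cast_sq hr
  unfold pmean at h1 h2
  have e : ((fun k : ℕ => (k : ℝ)) * fun k : ℕ => (k : ℝ)) = fun k : ℕ => (k : ℝ) ^ 2 := by
    ext k; simp [pow_two]
  rw [e, h1, h2]; ring

lemma info_eq (hpos : ∀ i, 0 < s i θ) (hd : ∀ i, DifferentiableAt ℝ (s i) θ) (j k : Fin d) :
    info s n θ j k = ∑ i : Fin n, grad s i θ j * grad s i θ k / s i θ := by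
  rw [info, Matrix.of_apply, score_eq hpos hd, score_eq hpos hd,
    cov_sum s θ (fun i => growth_score_term _ _) (fun i => growth_score_term _ _)]
  refine Finset.sum_congr rfl fun i _ => ?_
  have hI := (ExpGrowth.cast.const_mul (s i θ)⁻¹).integrable (s i θ).toNNReal
  rw [covariance_const_mul_left, covariance_const_mul_right, covariance_sub_const_left hI,
    covariance_sub_const_right hI, covariance_const_mul_left, covariance_const_mul_right,
    var_cast (hpos i).le]
  have := (hpos i).ne'
  field_simp

/-- Only the covariance of each deviance with its own count enters. By the chain rule the right-hand
side is also the gradient of μ, since `slope` is the derivative of the mean deviance; the expansion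
of W rests on this. -/
lemma crossCov_eq (hpos : ∀ i, 0 < s i θ) (hd : ∀ i, DifferentiableAt ℝ (s i) θ) (j : Fin d) :
    crossCov s n θ j = ∑ i : Fin n, slope (s i θ) * grad s i θ j := by
  rw [crossCov, score_eq hpos hd, cash_eq_sum,
    cov_sum s θ (fun i => growth_dev _) (fun i => growth_score_term _ _)]
  refine Finset.sum_congr rfl fun i _ => ?_
  have hI := (ExpGrowth.cast.const_mul (s i θ)⁻¹).integrable (s i θ).toNNReal
  rw [covariance_const_mul_right, covariance_sub_const_right hI, covariance_const_mul_right,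
    cov_dev_cast (hpos i).le]
  have := (hpos i).ne'
  field_simp

end formulas

/-! ### The likelihood ratio, and the Lipschitz dependence of the deviance on √s -/

section likelihoodRatio

variable {d n : ℕ} {s : ℕ → Param d → ℝ} {θ θ' : Param d}

/-- C_n is -2 times the log-likelihood plus a term free of θ, so the left side is the likelihood
ratio of θ' to θ. -/
lemma exp_cash_sub (h : ∀ i, 0 < s i θ) (h' : ∀ i, 0 < s i θ') (x : Fin n → ℕ) :
    Real.exp ((cash s n θ x - cash s n θ' x) / 2)
      = ∏ i : Fin n, (Real.exp (s i θ - s i θ') * (s i θ' / s i θ) ^ (x i)) := by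
  rw [cash, cash, ← mul_sub, mul_div_cancel_left₀ _ two_ne_zero, ← Finset.sum_sub_distrib,
    Real.exp_sum]
  refine Finset.prod_congr rfl fun i _ => ?_
  have e : s i θ' / s i θ = Real.exp (Real.log (s i θ') - Real.log (s i θ)) := by
    rw [Real.exp_sub, Real.exp_log (h i), Real.exp_log (h' i)]
  rw [e, ← Real.exp_nat_mul, ← Real.exp_add]
  congr 1; ring

lemma integrable_exp_cash_sub (h : ∀ i, 0 < s i θ) (h' : ∀ i, 0 < s i θ') :
    Integrable (fun x => Real.exp ((cash s n θ x - cash s n θ' x) / 2)) (law s n θ) := by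
  simp only [exp_cash_sub h h']
  exact Integrable.fintype_prod fun i => ((ExpGrowth.geom _).const_mul _).integrable _

/-- The likelihood ratio has mean one. -/
lemma integral_exp_cash_sub (h : ∀ i, 0 < s i θ) (h' : ∀ i, 0 < s i θ') :
    ∫ x, Real.exp ((cash s n θ x - cash s n θ' x) / 2) ∂(law s n θ) = 1 := by
  simp only [exp_cash_sub h h']
  rw [law, integral_fintype_prod_eq_prod
    (μ := fun i : Fin n => poissonMeasure (s i θ).toNNReal)
    (fun (i : Fin n) k => Real.exp (s i θ - s i θ') * (s i θ' / s i θ) ^ k)]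
  refine Finset.prod_eq_one fun i _ => ?_
  have := pmean_geom (h i).le (s i θ' / s i θ)
  have h2 := pmean_const_mul (s := s i θ) (Real.exp (s i θ - s i θ'))
    (fun k => (s i θ' / s i θ) ^ k)
  unfold pmean at h2 this
  rw [h2, this, ← Real.exp_add]
  rw [Real.exp_eq_one_iff]
  have := (h i).ne'
  field_simp; ring

/-- Here a, b, c are the roots of three means and the count is a² + a z, so the left side is half a
difference of deviances. Bounding the logarithm below by (b-c)/b turns the part without z into
(b-c)(b² + bc - 2a²)/b. The quadratic factor cancels to size M(b+c+2a), so after division by b only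
ratios of roots remain and the bound is uniform for large means. -/
lemma dev_sub_le_aux {a b c M ρ η z : ℝ} (ha : 0 < a) (hb : 0 < b) (hc : 0 < c) (hM : 0 ≤ M)
    (hη : 0 ≤ η) (hab : |b - a| ≤ M) (hac : |c - a| ≤ M) (hbc : |b - c| ≤ η)
    (h1 : a ≤ ρ * b) (h2 : a ≤ ρ * c) (h3 : c ≤ ρ * b) :
    b ^ 2 - c ^ 2 - 2 * (a ^ 2 + a * z) * (Real.log b - Real.log c)
      ≤ η * (M * (1 + 3 * ρ)) + 2 * (ρ * η * |z|) := by
  have hl1 := Real.one_sub_inv_le_log_of_pos (show 0 < b / c by positivity)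
  have hl2 := Real.log_le_sub_one_of_pos (show 0 < b / c by positivity)
  rw [Real.log_div hb.ne' hc.ne'] at hl1 hl2
  set l := Real.log b - Real.log c
  have hl1' : (b - c) / b ≤ l := by
    refine le_trans (le_of_eq ?_) hl1
    field_simp
  have hl2' : l ≤ (b - c) / c := by
    refine hl2.trans (le_of_eq ?_)
    field_simp
  obtain ⟨hbc1, hbc2⟩ := abs_le.1 hbc
  have hab' : a / b ≤ ρ := by rwa [div_le_iff₀ hb]
  have hac' : a / c ≤ ρ := by rwa [div_le_iff₀ hc]
  have hcb' : c / b ≤ ρ := by rwa [div_le_iff₀ hb]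
  have hal : |a * l| ≤ ρ * η := by
    rw [abs_le]
    constructor
    · calc -(ρ * η) ≤ -(a / b * η) := by gcongr
        _ = a * (-η / b) := by ring
        _ ≤ a * ((b - c) / b) := by gcongr
        _ ≤ a * l := by gcongr
    · calc a * l ≤ a * ((b - c) / c) := by gcongr
        _ ≤ a * (η / c) := by gcongr
        _ = a / c * η := by ring
        _ ≤ _ := by gcongr
  have hz : -(2 * (a * l) * z) ≤ 2 * (ρ * η * |z|) := by
    have : -((a * l) * z) ≤ |a * l| * |z| := by rw [← abs_mul]; exact neg_le_abs _
    have h5 : |a * l| * |z| ≤ ρ * η * |z| := by gcongr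
    linarith
  have hq : |b ^ 2 + b * c - 2 * a ^ 2| ≤ M * (b + c + 2 * a) := by
    have e : b ^ 2 + b * c - 2 * a ^ 2 = (b - a) * (b + a + c) + (c - a) * a := by ring
    rw [e]
    refine (abs_add_le _ _).trans ?_
    rw [abs_mul, abs_mul, abs_of_pos (show 0 < b + a + c by positivity), abs_of_pos ha]
    nlinarith
  have hmain : b ^ 2 - c ^ 2 - 2 * a ^ 2 * l ≤ η * (M * (1 + 3 * ρ)) := by
    calc b ^ 2 - c ^ 2 - 2 * a ^ 2 * l ≤ b ^ 2 - c ^ 2 - 2 * a ^ 2 * ((b - c) / b) := by gcongr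
      _ = (b - c) * ((b ^ 2 + b * c - 2 * a ^ 2) / b) := by field_simp; ring
      _ ≤ |b - c| * (|b ^ 2 + b * c - 2 * a ^ 2| / b) := by
          refine (le_abs_self _).trans_eq ?_
          rw [abs_mul, abs_div, abs_of_pos hb]
      _ ≤ η * (M * (b + c + 2 * a) / b) := by gcongr
      _ = η * (M * (1 + c / b + 2 * (a / b))) := by field_simp
      _ ≤ η * (M * (1 + ρ + 2 * ρ)) := by gcongr
      _ = _ := by ring
  calc _ = (b ^ 2 - c ^ 2 - 2 * a ^ 2 * l) + -(2 * (a * l) * z) := by ring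
    _ ≤ _ := add_le_add hmain hz

/-- The deviance of one bin is Lipschitz in the square root of the expected count, relative to the
standardized count. -/
lemma dev_sub_le {ε M : ℝ} (hε : 0 < ε) (hM : 0 ≤ M) : ∃ K : ℝ, 0 ≤ K ∧
    ∀ r r' r'' η : ℝ, ε ≤ r → ε ≤ r' → ε ≤ r'' → 0 ≤ η →
      |Real.sqrt r' - Real.sqrt r| ≤ M → |Real.sqrt r'' - Real.sqrt r| ≤ M →
      |Real.sqrt r' - Real.sqrt r''| ≤ η → ∀ k : ℕ,
      dev r' k - dev r'' k ≤ K * η * (1 + |((k : ℝ) - r) / Real.sqrt r|) := by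
  set e := Real.sqrt ε with he
  have he0 : 0 < e := Real.sqrt_pos.2 hε
  -- The roots are at least e and pairwise within 2M, so this bounds all their ratios.
  set ρ := 1 + 2 * M / e with hρ
  have hρ0 : 0 ≤ ρ := by positivity
  refine ⟨2 * (M * (1 + 3 * ρ)) + 4 * ρ, by positivity, ?_⟩
  intro r r' r'' η hr hr' hr'' hη h1 h2 h3 k
  set a := Real.sqrt r
  set b := Real.sqrt r'
  set c := Real.sqrt r''
  have ha : e ≤ a := Real.sqrt_le_sqrt hr
  have hb : e ≤ b := Real.sqrt_le_sqrt hr'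
  have hc : e ≤ c := Real.sqrt_le_sqrt hr''
  have hra : r = a ^ 2 := (Real.sq_sqrt (hε.le.trans hr)).symm
  have hrb : r' = b ^ 2 := (Real.sq_sqrt (hε.le.trans hr')).symm
  have hrc : r'' = c ^ 2 := (Real.sq_sqrt (hε.le.trans hr'')).symm
  have hstep : ∀ u v : ℝ, e ≤ v → u - v ≤ 2 * M → u ≤ ρ * v := by
    intro u v hv huv
    have : 2 * M ≤ 2 * M / e * v := by
      calc 2 * M = 2 * M / e * e := by field_simp
        _ ≤ _ := by gcongr
    rw [hρ, add_mul, one_mul]; linarith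
  obtain ⟨h11, h12⟩ := abs_le.1 h1
  obtain ⟨h21, h22⟩ := abs_le.1 h2
  have ha0 := he0.trans_le ha
  have hb0 := he0.trans_le hb
  have hc0 := he0.trans_le hc
  set z := ((k : ℝ) - r) / a with hz
  have hk : (k : ℝ) = a ^ 2 + a * z := by rw [hz, hra]; field_simp; ring
  have haux := dev_sub_le_aux (z := z) ha0 hb0 hc0 hM hη h1 h2 h3 (hstep a b hb (by linarith))
    (hstep a c hc (by linarith)) (hstep c b hb (by linarith))
  have hdev : dev r' k - dev r'' k
      = 2 * (b ^ 2 - c ^ 2 - 2 * (a ^ 2 + a * z) * (Real.log b - Real.log c)) := by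
    rw [← hk]
    unfold dev
    rw [hrb, hrc, Real.log_pow, Real.log_pow]
    push_cast; ring
  rw [hdev]
  have hzz := abs_nonneg z
  have p1 : 0 ≤ η * (M * (1 + 3 * ρ)) * |z| := by positivity
  have p2 : 0 ≤ ρ * η := by positivity
  nlinarith

end likelihoodRatio

/-! ### Finite nets in a bounded parameter set -/

section grid

/-- A bounded subset of `ℝ^d` has nets of mesh `d / n` with polynomially many points. -/
lemma exists_net {d : ℕ} {Θ : Set (Param d)} {R : ℝ} (hR : 0 ≤ R) (hΘ : ∀ θ ∈ Θ, ‖θ‖ ≤ R) (n : ℕ)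
    (hn : 1 ≤ n) : ∃ T : Finset (Param d), (∀ t ∈ T, t ∈ Θ) ∧
      ((T.card : ℝ) ≤ ((2 * R + 5) * n) ^ d) ∧
      ∀ θ ∈ Θ, ∃ t ∈ T, ‖θ - t‖ ≤ d / (n : ℝ) := by
  classical
  have hn0 : (0 : ℝ) < n := by exact_mod_cast hn
  have hn1 : (1 : ℝ) ≤ n := by exact_mod_cast hn
  set cell : Param d → (Fin d → ℤ) := fun θ j => ⌊(n : ℝ) * θ j⌋ with hcell
  set B : ℤ := ⌈(n : ℝ) * R⌉ + 1 with hB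
  set F : Finset (Fin d → ℤ) := Fintype.piFinset fun _ => Finset.Icc (-B) B
  have hB0 : 0 ≤ B := by
    have : 0 ≤ ⌈(n : ℝ) * R⌉ := Int.ceil_nonneg (by positivity)
    omega
  have hcoord : ∀ (θ : Param d) (j : Fin d), |θ j| ≤ ‖θ‖ := fun θ j => by
    simpa using PiLp.norm_apply_le θ j
  have hF : ∀ θ ∈ Θ, cell θ ∈ F := by
    intro θ hθ
    rw [Fintype.mem_piFinset]
    intro j
    have h1 := abs_le.1 ((hcoord θ j).trans (hΘ θ hθ))
    have h2 : (n : ℝ) * θ j ≤ n * R := by gcongr; exact h1.2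
    have h3 : -((n : ℝ) * R) ≤ n * θ j := by
      have := mul_le_mul_of_nonneg_left h1.1 hn0.le
      linarith
    rw [Finset.mem_Icc]
    constructor
    · rw [Int.le_floor]
      push_cast [hB]
      linarith [Int.le_ceil ((n : ℝ) * R)]
    · have : ⌊(n : ℝ) * θ j⌋ ≤ ⌈(n : ℝ) * R⌉ :=
        (Int.floor_le_floor h2).trans (Int.floor_le_ceil _)
      simp only [hcell]; omega
  -- One point of Θ for each occupied grid cell: net points must lie in Θ, where the s_i are bounded
  -- below. The value 0 on empty cells is never used.
  let rep : (Fin d → ℤ) → Param d := fun z => if h : ∃ θ ∈ Θ, cell θ = z then h.choose else 0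
  have hrep : ∀ θ ∈ Θ, rep (cell θ) ∈ Θ ∧ cell (rep (cell θ)) = cell θ := by
    intro θ hθ
    have h : ∃ θ' ∈ Θ, cell θ' = cell θ := ⟨θ, hθ, rfl⟩
    simp only [rep, dif_pos h]
    exact h.choose_spec
  refine ⟨(F.filter fun z => ∃ θ ∈ Θ, cell θ = z).image rep, ?_, ?_, ?_⟩
  · intro t ht
    obtain ⟨z, hz, rfl⟩ := Finset.mem_image.1 ht
    obtain ⟨θ, hθ, rfl⟩ := (Finset.mem_filter.1 hz).2
    exact (hrep θ hθ).1
  · have h1 : ((F.filter fun z => ∃ θ ∈ Θ, cell θ = z).image rep).card ≤ F.card :=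
      Finset.card_image_le.trans (Finset.card_filter_le _ _)
    have h2 : (F.card : ℝ) = (2 * (B : ℝ) + 1) ^ d := by
      rw [Fintype.card_piFinset_const, Int.card_Icc]
      push_cast
      congr 1
      have : ((B + 1 - -B).toNat : ℤ) = 2 * B + 1 := by rw [Int.toNat_of_nonneg] <;> omega
      exact_mod_cast this
    calc _ ≤ (F.card : ℝ) := by exact_mod_cast h1
      _ = _ := h2
      -- 2B + 1 < 2(nR + 2) + 1 ≤ (2R + 5)n, as n ≥ 1.
      _ ≤ _ := by
        have hB' : (0 : ℝ) ≤ B := by exact_mod_cast hB0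
        gcongr
        push_cast [hB]
        have := Int.ceil_lt_add_one ((n : ℝ) * R)
        nlinarith
  · intro θ hθ
    obtain ⟨h1, h2⟩ := hrep θ hθ
    refine ⟨rep (cell θ), Finset.mem_image.2 ⟨cell θ, Finset.mem_filter.2
      ⟨hF θ hθ, θ, hθ, rfl⟩, rfl⟩, ?_⟩
    set t := rep (cell θ)
    have hj : ∀ j, |(θ - t) j| ≤ 1 / (n : ℝ) := by
      intro j
      have h3 : ⌊(n : ℝ) * t j⌋ = ⌊(n : ℝ) * θ j⌋ := congrFun h2 j
      have h4 := Int.abs_sub_lt_one_of_floor_eq_floor h3.symm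
      rw [← mul_sub, abs_mul, abs_of_pos hn0] at h4
      rw [le_div_iff₀ hn0, mul_comm]
      simpa using h4.le
    have h5 : ‖θ - t‖ ≤ ∑ j, |(θ - t) j| := by
      rw [EuclideanSpace.norm_eq]
      rw [Real.sqrt_le_left (Finset.sum_nonneg fun _ _ => abs_nonneg _)]
      simp only [Real.norm_eq_abs]
      exact Finset.sum_sq_le_sq_sum_of_nonneg fun _ _ => abs_nonneg _
    calc _ ≤ _ := h5
      _ ≤ ∑ _j : Fin d, 1 / (n : ℝ) := Finset.sum_le_sum fun j _ => hj j
      _ = _ := by simp [div_eq_mul_inv]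

end grid

/-! ### The excess C_n(θ) - C_n(θhat) and the bootstrap moments -/

section excess

variable {d : ℕ} {Θ : Set (Param d)} {s : ℕ → Param d → ℝ} {θ₀ : Param d}
  {θhat : (n : ℕ) → (Fin n → ℕ) → Param d}

lemma Setting.pos (h : Setting Θ s θ₀ θhat) : ∀ θ ∈ Θ, ∀ i, 0 < s i θ := by
  obtain ⟨ε, hε, hs⟩ := h.b2
  exact fun θ hθ i => hε.trans_le (hs i θ hθ)

lemma Setting.true_mem (h : Setting Θ s θ₀ θhat) : θ₀ ∈ Θ :=
  interior_subset h.standing.interior_mem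

lemma cash_nonneg (hpos : ∀ i, 0 < s i θ₀) (n : ℕ) (x : Fin n → ℕ) : 0 ≤ cash s n θ₀ x := by
  rw [cash_eq_sum]
  exact Finset.sum_nonneg fun i _ => dev_nonneg (hpos i) _

lemma Setting.cStat_nonneg (h : Setting Θ s θ₀ θhat) (n : ℕ) (x : Fin n → ℕ) :
    0 ≤ cStat s θhat n x :=
  cash_nonneg (h.pos _ (h.mle n x).1) n x

lemma Setting.cStat_le (h : Setting Θ s θ₀ θhat) {θ : Param d} (hθ : θ ∈ Θ) (n : ℕ)
    (x : Fin n → ℕ) : cStat s θhat n x ≤ cash s n θ x :=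
  (h.mle n x).2 θ hθ

/-- Minimality places the statistic between 0 and C_n(θ₀), so its moments exist without any
regularity of θhat as a function of the data. -/
lemma Setting.growth_cStat (h : Setting Θ s θ₀ θhat) (n : ℕ) : DataGrowth (cStat s θhat n) := by
  refine (growth_cash s θ₀).of_abs_le fun x => ?_
  rw [abs_of_nonneg (h.cStat_nonneg n x), abs_of_nonneg (cash_nonneg (h.pos _ h.true_mem) n x)]
  exact h.cStat_le h.true_mem n x

/-- To be used with y the log-likelihood ratio statistic of a net point, r the error of passing from
the net point to θhat, and a a threshold. Above the threshold, (y-a)² ≤ 8 exp((y-a)/2); below it, y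
contributes at most a² when nonnegative, and when y is negative the sum is at most r. -/
lemma sq_le_add_exp {y r a : ℝ} (h0 : 0 ≤ y + r) :
    (y + r) ^ 2 ≤ 4 * a ^ 2 + 32 * (Real.exp (-(a / 2)) * Real.exp (y / 2)) + 2 * r ^ 2 := by
  have hE : 0 < Real.exp (-(a / 2)) * Real.exp (y / 2) := by positivity
  rcases le_or_gt y a with hya | hya
  · rcases le_or_gt 0 y with hy | hy
    · have : y ^ 2 ≤ a ^ 2 := by gcongr
      nlinarith [sq_nonneg (y - r)]
    · have : (y + r) ^ 2 ≤ r ^ 2 := by nlinarith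
      nlinarith [sq_nonneg a, sq_nonneg r]
  · have h1 : (y - a) ^ 2 ≤ 8 * (Real.exp (-(a / 2)) * Real.exp (y / 2)) := by
      rw [← Real.exp_add]
      have := Real.pow_div_factorial_le_exp (-(a / 2) + y / 2) (by linarith) 2
      have e2 : ((Nat.factorial 2 : ℕ) : ℝ) = 2 := by norm_num [Nat.factorial]
      rw [e2] at this
      nlinarith
    have h2 : y ^ 2 ≤ 2 * a ^ 2 + 2 * (y - a) ^ 2 := by nlinarith [sq_nonneg (y - 2 * a)]
    nlinarith [sq_nonneg (y - r)]

/-- The likelihood ratio statistic has second moment `o(n)`, uniformly in the parameter. -/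
lemma Setting.exists_excess_bound (h : Setting Θ s θ₀ θhat) :
    ∃ β : ℕ → ℝ, Tendsto (fun n => β n / (n : ℝ)) atTop (𝓝 0) ∧
      ∀ n, 1 ≤ n → ∀ θ ∈ Θ,
        ∫ x, (cash s n θ x - cStat s θhat n x) ^ 2 ∂(law s n θ) ≤ β n := by
  obtain ⟨ε, hε, hlow⟩ := h.b2
  obtain ⟨L', hL'⟩ := h.standing.lipschitz
  obtain ⟨R', hR'⟩ := h.standing.bounded.exists_norm_le
  set L := max L' 0
  set R := max R' 0
  have hL0 : 0 ≤ L := le_max_right _ _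
  have hR0 : 0 ≤ R := le_max_right _ _
  have hR : ∀ θ ∈ Θ, ‖θ‖ ≤ R := fun θ hθ => (hR' θ hθ).trans (le_max_left _ _)
  have hL : ∀ (i : ℕ), ∀ θ ∈ Θ, ∀ θ' ∈ Θ,
      |Real.sqrt (s i θ) - Real.sqrt (s i θ')| ≤ L * ‖θ - θ'‖ := fun i θ hθ θ' hθ' =>
    (hL' i θ hθ θ' hθ').trans (by gcongr; exact le_max_left _ _)
  set M := L * (2 * R) with hM
  have hM0 : 0 ≤ M := by positivity
  have hLM : ∀ (i : ℕ), ∀ θ ∈ Θ, ∀ θ' ∈ Θ,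
      |Real.sqrt (s i θ) - Real.sqrt (s i θ')| ≤ M := fun i θ hθ θ' hθ' => by
    refine (hL i θ hθ θ' hθ').trans ?_
    rw [hM]; gcongr
    exact (norm_sub_le _ _).trans (by linarith [hR θ hθ, hR θ' hθ'])
  obtain ⟨K, hK0, hK⟩ := dev_sub_le hε hM0
  have hpos := h.pos
  -- Twice the logarithm of the bound on the net size: exp(-a/2) then cancels the number of net
  -- points in the union bound.
  set a : ℕ → ℝ := fun n => 2 * (d * (Real.log (2 * R + 5) + Real.log n)) with ha
  -- Threshold, exponential part (net size times exp(-a/2) times mean one), and net error: the last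
  -- has second moment at most (K L d/n)² · n · 4n, each term 2 + 2Z² having mean 4.
  refine ⟨fun n => 4 * a n ^ 2 + 32 + 2 * (4 * (K * (L * d)) ^ 2), ?_, ?_⟩
  · have h1 : Tendsto (fun n : ℕ => Real.log n ^ 2 / (n : ℝ)) atTop (𝓝 0) :=
      (Real.isLittleO_pow_log_id_atTop (n := 2)).tendsto_div_nhds_zero.comp
        tendsto_natCast_atTop_atTop
    have h2 : Tendsto (fun n : ℕ => Real.log n / (n : ℝ)) atTop (𝓝 0) :=
      Real.isLittleO_log_id_atTop.tendsto_div_nhds_zero.comp tendsto_natCast_atTop_atTop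
    have h3 : Tendsto (fun n : ℕ => 1 / (n : ℝ)) atTop (𝓝 0) :=
      tendsto_one_div_atTop_nhds_zero_nat
    have h4 := ((h1.const_mul (16 * (d : ℝ) ^ 2)).add
      ((h2.const_mul (32 * (d : ℝ) ^ 2 * Real.log (2 * R + 5))).add
      (h3.const_mul (16 * (d : ℝ) ^ 2 * Real.log (2 * R + 5) ^ 2 + 32
        + 2 * (4 * (K * (L * d)) ^ 2)))))
    simp only [mul_zero, add_zero] at h4
    refine h4.congr fun n => ?_
    simp only [ha]; ring
  · intro n hn θ hθ
    have hn0 : (0 : ℝ) < n := by exact_mod_cast hn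
    have hn1 : (1 : ℝ) ≤ n := by exact_mod_cast hn
    obtain ⟨T, hT1, hT2, hT3⟩ := exists_net hR0 hR n hn
    have hea : Real.exp (-(a n / 2)) * T.card ≤ 1 := by
      have e : Real.exp (a n / 2) = ((2 * R + 5) * n) ^ d := by
        simp only [ha]
        rw [mul_div_cancel_left₀ _ two_ne_zero, ← Real.log_mul (by positivity) hn0.ne',
          Real.exp_nat_mul, Real.exp_log (by positivity)]
      rw [Real.exp_neg, e, inv_mul_le_iff₀ (by positivity), mul_one]
      exact hT2
    set Z : Fin n → ℕ → ℝ := fun i k => ((k : ℝ) - s i θ) / Real.sqrt (s i θ) with hZ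
    have hptw : ∀ x : Fin n → ℕ, (cash s n θ x - cStat s θhat n x) ^ 2
        ≤ (4 * a n ^ 2 + 32 * (Real.exp (-(a n / 2)) *
            ∑ t ∈ T, Real.exp ((cash s n θ x - cash s n t x) / 2)))
          + (2 * ((K * (L * (d / n))) ^ 2 * n) * ∑ i : Fin n, (2 + 2 * Z i (x i) ^ 2)) := by
      intro x
      obtain ⟨hm, -⟩ := h.mle n x
      obtain ⟨t, ht, hdist⟩ := hT3 _ hm
      have hr0 : 0 ≤ cash s n t x - cStat s θhat n x := sub_nonneg.2 (h.cStat_le (hT1 t ht) n x)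
      have hr : cash s n t x - cStat s θhat n x
          ≤ K * (L * (d / n)) * ∑ i : Fin n, (1 + |Z i (x i)|) := by
        rw [cStat, cash_eq_sum, cash_eq_sum, ← Finset.sum_sub_distrib, Finset.mul_sum]
        refine Finset.sum_le_sum fun i _ => ?_
        refine hK (s i θ) (s i t) _ (L * (d / n)) (hlow i θ hθ) (hlow i t (hT1 t ht))
          (hlow i _ hm) (by positivity) (hLM i _ (hT1 t ht) _ hθ) (hLM i _ hm _ hθ) ?_ (x i)
        refine (hL i _ (hT1 t ht) _ hm).trans ?_
        rw [norm_sub_rev]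
        gcongr
      have hr2 : (cash s n t x - cStat s θhat n x) ^ 2
          ≤ (K * (L * (d / n))) ^ 2 * n * ∑ i : Fin n, (2 + 2 * Z i (x i) ^ 2) := by
        calc _ ≤ (K * (L * (d / n)) * ∑ i : Fin n, (1 + |Z i (x i)|)) ^ 2 := by gcongr
          _ = (K * (L * (d / n))) ^ 2 * (∑ i : Fin n, (1 + |Z i (x i)|)) ^ 2 := by ring
          _ ≤ (K * (L * (d / n))) ^ 2 * (n * ∑ i : Fin n, (1 + |Z i (x i)|) ^ 2) := by
              gcongr
              simpa using sq_sum_le_card_mul_sum_sq (s := (Finset.univ : Finset (Fin n)))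
                (f := fun i => 1 + |Z i (x i)|)
          _ ≤ (K * (L * (d / n))) ^ 2 * (n * ∑ i : Fin n, (2 + 2 * Z i (x i) ^ 2)) := by
              gcongr with i
              nlinarith [sq_abs (Z i (x i)), sq_nonneg (1 - |Z i (x i)|)]
          _ = _ := by ring
      have hy := sq_le_add_exp (y := cash s n θ x - cash s n t x)
        (r := cash s n t x - cStat s θhat n x) (a := a n)
        (by linarith [h.cStat_le hθ n x])
      have hsum : Real.exp ((cash s n θ x - cash s n t x) / 2)
          ≤ ∑ t ∈ T, Real.exp ((cash s n θ x - cash s n t x) / 2) :=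
        Finset.single_le_sum (f := fun t => Real.exp ((cash s n θ x - cash s n t x) / 2))
          (fun _ _ => (Real.exp_pos _).le) ht
      have e : cash s n θ x - cash s n t x + (cash s n t x - cStat s θhat n x)
          = cash s n θ x - cStat s θhat n x := by ring
      rw [e] at hy
      have hexp : Real.exp (-(a n / 2)) * Real.exp ((cash s n θ x - cash s n t x) / 2)
          ≤ Real.exp (-(a n / 2)) * ∑ t ∈ T, Real.exp ((cash s n θ x - cash s n t x) / 2) := by
        gcongr
      linarith
    have hint1 : Integrable (fun x : Fin n → ℕ =>
        ∑ t ∈ T, Real.exp ((cash s n θ x - cash s n t x) / 2)) (law s n θ) :=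
      integrable_finsetSum _ fun t ht => integrable_exp_cash_sub (hpos θ hθ) (hpos t (hT1 t ht))
    have hgZ : ∀ i : Fin n, ExpGrowth (fun k => 2 + 2 * Z i k ^ 2) := fun i => by
      have : ExpGrowth (Z i) := by
        simp only [hZ, div_eq_mul_inv]
        exact growth_sub.mul (ExpGrowth.const _)
      exact (ExpGrowth.const 2).add ((this.pow 2).const_mul 2)
    have hint2 : Integrable (fun x : Fin n → ℕ => ∑ i : Fin n, (2 + 2 * Z i (x i) ^ 2))
        (law s n θ) :=
      (DataGrowth.sum _ fun i => DataGrowth.eval i (hgZ i)).integrable s θ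
    have hI1 : ∫ x, ∑ t ∈ T, Real.exp ((cash s n θ x - cash s n t x) / 2) ∂(law s n θ)
        = T.card := by
      rw [integral_finsetSum _ fun t ht =>
        integrable_exp_cash_sub (hpos θ hθ) (hpos t (hT1 t ht)),
        Finset.sum_congr rfl fun t ht => integral_exp_cash_sub (hpos θ hθ) (hpos t (hT1 t ht))]
      simp
    have hI2 : ∫ x, ∑ i : Fin n, (2 + 2 * Z i (x i) ^ 2) ∂(law s n θ) = (n : ℝ) * 4 := by
      rw [integral_finsetSum _ fun i _ => (DataGrowth.eval i (hgZ i)).integrable s θ]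
      have : ∀ i : Fin n, ∫ x, (2 + 2 * Z i (x i) ^ 2) ∂(law s n θ) = 4 := fun i => by
        rw [integral_eval s θ i (fun k => 2 + 2 * Z i k ^ 2)]
        have hs := hpos θ hθ i
        have e : ∀ k, 2 + 2 * Z i k ^ 2 = 2 + (2 / s i θ) * ((k : ℝ) - s i θ) ^ 2 := fun k => by
          simp only [hZ]; rw [div_pow, Real.sq_sqrt hs.le]; ring
        simp only [e]
        rw [pmean_add (ExpGrowth.const 2) ((growth_sub.pow 2).const_mul _), pmean_const,
          pmean_const_mul, pmean_sub_sq hs.le]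
        field_simp; norm_num
      simp [this]
    have hD : DataGrowth (fun x => (cash s n θ x - cStat s θhat n x) ^ 2) :=
      ((growth_cash s θ).sub (h.growth_cStat n)).pow 2
    have hA := ((hint1.const_mul (Real.exp (-(a n / 2)))).const_mul 32)
    refine (integral_mono (hD.integrable s θ)
      (((integrable_const _).add hA).add (hint2.const_mul _)) hptw).trans ?_
    rw [integral_add' ((integrable_const _).add hA) (hint2.const_mul _),
      integral_add' (integrable_const _) hA, integral_const, probReal_univ, one_smul,
      integral_const_mul, integral_const_mul, integral_const_mul, hI1, hI2]
    have e : 2 * ((K * (L * (d / (n : ℝ)))) ^ 2 * n) * (n * 4)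
        = 2 * (4 * (K * (L * d)) ^ 2) := by field_simp
    rw [e]
    dsimp only
    linarith

/-- The constant depends only on the lower bound for the mean. Part 4 uses it with ε = 1,
independently of the setting. -/
lemma exists_var_dev_le {ε : ℝ} (hε : 0 < ε) : ∃ K : ℝ, 1 ≤ K ∧ ∀ r, ε ≤ r →
    Var[dev r; poissonMeasure r.toNNReal] ≤ K ∧ pmean r (fun k => (dev r k - pmean r (dev r)) ^ 4)
      ≤ K := by
  obtain ⟨K, hK, h⟩ := exists_pmean_dev_pow_four_le hε
  -- From (y - m)⁴ ≤ 8(y⁴ + m⁴), with mean deviance m ≤ 1 + K.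
  refine ⟨8 * (1 + K) + 8 * (1 + K) ^ 4, by nlinarith [pow_pos (show 0 < 1 + K by linarith) 4],
    fun r hr => ?_⟩
  have hr0 : 0 < r := hε.trans_le hr
  have g := growth_dev r
  have h4 := h r hr
  have h2 : pmean r (fun k => dev r k ^ 2) ≤ 1 + K := by
    refine (pmean_mono (g.pow 2) ((ExpGrowth.const 1).add (g.pow 4)) fun k => ?_).trans ?_
    · nlinarith [sq_nonneg (dev r k ^ 2 - 1)]
    · rw [pmean_add (ExpGrowth.const 1) (g.pow 4), pmean_const]; linarith
  have h1 : pmean r (dev r) ≤ 1 + K := by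
    refine (pmean_mono g ((ExpGrowth.const 1).add (g.pow 4)) fun k => ?_).trans ?_
    · nlinarith [sq_nonneg (dev r k ^ 2 - 1), sq_nonneg (dev r k - 1)]
    · rw [pmean_add (ExpGrowth.const 1) (g.pow 4), pmean_const]; linarith
  have h1' : 0 ≤ pmean r (dev r) := pmean_nonneg fun k => dev_nonneg hr0 k
  have hp : 0 < (1 + K) ^ 4 := by positivity
  constructor
  · refine (variance_le_expectation_sq (Measurable.of_discrete.aestronglyMeasurable)).trans ?_
    change pmean r (fun k => dev r k ^ 2) ≤ _
    linarith
  · set m := pmean r (dev r)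
    refine (pmean_mono ((g.sub (ExpGrowth.const m)).pow 4)
      (((g.pow 4).const_mul 8).add (ExpGrowth.const (8 * m ^ 4))) fun k => ?_).trans ?_
    · have e1 : (dev r k - m) ^ 2 ≤ 2 * (dev r k ^ 2 + m ^ 2) := by
        nlinarith [sq_nonneg (dev r k + m)]
      calc (dev r k - m) ^ 4 = ((dev r k - m) ^ 2) ^ 2 := by ring
        _ ≤ (2 * (dev r k ^ 2 + m ^ 2)) ^ 2 := by gcongr
        _ ≤ _ := by nlinarith [sq_nonneg (dev r k ^ 2 - m ^ 2)]
    · rw [pmean_add ((g.pow 4).const_mul 8) (ExpGrowth.const _), pmean_const_mul, pmean_const]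
      have : m ^ 4 ≤ (1 + K) ^ 4 := by gcongr
      linarith

lemma Setting.exists_funVar_le (h : Setting Θ s θ₀ θhat) : ∃ K : ℝ, 1 ≤ K ∧
    ∀ n, ∀ θ ∈ Θ, funVar s n θ ≤ K * n := by
  obtain ⟨ε, hε, hlow⟩ := h.b2
  obtain ⟨K, hK, hKb⟩ := exists_var_dev_le hε
  refine ⟨K, hK, fun n θ hθ => ?_⟩
  rw [funVar_eq_sum]
  calc _ ≤ ∑ _i : Fin n, K := Finset.sum_le_sum fun i _ => (hKb _ (hlow i θ hθ)).1
    _ = K * n := by simp [mul_comm]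

lemma sq_integral_le {n : ℕ} {X : (Fin n → ℕ) → ℝ} (hX : DataGrowth X) (θ : Param d) :
    (∫ x, X x ∂(law s n θ)) ^ 2 ≤ ∫ x, X x ^ 2 ∂(law s n θ) := by
  have h := variance_eq_sub (hX.memLp_two s θ)
  have h2 := variance_nonneg X (law s n θ)
  have e : ∫ x, (X ^ 2) x ∂(law s n θ) = ∫ x, X x ^ 2 ∂(law s n θ) := rfl
  linarith

/-- Uniformly over `Θ`, the bootstrap mean of the `C` statistic is `μ` up to `o(√n)`. -/
lemma Setting.statMean_sub_funMean (h : Setting Θ s θ₀ θhat) {δ : ℝ} (hδ : 0 < δ) :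
    ∀ᶠ n : ℕ in atTop, ∀ θ ∈ Θ, |statMean s θhat n θ - funMean s n θ| ≤ δ * Real.sqrt n := by
  obtain ⟨β, hβ, hb⟩ := h.exists_excess_bound
  filter_upwards [hβ.eventually (gt_mem_nhds (show 0 < δ ^ 2 by positivity)),
    eventually_ge_atTop 1] with n hn hn1 θ hθ
  have hn0 : (0 : ℝ) < n := by exact_mod_cast hn1
  have hD : DataGrowth (fun x => cash s n θ x - cStat s θhat n x) :=
    (growth_cash s θ).sub (h.growth_cStat n)
  have e : funMean s n θ - statMean s θhat n θ
      = ∫ x, (cash s n θ x - cStat s θhat n x) ∂(law s n θ) :=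
    (integral_sub ((growth_cash s θ).integrable s θ) ((h.growth_cStat n).integrable s θ)).symm
  rw [abs_sub_comm, e]
  apply abs_le_of_sq_le_sq _ (by positivity)
  rw [mul_pow, Real.sq_sqrt hn0.le]
  refine (sq_integral_le hD θ).trans ((hb n hn1 θ hθ).trans ?_)
  rw [div_lt_iff₀ hn0] at hn
  exact hn.le

/-- Uniformly over `Θ`, the bootstrap variance of the `C` statistic is the variance of the
`C` function up to `o(n)`. -/
lemma Setting.statVar_sub_funVar (h : Setting Θ s θ₀ θhat) {δ : ℝ} (hδ : 0 < δ) :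
    ∀ᶠ n : ℕ in atTop, ∀ θ ∈ Θ, |statVar s θhat n θ - funVar s n θ| ≤ δ * n := by
  obtain ⟨β, hβ, hb⟩ := h.exists_excess_bound
  obtain ⟨K, hK, hV⟩ := h.exists_funVar_le
  have hK0 : 0 < K := by linarith
  -- The weight in |2 cov(C, D)| ≤ t V + Var(D)/t: it makes t V ≤ δn/2, and then Var(D)(1 + 1/t) ≤
  -- δn/2 eventually.
  set t := δ / (2 * K) with ht
  have ht0 : 0 < t := by positivity
  filter_upwards [hβ.eventually (gt_mem_nhds (show 0 < δ / 2 / (1 + 1 / t) by positivity)),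
    eventually_ge_atTop 1] with n hn hn1 θ hθ
  have hn0 : (0 : ℝ) < n := by exact_mod_cast hn1
  have hC := (growth_cash s θ).memLp_two (n := n) s θ
  have hDg : DataGrowth (fun x => cash s n θ x - cStat s θhat n x) :=
    (growth_cash s θ).sub (h.growth_cStat n)
  set D : (Fin n → ℕ) → ℝ := fun x => cash s n θ x - cStat s θhat n x with hD
  have hDm := hDg.memLp_two s θ
  have hDv : Var[D; law s n θ] ≤ β n :=
    (variance_le_expectation_sq Measurable.of_discrete.aestronglyMeasurable).trans (hb n hn1 θ hθ)
  have hD0 := variance_nonneg D (law s n θ)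
  have hv : statVar s θhat n θ = funVar s n θ
      - 2 * cov[cash s n θ, D; law s n θ] + Var[D; law s n θ] := by
    have e : cStat s θhat n = cash s n θ - D := by ext x; simp [hD]
    rw [statVar, e, variance_sub hC hDm, funVar]
  -- Nonnegativity of the variances of tC - D and tC + D gives the weighted covariance bound.
  have h1 := variance_nonneg (fun x => t * cash s n θ x - D x) (law s n θ)
  have h2 := variance_nonneg (fun x => t * cash s n θ x + D x) (law s n θ)
  rw [variance_fun_sub (hC.const_mul t) hDm, variance_const_mul, covariance_const_mul_left] at h1
  rw [variance_fun_add (hC.const_mul t) hDm, variance_const_mul, covariance_const_mul_left] at h2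
  have hVn := hV n θ hθ
  have hVar : Var[cash s n θ; law s n θ] = funVar s n θ := rfl
  rw [hVar] at h1 h2
  set V := funVar s n θ
  set c := cov[cash s n θ, D; law s n θ]
  set w := Var[D; law s n θ]
  have hc : |2 * c| ≤ t * V + w / t := by
    have e : t * (t * V + w / t) = t ^ 2 * V + w := by field_simp
    rw [abs_le]
    constructor
    · have : 0 ≤ t * (t * V + w / t + 2 * c) := by rw [mul_add, e]; linarith
      linarith [nonneg_of_mul_nonneg_right this ht0]
    · have : 0 ≤ t * (t * V + w / t - 2 * c) := by rw [mul_sub, e]; linarith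
      linarith [nonneg_of_mul_nonneg_right this ht0]
  have hw : w * (1 + 1 / t) ≤ δ / 2 * n := by
    rw [div_lt_iff₀ hn0] at hn
    have h5 : w ≤ δ / 2 / (1 + 1 / t) * n := hDv.trans hn.le
    calc w * (1 + 1 / t) ≤ δ / 2 / (1 + 1 / t) * n * (1 + 1 / t) := by gcongr
      _ = _ := by field_simp
  have htV : t * V ≤ δ / 2 * n := by
    calc t * V ≤ t * (K * n) := by gcongr
      _ = _ := by rw [ht]; field_simp
  rw [hv]
  have e : V - 2 * c + w - V = w - 2 * c := by ring
  rw [e]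
  have e2 : w / t = w * (1 / t) := by ring
  calc |w - 2 * c| ≤ |w| + |2 * c| := abs_sub _ _
    _ ≤ w + (t * V + w / t) := by rw [abs_of_nonneg hD0]; gcongr
    _ ≤ δ * n := by rw [e2]; linarith

end excess

/-! ### Bounds on Q and on V - Q -/

section quad

variable {d n : ℕ} {s : ℕ → Param d → ℝ} {θ : Param d}

/-- `Q` is nonnegative, and it is at most the sum of the variances explained by the counts. -/
lemma quadQ_bounds (hpos : ∀ i, 0 < s i θ) (hd : ∀ i, DifferentiableAt ℝ (s i) θ) :
    0 ≤ quadQ s n θ ∧ quadQ s n θ ≤ ∑ i : Fin n, s i θ * slope (s i θ) ^ 2 := by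
  by_cases hdet : IsUnit (info s n θ).det
  · set b := (info s n θ)⁻¹ *ᵥ crossCov s n θ with hb
    have hJb : info s n θ *ᵥ b = crossCov s n θ := by
      rw [hb, Matrix.mulVec_mulVec, Matrix.mul_nonsing_inv _ hdet, Matrix.one_mulVec]
    set t : Fin n → ℝ := fun i => ∑ j, b j * grad s i θ j with ht
    have h1 : quadQ s n θ = ∑ i : Fin n, slope (s i θ) * t i := by
      rw [quadQ, ← hb]
      simp only [dotProduct, crossCov_eq hpos hd, ht, Finset.mul_sum, Finset.sum_mul]
      rw [Finset.sum_comm]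
      exact Finset.sum_congr rfl fun i _ => Finset.sum_congr rfl fun j _ => by ring
    have h2 : quadQ s n θ = ∑ i : Fin n, t i ^ 2 / s i θ := by
      have : quadQ s n θ = (info s n θ *ᵥ b) ⬝ᵥ b := by rw [quadQ, hJb]
      rw [this]
      simp only [dotProduct, Matrix.mulVec, info_eq hpos hd, ht, Finset.sum_mul]
      -- With b = J⁻¹c, Q = bᵀJb is the variance of the projection b · score, which is a combination
      -- of the counts with weights t_i / s_i.
      have e : ∀ i : Fin n, (∑ j, b j * grad s i θ j) ^ 2 / s i θ
          = ∑ j, ∑ k, grad s i θ j * grad s i θ k / s i θ * b k * b j := fun i => by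
        rw [pow_two, Finset.sum_mul_sum, Finset.sum_div]
        refine Finset.sum_congr rfl fun j _ => ?_
        rw [Finset.sum_div]
        exact Finset.sum_congr rfl fun k _ => by ring
      rw [Finset.sum_congr rfl fun i _ => e i, Finset.sum_comm (s := Finset.univ (α := Fin n))]
      refine Finset.sum_congr rfl fun j _ => ?_
      rw [Finset.sum_comm]
    constructor
    · rw [h2]
      exact Finset.sum_nonneg fun i _ => div_nonneg (sq_nonneg _) (hpos i).le
    -- Q is both ∑ slope·t and ∑ t²/s, hence 2∑ slope·t - ∑ t²/s; completing the square in each bin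
    -- gives the bound.
    · have h3 : quadQ s n θ
          = ∑ i : Fin n, (2 * (slope (s i θ) * t i) - t i ^ 2 / s i θ) := by
        rw [Finset.sum_sub_distrib, ← Finset.mul_sum, ← h1, ← h2]; ring
      rw [h3]
      refine Finset.sum_le_sum fun i _ => ?_
      have hs := hpos i
      have e : s i θ * slope (s i θ) ^ 2 - (2 * (slope (s i θ) * t i) - t i ^ 2 / s i θ)
          = (s i θ * slope (s i θ) - t i) ^ 2 / s i θ := by field_simp; ring
      have : 0 ≤ (s i θ * slope (s i θ) - t i) ^ 2 / s i θ := by positivity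
      linarith
  -- For singular information the inverse is 0 by convention, so Q = 0.
  · have : quadQ s n θ = 0 := by
      rw [quadQ, Matrix.nonsing_inv_apply_not_isUnit _ hdet, Matrix.zero_mulVec,
        dotProduct_zero]
    rw [this]
    exact ⟨le_rfl, Finset.sum_nonneg fun i _ => mul_nonneg (hpos i).le (sq_nonneg _)⟩

/-- The score lies in the span of the individual counts, so removing its contribution leaves at
least the residual of each deviance after regression on its own count. -/
lemma funVar_sub_quadQ_ge (hpos : ∀ i, 0 < s i θ) (hd : ∀ i, DifferentiableAt ℝ (s i) θ) :
    ∑ i : Fin n, 2 / 9 * (s i θ / (s i θ + 1)) ^ 2 ≤ funVar s n θ - quadQ s n θ := by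
  have h := (quadQ_bounds (n := n) hpos hd).2
  have h2 : ∑ i : Fin n, 2 / 9 * (s i θ / (s i θ + 1)) ^ 2
      ≤ ∑ i : Fin n, (Var[dev (s i θ); poissonMeasure (s i θ).toNNReal]
        - s i θ * slope (s i θ) ^ 2) :=
    Finset.sum_le_sum fun i _ => residual_dev_ge (hpos i)
  rw [Finset.sum_sub_distrib, ← funVar_eq_sum] at h2
  linarith

/-- The bound |slope| ≤ 2/s makes each explained variance s·slope² at most 4/s. This is the source
of the decay in part 4. -/
lemma quadQ_le (hpos : ∀ i, 0 < s i θ) (hd : ∀ i, DifferentiableAt ℝ (s i) θ) :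
    quadQ s n θ ≤ ∑ i : Fin n, 4 / s i θ := by
  refine (quadQ_bounds hpos hd).2.trans (Finset.sum_le_sum fun i _ => ?_)
  have hs := hpos i
  have h := abs_slope_le hs
  have h2 : slope (s i θ) ^ 2 ≤ (2 / s i θ) ^ 2 := by
    rw [← sq_abs]; gcongr
  calc s i θ * slope (s i θ) ^ 2 ≤ s i θ * (2 / s i θ) ^ 2 := by gcongr
    _ = 4 / s i θ := by field_simp; norm_num

end quad

/-! ### Uniform smoothness near the true parameter -/

section local_

variable {d : ℕ}

/-- A scalar function of `f`, times the gradient of `f`, is Lipschitz if the derivatives of `f`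
of order `1` and `2` are of the order `√f`. -/
lemma norm_comp_smul_fderiv_sub_le {f : Param d → ℝ} {U : Set (Param d)} (hU : Convex ℝ U)
    (hUo : IsOpen U) (hf : ContDiffOn ℝ 2 f U) {ε L A B : ℝ} (hε : 0 < ε) (hL : 0 ≤ L)
    (hlow : ∀ θ ∈ U, ε ≤ f θ)
    (h1 : ∀ θ ∈ U, ‖fderiv ℝ f θ‖ ≤ L * Real.sqrt (f θ))
    (h2 : ∀ θ ∈ U, ‖fderiv ℝ (fderiv ℝ f) θ‖ ≤ L * Real.sqrt (f θ))
    {c c' : ℝ → ℝ} (hc : ∀ t, 0 < t → HasDerivAt c (c' t) t)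
    (hA : ∀ t, ε ≤ t → |c t| * Real.sqrt t ≤ A) (hB : ∀ t, ε ≤ t → |c' t| * t ≤ B)
    {θ θ' : Param d} (hθ : θ ∈ U) (hθ' : θ' ∈ U) :
    ‖c (f θ) • fderiv ℝ f θ - c (f θ') • fderiv ℝ f θ'‖ ≤ (A * L + B * L ^ 2) * ‖θ - θ'‖ := by
  have hder : ∀ t ∈ U, HasFDerivAt (fun t => c (f t) • fderiv ℝ f t)
      (c (f t) • fderiv ℝ (fderiv ℝ f) t + (c' (f t) • fderiv ℝ f t).smulRight (fderiv ℝ f t)) t := by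
    intro t ht
    have hat : ContDiffAt ℝ 2 f t := hf.contDiffAt (hUo.mem_nhds ht)
    have hd1 : HasFDerivAt f (fderiv ℝ f t) t := (hat.differentiableAt (by norm_num)).hasFDerivAt
    have hd2 : HasFDerivAt (fderiv ℝ f) (fderiv ℝ (fderiv ℝ f) t) t :=
      ((hat.fderiv_right (m := 1) (by norm_num)).differentiableAt (by norm_num)).hasFDerivAt
    exact ((hc _ (hε.trans_le (hlow t ht))).comp_hasFDerivAt t hd1).smul hd2
  refine hU.norm_image_sub_le_of_norm_hasFDerivWithin_le
    (fun t ht => (hder t ht).hasFDerivWithinAt) (fun t ht => ?_) hθ' hθ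
  have hs : Real.sqrt (f t) ^ 2 = f t := Real.sq_sqrt (hε.le.trans (hlow t ht))
  have hs0 := Real.sqrt_nonneg (f t)
  refine (norm_add_le _ _).trans (add_le_add ?_ ?_)
  · rw [norm_smul, Real.norm_eq_abs]
    calc |c (f t)| * ‖fderiv ℝ (fderiv ℝ f) t‖ ≤ |c (f t)| * (L * Real.sqrt (f t)) := by
          gcongr; exact h2 t ht
      _ = (|c (f t)| * Real.sqrt (f t)) * L := by ring
      _ ≤ A * L := by gcongr; exact hA _ (hlow t ht)
  · rw [ContinuousLinearMap.norm_smulRight_apply, norm_smul, Real.norm_eq_abs]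
    calc |c' (f t)| * ‖fderiv ℝ f t‖ * ‖fderiv ℝ f t‖
        ≤ |c' (f t)| * (L * Real.sqrt (f t)) * (L * Real.sqrt (f t)) := by
          gcongr <;> exact h1 t ht
      _ = (|c' (f t)| * Real.sqrt (f t) ^ 2) * L ^ 2 := by ring
      _ ≤ B * L ^ 2 := by rw [hs]; gcongr; exact hB _ (hlow t ht)

variable {Θ : Set (Param d)} {s : ℕ → Param d → ℝ} {θ₀ : Param d}
  {θhat : (n : ℕ) → (Fin n → ℕ) → Param d}

lemma sum_mul_coord (l : Param d →L[ℝ] ℝ) (v : Param d) :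
    l v = ∑ j, l (EuclideanSpace.single j 1) * v j := by
  have h : v = ∑ j, v j • EuclideanSpace.single j (1 : ℝ) := by
    ext k
    simp [Finset.sum_apply, Pi.single_apply]
  conv_lhs => rw [h, map_sum]
  exact Finset.sum_congr rfl fun j _ => by rw [map_smul, smul_eq_mul, mul_comm]

/-- Uniform smoothness, near the true parameter, of the quantities that enter the moments of the
`C` function. -/
lemma Setting.exists_local (h : Setting Θ s θ₀ θhat) : ∃ r : ℝ, 0 < r ∧ ∃ K : ℝ, 0 ≤ K ∧
    Metric.ball θ₀ r ⊆ Θ ∧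
    ∀ θ ∈ Metric.ball θ₀ r, (∀ i, DifferentiableAt ℝ (s i) θ) ∧
      ∀ n : ℕ, (∀ j, |crossCov s n θ j| ≤ K * n) ∧
        (∀ j, |crossCov s n θ j - crossCov s n θ₀ j| ≤ K * n * ‖θ - θ₀‖) ∧
        (∀ j k, |info s n θ j k - info s n θ₀ j k| ≤ K * n * ‖θ - θ₀‖) ∧
        |funMean s n θ - funMean s n θ₀ - ∑ j, crossCov s n θ₀ j * (θ - θ₀) j|
          ≤ K * n * ‖θ - θ₀‖ ^ 2 := by
  obtain ⟨ε, hε, hlow⟩ := h.b2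
  obtain ⟨r₁, hr₁, hball⟩ := Metric.isOpen_iff.1 isOpen_interior θ₀ h.standing.interior_mem
  obtain ⟨r₂, hr₂, L', hsm⟩ := h.standing.smooth
  set L := max L' 0
  have hL : 0 ≤ L := le_max_right _ _
  set r := min r₁ r₂
  have hr : 0 < r := lt_min hr₁ hr₂
  set U := Metric.ball θ₀ r with hU
  have hUΘ : U ⊆ Θ := (Metric.ball_subset_ball (min_le_left _ _)).trans
    (hball.trans interior_subset)
  have hU2 : U ⊆ Metric.ball θ₀ r₂ := Metric.ball_subset_ball (min_le_right _ _)
  have hθ₀ : θ₀ ∈ U := Metric.mem_ball_self hr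
  have hcd : ∀ i, ContDiffOn ℝ 3 (s i) U := fun i => (hsm i).1.mono hU2
  have hUo : IsOpen U := Metric.isOpen_ball
  have hUc : Convex ℝ U := convex_ball _ _
  have hdiff : ∀ θ ∈ U, ∀ i, DifferentiableAt ℝ (s i) θ := fun θ hθ i =>
    ((hcd i).contDiffAt (hUo.mem_nhds hθ)).differentiableAt (by norm_num)
  have hlowU : ∀ i, ∀ θ ∈ U, ε ≤ s i θ := fun i θ hθ => hlow i θ (hUΘ hθ)
  have hposU : ∀ θ ∈ U, ∀ i, 0 < s i θ := fun θ hθ i => hε.trans_le (hlowU i θ hθ)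
  have h1 : ∀ i, ∀ θ ∈ U, ‖fderiv ℝ (s i) θ‖ ≤ L * Real.sqrt (s i θ) := fun i θ hθ => by
    have := (hsm i).2 θ (hU2 hθ) 1 le_rfl (by norm_num)
    rw [norm_iteratedFDeriv_one] at this
    exact this.trans (by gcongr; exact le_max_left _ _)
  have h2 : ∀ i, ∀ θ ∈ U, ‖fderiv ℝ (fderiv ℝ (s i)) θ‖ ≤ L * Real.sqrt (s i θ) :=
    fun i θ hθ => by
      have := (hsm i).2 θ (hU2 hθ) 2 (by norm_num) (by norm_num)
      rw [← norm_iteratedFDeriv_fderiv, norm_iteratedFDeriv_one] at this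
      exact this.trans (by gcongr; exact le_max_left _ _)
  set e := Real.sqrt ε with he
  have he0 : 0 < e := Real.sqrt_pos.2 hε
  have hle : ∀ t, ε ≤ t → e ≤ Real.sqrt t := fun t ht => Real.sqrt_le_sqrt ht
  have hslopeA : ∀ t, ε ≤ t → |slope t| * Real.sqrt t ≤ 2 / e := fun t ht => by
    have ht0 := hε.trans_le ht
    have := hle t ht
    calc |slope t| * Real.sqrt t ≤ 2 / t * Real.sqrt t := by gcongr; exact abs_slope_le ht0
      _ = 2 / Real.sqrt t := by
          rw [div_mul_eq_mul_div, div_eq_div_iff ht0.ne' (by positivity), mul_assoc,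
            Real.mul_self_sqrt ht0.le]
      _ ≤ 2 / e := by gcongr
  -- The Lipschitz constant of the one-bin gradient of μ, from the scalar factor `slope` with A =
  -- 2/e and B = 2.
  set KA := 2 / e * L + 2 * L ^ 2 with hKA
  have hphi : ∀ i, ∀ θ ∈ U, ∀ θ' ∈ U, ‖slope (s i θ) • fderiv ℝ (s i) θ
      - slope (s i θ') • fderiv ℝ (s i) θ'‖ ≤ KA * ‖θ - θ'‖ := fun i θ hθ θ' hθ' =>
    norm_comp_smul_fderiv_sub_le hUc hUo ((hcd i).of_le (by norm_num)) hε hL (hlowU i) (h1 i) (h2 i)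
      (fun t ht => hasDerivAt_slope ht) hslopeA
      (fun t ht => by
        have ht0 := hε.trans_le ht
        calc _ ≤ 2 / t * t := by gcongr; exact abs_deriv_slope_le ht0
          _ = 2 := by field_simp) hθ hθ'
  -- The same for the normalized gradient ∇s/√s, from t^(-1/2) with A = 1 and B = 1/(2e). Its
  -- coordinate products are the summands of the information.
  set KB := 1 * L + (1 / (2 * e)) * L ^ 2 with hKB
  have hpsi : ∀ i, ∀ θ ∈ U, ∀ θ' ∈ U, ‖(Real.sqrt (s i θ))⁻¹ • fderiv ℝ (s i) θ
      - (Real.sqrt (s i θ'))⁻¹ • fderiv ℝ (s i) θ'‖ ≤ KB * ‖θ - θ'‖ := fun i θ hθ θ' hθ' =>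
    norm_comp_smul_fderiv_sub_le (c := fun t => (Real.sqrt t)⁻¹) hUc hUo
      ((hcd i).of_le (by norm_num)) hε hL (hlowU i) (h1 i) (h2 i)
      (fun t ht => (Real.hasDerivAt_sqrt ht.ne').inv (Real.sqrt_pos.2 ht).ne')
      (fun t ht => by
        have := Real.sqrt_pos.2 (hε.trans_le ht)
        rw [abs_of_pos (by positivity), inv_mul_cancel₀ this.ne'])
      (fun t ht => by
        have ht0 := hε.trans_le ht
        have := Real.sqrt_pos.2 ht0
        rw [abs_div, abs_neg, abs_of_pos (by positivity : 0 < 1 / (2 * Real.sqrt t)),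
          abs_of_pos (by positivity : 0 < Real.sqrt t ^ 2), Real.sq_sqrt ht0.le,
          div_mul_cancel₀ _ ht0.ne']
        gcongr; exact hle t ht) hθ hθ'
  have hpsiB : ∀ i, ∀ θ ∈ U, ‖(Real.sqrt (s i θ))⁻¹ • fderiv ℝ (s i) θ‖ ≤ L := fun i θ hθ => by
    have := Real.sqrt_pos.2 (hposU θ hθ i)
    rw [norm_smul, norm_inv, Real.norm_eq_abs, abs_of_pos this, inv_mul_le_iff₀ this, mul_comm]
    exact h1 i θ hθ
  have hsingle : ∀ j : Fin d, ‖EuclideanSpace.single j (1 : ℝ)‖ = 1 := fun j => by simp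
  have happ : ∀ (l : Param d →L[ℝ] ℝ) (j : Fin d), |l (EuclideanSpace.single j 1)| ≤ ‖l‖ :=
    fun l j => by
      have := l.le_opNorm (EuclideanSpace.single j 1)
      rwa [hsingle, mul_one] at this
  have hsum : ∀ (n : ℕ) (a : Fin n → ℝ) (b : ℝ), (∀ i, |a i| ≤ b) → |∑ i, a i| ≤ n * b :=
    fun n a b hab => (Finset.abs_sum_le_sum_abs _ _).trans
      ((Finset.sum_le_sum fun i _ => hab i).trans_eq (by simp))
  have hKA0 : 0 ≤ KA := by positivity
  have hKB0 : 0 ≤ KB := by positivity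
  refine ⟨r, hr, 2 / e * L + KA + 2 * L * KB, by positivity, hUΘ, fun θ hθ => ⟨hdiff θ hθ,
    fun n => ⟨fun j => ?_, fun j => ?_, fun j k => ?_, ?_⟩⟩⟩
  · rw [crossCov_eq (hposU θ hθ) (hdiff θ hθ)]
    refine (hsum n _ (2 / e * L) fun i => ?_).trans ?_
    · rw [abs_mul]
      calc |slope (s i θ)| * |grad s i θ j| ≤ |slope (s i θ)| * (L * Real.sqrt (s i θ)) := by
            gcongr
            exact (happ _ j).trans (h1 i θ hθ)
        _ = (|slope (s i θ)| * Real.sqrt (s i θ)) * L := by ring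
        _ ≤ _ := by gcongr; exact hslopeA _ (hlowU i θ hθ)
    · rw [mul_comm]
      gcongr
      linarith [show 0 ≤ KA + 2 * L * KB by positivity]
  · rw [crossCov_eq (hposU θ hθ) (hdiff θ hθ), crossCov_eq (hposU θ₀ hθ₀) (hdiff θ₀ hθ₀),
      ← Finset.sum_sub_distrib]
    refine (hsum n _ (KA * ‖θ - θ₀‖) fun i => ?_).trans ?_
    · exact (happ (slope (s i θ) • fderiv ℝ (s i) θ - slope (s i θ₀) • fderiv ℝ (s i) θ₀) j).trans
        (hphi i θ hθ θ₀ hθ₀)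
    · rw [← mul_assoc, mul_comm (n : ℝ)]
      gcongr
      linarith [show 0 ≤ 2 / e * L by positivity, show 0 ≤ 2 * L * KB by positivity]
  · rw [info_eq (hposU θ hθ) (hdiff θ hθ), info_eq (hposU θ₀ hθ₀) (hdiff θ₀ hθ₀),
      ← Finset.sum_sub_distrib]
    refine (hsum n _ (2 * L * KB * ‖θ - θ₀‖) fun i => ?_).trans ?_
    · set p := (Real.sqrt (s i θ))⁻¹ • fderiv ℝ (s i) θ
      set q := (Real.sqrt (s i θ₀))⁻¹ • fderiv ℝ (s i) θ₀
      have hw : ∀ t ∈ U, grad s i t j * grad s i t k / s i t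
          = ((Real.sqrt (s i t))⁻¹ • fderiv ℝ (s i) t) (EuclideanSpace.single j 1)
            * ((Real.sqrt (s i t))⁻¹ • fderiv ℝ (s i) t) (EuclideanSpace.single k 1) := by
        intro t ht
        have h0 := Real.sqrt_pos.2 (hposU t ht i)
        have h3 := Real.sq_sqrt (hposU t ht i).le
        simp only [_root_.smul_apply, smul_eq_mul, grad]
        conv_lhs => rw [← h3]
        field_simp
      rw [hw θ hθ, hw θ₀ hθ₀]
      change |p _ * p _ - q _ * q _| ≤ _
      have e1 : p (EuclideanSpace.single j 1) * p (EuclideanSpace.single k 1)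
          - q (EuclideanSpace.single j 1) * q (EuclideanSpace.single k 1)
          = p (EuclideanSpace.single j 1) * (p - q) (EuclideanSpace.single k 1)
            + (p - q) (EuclideanSpace.single j 1) * q (EuclideanSpace.single k 1) := by
        simp only [_root_.sub_apply]; ring
      have hpq := hpsi i θ hθ θ₀ hθ₀
      rw [e1]
      calc _ ≤ |p (EuclideanSpace.single j 1)| * |(p - q) (EuclideanSpace.single k 1)|
            + |(p - q) (EuclideanSpace.single j 1)| * |q (EuclideanSpace.single k 1)| := by
            rw [← abs_mul, ← abs_mul]; exact abs_add_le _ _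
        _ ≤ L * (KB * ‖θ - θ₀‖) + (KB * ‖θ - θ₀‖) * L := by
            gcongr
            · exact (happ _ _).trans (hpsiB i θ hθ)
            · exact (happ _ _).trans hpq
            · exact (happ _ _).trans hpq
            · exact (happ _ _).trans (hpsiB i θ₀ hθ₀)
        _ = _ := by ring
    · rw [← mul_assoc, mul_comm (n : ℝ)]
      gcongr
      linarith [show 0 ≤ 2 / e * L by positivity]
  -- Since c(θ₀) is the gradient of μ, this is a first-order Taylor remainder; the Lipschitz
  -- gradient makes it quadratic in each bin.
  · have hc : ∑ j, crossCov s n θ₀ j * (θ - θ₀) j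
        = ∑ i : Fin n, (slope (s i θ₀) • fderiv ℝ (s i) θ₀) (θ - θ₀) := by
      have : ∀ i : Fin n, (slope (s i θ₀) • fderiv ℝ (s i) θ₀) (θ - θ₀)
          = ∑ j, slope (s i θ₀) * grad s i θ₀ j * (θ - θ₀) j := fun i => by
        rw [sum_mul_coord]; rfl
      rw [Finset.sum_congr rfl fun i _ => this i, Finset.sum_comm]
      refine Finset.sum_congr rfl fun j _ => ?_
      rw [crossCov_eq (hposU θ₀ hθ₀) (hdiff θ₀ hθ₀), Finset.sum_mul]
    rw [hc, funMean_eq_sum, funMean_eq_sum, ← Finset.sum_sub_distrib, ← Finset.sum_sub_distrib]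
    refine (hsum n _ (KA * ‖θ - θ₀‖ ^ 2) fun i => ?_).trans ?_
    · have hsub : Metric.closedBall θ₀ ‖θ - θ₀‖ ⊆ U :=
        Metric.closedBall_subset_ball (by rwa [Metric.mem_ball, dist_eq_norm] at hθ)
      have hd : ∀ t ∈ Metric.closedBall θ₀ ‖θ - θ₀‖,
          HasFDerivWithinAt (fun t => pmean (s i t) (dev (s i t)))
            (slope (s i t) • fderiv ℝ (s i) t) (Metric.closedBall θ₀ ‖θ - θ₀‖) t := fun t ht =>
        ((hasDerivAt_pmean_dev (hposU t (hsub ht) i)).comp_hasFDerivAt t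
          (hdiff t (hsub ht) i).hasFDerivAt).hasFDerivWithinAt
      have hb : ∀ t ∈ Metric.closedBall θ₀ ‖θ - θ₀‖, ‖slope (s i t) • fderiv ℝ (s i) t
          - slope (s i θ₀) • fderiv ℝ (s i) θ₀‖ ≤ KA * ‖θ - θ₀‖ := fun t ht => by
        refine (hphi i t (hsub ht) θ₀ hθ₀).trans ?_
        gcongr
        rwa [Metric.mem_closedBall, dist_eq_norm] at ht
      have := (convex_closedBall θ₀ ‖θ - θ₀‖).norm_image_sub_le_of_norm_hasFDerivWithin_le' hd hb
        (Metric.mem_closedBall_self (norm_nonneg _))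
        (show θ ∈ Metric.closedBall θ₀ ‖θ - θ₀‖ by rw [Metric.mem_closedBall, dist_eq_norm])
      rw [Real.norm_eq_abs] at this
      exact this.trans_eq (by ring)
    · rw [← mul_assoc, mul_comm (n : ℝ)]
      gcongr
      linarith [show 0 ≤ 2 / e * L by positivity, show 0 ≤ 2 * L * KB by positivity]

end local_

/-! ### Limits of inverses and of products -/

section matrixLimits

/-- Valid for singular matrices too, where both inverses are 0. -/
lemma inv_smul_of_ne_zero {d : ℕ} {c : ℝ} (hc : c ≠ 0) (A : Matrix (Fin d) (Fin d) ℝ) :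
    (c • A)⁻¹ = c⁻¹ • A⁻¹ := by
  by_cases h : IsUnit A.det
  · have := invertibleOfNonzero hc
    rw [Matrix.inv_smul A c h, invOf_eq_inv]
  · have h2 : ¬ IsUnit (c • A).det := by
      rw [Matrix.det_smul]
      intro h3
      exact h (isUnit_of_mul_isUnit_right h3)
    rw [Matrix.nonsing_inv_apply_not_isUnit _ h, Matrix.nonsing_inv_apply_not_isUnit _ h2,
      smul_zero]

lemma tendsto_matrix_inv {d : ℕ} {ι : Type*} {l : Filter ι} {A : ι → Matrix (Fin d) (Fin d) ℝ}
    {B : Matrix (Fin d) (Fin d) ℝ} (hB : B.det ≠ 0) (h : ∀ j k, Tendsto (fun i => A i j k) l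
      (𝓝 (B j k))) (j k : Fin d) : Tendsto (fun i => (A i)⁻¹ j k) l (𝓝 (B⁻¹ j k)) := by
  have h1 : Tendsto A l (𝓝 B) := tendsto_pi_nhds.2 fun j => tendsto_pi_nhds.2 fun k => h j k
  have h2 : ContinuousAt Inv.inv B := continuousAt_matrix_inv B (by
    rw [Ring.inverse_eq_inv']
    exact continuousAt_inv₀ hB)
  exact tendsto_pi_nhds.1 (tendsto_pi_nhds.1 (h2.tendsto.comp h1) j) k

lemma tendsto_mul_sub_mul {ι : Type*} {l : Filter ι} {X X' Y Y' : ι → ℝ} {K K' : ℝ}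
    (hX : Tendsto (fun i => X i - X' i) l (𝓝 0)) (hY : Tendsto (fun i => Y i - Y' i) l (𝓝 0))
    (hX' : ∀ᶠ i in l, |X' i| ≤ K) (hY' : ∀ᶠ i in l, |Y i| ≤ K') :
    Tendsto (fun i => X i * Y i - X' i * Y' i) l (𝓝 0) := by
  have e : ∀ i, X i * Y i - X' i * Y' i = (X i - X' i) * Y i + X' i * (Y i - Y' i) :=
    fun i => by ring
  simp only [e]
  have h1 : Tendsto (fun i => (X i - X' i) * Y i) l (𝓝 0) := by
    refine squeeze_zero_norm' (a := fun i => |X i - X' i| * K') ?_ ?_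
    · filter_upwards [hY'] with i hi
      rw [Real.norm_eq_abs, abs_mul]; gcongr
    · simpa using hX.abs.mul_const K'
  have h2 : Tendsto (fun i => X' i * (Y i - Y' i)) l (𝓝 0) := by
    refine squeeze_zero_norm' (a := fun i => K * |Y i - Y' i|) ?_ ?_
    · filter_upwards [hX'] with i hi
      rw [Real.norm_eq_abs, abs_mul]; gcongr
    · simpa using hY.abs.const_mul K
  simpa using h1.add h2

end matrixLimits

/-! ### Q/n near the true parameter and along subsequences -/

section quadLimits

variable {d : ℕ} {Θ : Set (Param d)} {s : ℕ → Param d → ℝ} {θ₀ : Param d}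
  {θhat : (n : ℕ) → (Fin n → ℕ) → Param d}

/-- The information per bin. -/
noncomputable def infoBar (s : ℕ → Param d → ℝ) (n : ℕ) (θ : Param d) :
    Matrix (Fin d) (Fin d) ℝ := Matrix.of fun j k => info s n θ j k / (n : ℝ)

/-- Per-bin normalization of both c and J: only these normalized quantities have bounds and limits.
-/
lemma quadQ_div_eq {n : ℕ} (hn : n ≠ 0) (θ : Param d) : quadQ s n θ / (n : ℝ)
    = ∑ j, ∑ k, crossCov s n θ j / n * (crossCov s n θ k / n) * (infoBar s n θ)⁻¹ j k := by
  have hn' : (n : ℝ) ≠ 0 := by exact_mod_cast hn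
  have h : info s n θ = (n : ℝ) • infoBar s n θ := by
    ext j k
    simp only [infoBar, Matrix.smul_apply, Matrix.of_apply, smul_eq_mul]
    field_simp
  rw [quadQ, h, inv_smul_of_ne_zero hn']
  simp only [dotProduct, Matrix.mulVec, Matrix.smul_apply, smul_eq_mul, Finset.mul_sum,
    Finset.sum_div]
  refine Finset.sum_congr rfl fun j _ => Finset.sum_congr rfl fun k _ => ?_
  field_simp

lemma eventually_fst_atTop {d : ℕ} {θ₀ : Param d} {p : ℕ → Prop} (h : ∀ᶠ n in atTop, p n) :
    ∀ᶠ q : ℕ × Param d in atTop ×ˢ 𝓝 θ₀, p q.1 := tendsto_fst.eventually h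

lemma eventually_snd_nhds {d : ℕ} {θ₀ : Param d} {p : Param d → Prop} (h : ∀ᶠ θ in 𝓝 θ₀, p θ) :
    ∀ᶠ q : ℕ × Param d in atTop ×ˢ 𝓝 θ₀, p q.2 := tendsto_snd.eventually h

/-- Convergence along `atTop ×ˢ 𝓝 θ₀` expresses continuity at θ₀ uniformly in large n, the form in
which a random parameter can later be substituted. -/
lemma tendsto_of_abs_le_norm_sub {f : ℕ × Param d → ℝ} {K : ℝ}
    (h : ∀ᶠ q : ℕ × Param d in atTop ×ˢ 𝓝 θ₀, |f q| ≤ K * ‖q.2 - θ₀‖) :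
    Tendsto f (atTop ×ˢ 𝓝 θ₀) (𝓝 0) := by
  refine squeeze_zero_norm' h ?_
  have h1 : Tendsto (fun θ : Param d => K * ‖θ - θ₀‖) (𝓝 θ₀) (𝓝 (K * ‖θ₀ - θ₀‖)) :=
    (continuous_const.mul (continuous_id.sub continuous_const).norm).tendsto θ₀
  simp only [sub_self, norm_zero, mul_zero] at h1
  exact h1.comp tendsto_snd

lemma Setting.crossCov_bound (h : Setting Θ s θ₀ θhat) : ∃ K : ℝ, 0 ≤ K ∧
    (∀ᶠ q : ℕ × Param d in atTop ×ˢ 𝓝 θ₀, ∀ j, |crossCov s q.1 q.2 j / (q.1 : ℝ)| ≤ K) ∧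
    (∀ n : ℕ, 1 ≤ n → ∀ j, |crossCov s n θ₀ j / (n : ℝ)| ≤ K) := by
  obtain ⟨r, hr, K, hK, -, hloc⟩ := h.exists_local
  have key : ∀ θ ∈ Metric.ball θ₀ r, ∀ n : ℕ, 1 ≤ n → ∀ j, |crossCov s n θ j / (n : ℝ)| ≤ K := by
    intro θ hθ n hn j
    have hn0 : (0 : ℝ) < n := by exact_mod_cast hn
    rw [abs_div, abs_of_pos hn0, div_le_iff₀ hn0]
    exact ((hloc θ hθ).2 n).1 j
  refine ⟨K, hK, ?_, fun n hn j => key θ₀ (Metric.mem_ball_self hr) n hn j⟩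
  filter_upwards [eventually_fst_atTop (eventually_ge_atTop 1),
    eventually_snd_nhds (Metric.ball_mem_nhds θ₀ hr)] with q h1 h2 j using key q.2 h2 q.1 h1 j

lemma Setting.tendsto_crossCov_sub (h : Setting Θ s θ₀ θhat) (j : Fin d) :
    Tendsto (fun q : ℕ × Param d => crossCov s q.1 q.2 j / (q.1 : ℝ)
      - crossCov s q.1 θ₀ j / (q.1 : ℝ)) (atTop ×ˢ 𝓝 θ₀) (𝓝 0) := by
  obtain ⟨r, hr, K, hK, -, hloc⟩ := h.exists_local
  refine tendsto_of_abs_le_norm_sub (K := K) ?_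
  filter_upwards [eventually_fst_atTop (eventually_ge_atTop 1),
    eventually_snd_nhds (Metric.ball_mem_nhds θ₀ hr)] with q h1 h2
  have hn0 : (0 : ℝ) < q.1 := by exact_mod_cast h1
  rw [← sub_div, abs_div, abs_of_pos hn0, div_le_iff₀ hn0]
  exact (((hloc q.2 h2).2 q.1).2.1 j).trans_eq (by ring)

lemma Setting.tendsto_infoBar (h : Setting Θ s θ₀ θhat) {I : Matrix (Fin d) (Fin d) ℝ}
    (hI : ∀ j k : Fin d, Tendsto (fun n : ℕ => info s n θ₀ j k / (n : ℝ)) atTop (𝓝 (I j k)))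
    (j k : Fin d) :
    Tendsto (fun q : ℕ × Param d => infoBar s q.1 q.2 j k) (atTop ×ˢ 𝓝 θ₀) (𝓝 (I j k)) := by
  obtain ⟨r, hr, K, hK, -, hloc⟩ := h.exists_local
  have h1 : Tendsto (fun q : ℕ × Param d => infoBar s q.1 q.2 j k - infoBar s q.1 θ₀ j k)
      (atTop ×ˢ 𝓝 θ₀) (𝓝 0) := by
    refine tendsto_of_abs_le_norm_sub (K := K) ?_
    filter_upwards [eventually_fst_atTop (eventually_ge_atTop 1),
      eventually_snd_nhds (Metric.ball_mem_nhds θ₀ hr)] with q h1 h2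
    have hn0 : (0 : ℝ) < q.1 := by exact_mod_cast h1
    simp only [infoBar, Matrix.of_apply]
    rw [← sub_div, abs_div, abs_of_pos hn0, div_le_iff₀ hn0]
    exact (((hloc q.2 h2).2 q.1).2.2.1 j k).trans_eq (by ring)
  have h2 : Tendsto (fun q : ℕ × Param d => infoBar s q.1 θ₀ j k) (atTop ×ˢ 𝓝 θ₀)
      (𝓝 (I j k)) := (hI j k).comp tendsto_fst
  simpa using h1.add h2

lemma tendsto_diag (θ₀ : Param d) {φ : ℕ → ℕ} (hφ : Tendsto φ atTop atTop) :
    Tendsto (fun k => (φ k, θ₀)) atTop (atTop ×ˢ 𝓝 θ₀) :=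
  hφ.prodMk tendsto_const_nhds

/-- `Q(θ) / n` depends continuously on `θ` at the true parameter, uniformly in `n`. -/
lemma Setting.tendsto_quadQ_sub (h : Setting Θ s θ₀ θhat) :
    Tendsto (fun q : ℕ × Param d => quadQ s q.1 q.2 / (q.1 : ℝ) - quadQ s q.1 θ₀ / (q.1 : ℝ))
      (atTop ×ˢ 𝓝 θ₀) (𝓝 0) := by
  obtain ⟨I, hI, hpd, -⟩ := h.b1
  obtain ⟨K, hK, hb, hb₀⟩ := h.crossCov_bound
  have hinv := tendsto_matrix_inv hpd.det_pos.ne' (fun j k => h.tendsto_infoBar hI j k)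
  have hinv₀ : ∀ j k, Tendsto (fun q : ℕ × Param d => (infoBar s q.1 θ₀)⁻¹ j k)
      (atTop ×ˢ 𝓝 θ₀) (𝓝 (I⁻¹ j k)) := fun j k =>
    (tendsto_matrix_inv hpd.det_pos.ne' (A := fun n => infoBar s n θ₀) hI j k).comp tendsto_fst
  have hb₀' : ∀ᶠ q : ℕ × Param d in atTop ×ˢ 𝓝 θ₀, ∀ j, |crossCov s q.1 θ₀ j / (q.1 : ℝ)| ≤ K :=
    eventually_fst_atTop ((eventually_ge_atTop 1).mono hb₀)
  have hterm : ∀ j k, Tendsto (fun q : ℕ × Param d =>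
      crossCov s q.1 q.2 j / q.1 * (crossCov s q.1 q.2 k / q.1) * (infoBar s q.1 q.2)⁻¹ j k
      - crossCov s q.1 θ₀ j / q.1 * (crossCov s q.1 θ₀ k / q.1) * (infoBar s q.1 θ₀)⁻¹ j k)
      (atTop ×ˢ 𝓝 θ₀) (𝓝 0) := fun j k => by
    refine tendsto_mul_sub_mul (K := K * K) (K' := |I⁻¹ j k| + 1)
      (tendsto_mul_sub_mul (h.tendsto_crossCov_sub j) (h.tendsto_crossCov_sub k)
        (hb₀'.mono fun q hq => hq j) (hb.mono fun q hq => hq k)) ?_ ?_ ?_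
    · simpa using (hinv j k).sub (hinv₀ j k)
    · filter_upwards [hb₀'] with q hq
      rw [abs_mul]
      exact mul_le_mul (hq j) (hq k) (abs_nonneg _) hK
    · exact ((hinv j k).abs.eventually (gt_mem_nhds (lt_add_one _))).mono fun q hq => hq.le
  have hsum := tendsto_finsetSum Finset.univ fun j _ =>
    tendsto_finsetSum Finset.univ fun k (_ : k ∈ Finset.univ) => hterm j k
  simp only [Finset.sum_const_zero] at hsum
  refine hsum.congr' ?_
  filter_upwards [eventually_fst_atTop (eventually_ge_atTop 1)] with q hq
  have hq' : q.1 ≠ 0 := by omega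
  rw [quadQ_div_eq hq', quadQ_div_eq hq', ← Finset.sum_sub_distrib]
  exact Finset.sum_congr rfl fun j _ => Finset.sum_sub_distrib _ _

/-- The limit is the variance of the linear form with coefficients u under N(0, I⁻¹), see
`integral_linear_sq`; this identifies lim Q/n with the limiting variance of the linear part of W. -/
lemma tendsto_quadQ_subseq {I : Matrix (Fin d) (Fin d) ℝ} (hpd : I.PosDef)
    (hI : ∀ j k : Fin d, Tendsto (fun n : ℕ => info s n θ₀ j k / (n : ℝ)) atTop (𝓝 (I j k)))
    {φ : ℕ → ℕ} (hφ : Tendsto φ atTop atTop) {u : Fin d → ℝ}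
    (hu : ∀ j, Tendsto (fun k => crossCov s (φ k) θ₀ j / (φ k : ℝ)) atTop (𝓝 (u j))) :
    Tendsto (fun k => quadQ s (φ k) θ₀ / (φ k : ℝ)) atTop (𝓝 (u ⬝ᵥ (I⁻¹ *ᵥ u))) := by
  have hinv := tendsto_matrix_inv hpd.det_pos.ne' (A := fun n => infoBar s n θ₀) hI
  have hsum := tendsto_finsetSum Finset.univ fun j (_ : j ∈ Finset.univ) =>
    tendsto_finsetSum Finset.univ fun k (_ : k ∈ Finset.univ) =>
      ((hu j).mul (hu k)).mul ((hinv j k).comp hφ)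
  have e : ∑ j, ∑ k, u j * u k * I⁻¹ j k = u ⬝ᵥ (I⁻¹ *ᵥ u) := by
    simp only [dotProduct, Matrix.mulVec, Finset.mul_sum]
    exact Finset.sum_congr rfl fun j _ => Finset.sum_congr rfl fun k _ => by ring
  rw [e] at hsum
  refine hsum.congr' ?_
  filter_upwards [hφ.eventually (eventually_ge_atTop 1)] with k hk
  rw [quadQ_div_eq (by omega)]
  rfl

end quadLimits

/-! ### Calculus of O_p and o_p -/

section inProb

variable {d : ℕ} {s : ℕ → Param d → ℝ} {θ₀ : Param d} {φ : ℕ → ℕ}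
  {X Y : (n : ℕ) → (Fin n → ℕ) → ℝ}

/-- The events `A n` have probability tending to one under the true parameter. -/
def HighProb (s : ℕ → Param d → ℝ) (θ₀ : Param d) (A : (n : ℕ) → (Fin n → ℕ) → Prop) : Prop :=
  Tendsto (fun n => (law s n θ₀).real {x | ¬ A n x}) atTop (𝓝 0)

lemma prob_le_add {n : ℕ} {P Q R : (Fin n → ℕ) → Prop} (h : ∀ x, P x → Q x ∨ R x) :
    (law s n θ₀).real {x | P x} ≤ (law s n θ₀).real {x | Q x} + (law s n θ₀).real {x | R x} :=
  (measureReal_mono (fun x hx => h x hx)).trans (measureReal_union_le {x | Q x} {x | R x})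

lemma VanishesInProb.comp (h : VanishesInProb s θ₀ φ X) {ψ : ℕ → ℕ} (hψ : Tendsto ψ atTop atTop) :
    VanishesInProb s θ₀ (φ ∘ ψ) X := fun δ hδ => (h δ hδ).comp hψ

lemma VanishesInProb.of_id (h : VanishesInProb s θ₀ id X) (hφ : Tendsto φ atTop atTop) :
    VanishesInProb s θ₀ φ X := fun δ hδ => (h δ hδ).comp hφ

/-- Domination on events of high probability. -/
lemma VanishesInProb.of_abs_le (hX : VanishesInProb s θ₀ φ X) (hφ : Tendsto φ atTop atTop)
    {A : (n : ℕ) → (Fin n → ℕ) → Prop} (hA : HighProb s θ₀ A) {C : ℝ}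
    (h : ∀ᶠ n in atTop, ∀ x, A n x → |Y n x| ≤ C * |X n x|) : VanishesInProb s θ₀ φ Y := by
  intro δ hδ
  have hC : 0 < |C| + 1 := by positivity
  have h1 := (hX (δ / (|C| + 1)) (by positivity)).add (hA.comp hφ)
  rw [add_zero] at h1
  refine squeeze_zero' (Eventually.of_forall fun k => measureReal_nonneg) ?_ h1
  filter_upwards [hφ.eventually h] with k hk
  refine prob_le_add fun x hx => ?_
  by_cases hAx : A (φ k) x
  · left
    rw [div_le_iff₀ hC]
    have h2 : C * |X (φ k) x| ≤ (|C| + 1) * |X (φ k) x| := by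
      gcongr; linarith [le_abs_self C]
    linarith [hk x hAx, mul_comm |X (φ k) x| (|C| + 1)]
  · exact Or.inr hAx

lemma highProb_true : HighProb s θ₀ (fun _ _ => True) := by
  simp [HighProb]

lemma VanishesInProb.add (hX : VanishesInProb s θ₀ φ X) (hY : VanishesInProb s θ₀ φ Y) :
    VanishesInProb s θ₀ φ (fun n x => X n x + Y n x) := by
  intro δ hδ
  have h1 := (hX (δ / 2) (by positivity)).add (hY (δ / 2) (by positivity))
  rw [add_zero] at h1
  refine squeeze_zero (fun k => measureReal_nonneg) (fun k => prob_le_add fun x hx => ?_) h1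
  by_contra! hc
  linarith [abs_add_le (X (φ k) x) (Y (φ k) x), hc.1, hc.2]

lemma VanishesInProb.neg (hX : VanishesInProb s θ₀ φ X) :
    VanishesInProb s θ₀ φ (fun n x => - X n x) := by
  intro δ hδ
  simpa using hX δ hδ

lemma VanishesInProb.sub (hX : VanishesInProb s θ₀ φ X) (hY : VanishesInProb s θ₀ φ Y) :
    VanishesInProb s θ₀ φ (fun n x => X n x - Y n x) := by
  simpa [sub_eq_add_neg] using hX.add hY.neg

lemma VanishesInProb.congr (hX : VanishesInProb s θ₀ φ X) (hφ : Tendsto φ atTop atTop)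
    (h : ∀ᶠ n in atTop, ∀ x, X n x = Y n x) : VanishesInProb s θ₀ φ Y :=
  hX.of_abs_le hφ highProb_true (C := 1) (h.mono fun n hn x _ => by rw [hn x, one_mul])

lemma BoundedInProb.mul_vanishes (hX : BoundedInProb s θ₀ X) (hφ : Tendsto φ atTop atTop)
    (hY : VanishesInProb s θ₀ φ Y) : VanishesInProb s θ₀ φ (fun n x => X n x * Y n x) := by
  intro δ hδ
  rw [Metric.tendsto_nhds]
  intro η hη
  obtain ⟨K, hK⟩ := hX (η / 2) (by positivity)
  have hK1 : 0 < |K| + 1 := by positivity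
  filter_upwards [hφ.eventually hK,
    (hY (δ / (|K| + 1)) (by positivity)).eventually (gt_mem_nhds (half_pos hη))] with k h1 h2
  rw [Real.dist_eq, sub_zero, abs_of_nonneg measureReal_nonneg]
  refine (prob_le_add (Q := fun x => K < |X (φ k) x|)
    (R := fun x => δ / (|K| + 1) ≤ |Y (φ k) x|) fun x hx => ?_).trans_lt (by linarith)
  by_contra! hc
  obtain ⟨h3, h4⟩ := hc
  rw [lt_div_iff₀ hK1] at h4
  rw [abs_mul] at hx
  have h5 : |X (φ k) x| * |Y (φ k) x| ≤ (|K| + 1) * |Y (φ k) x| := by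
    gcongr; linarith [le_abs_self K]
  linarith [mul_comm (|K| + 1) |Y (φ k) x|]

lemma VanishesInProb.bounded (hX : VanishesInProb s θ₀ id X) : BoundedInProb s θ₀ X := by
  intro δ hδ
  refine ⟨1, ?_⟩
  filter_upwards [(hX 1 one_pos).eventually (gt_mem_nhds hδ)] with n hn
  refine (measureReal_mono fun x hx => ?_).trans hn.le
  have hx' : 1 < |X n x| := hx
  exact hx'.le

lemma BoundedInProb.add (hX : BoundedInProb s θ₀ X) (hY : BoundedInProb s θ₀ Y) :
    BoundedInProb s θ₀ (fun n x => X n x + Y n x) := by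
  intro δ hδ
  obtain ⟨K, hK⟩ := hX (δ / 2) (by positivity)
  obtain ⟨K', hK'⟩ := hY (δ / 2) (by positivity)
  refine ⟨K + K', ?_⟩
  filter_upwards [hK, hK'] with n h1 h2
  refine (prob_le_add (Q := fun x => K < |X n x|) (R := fun x => K' < |Y n x|)
    fun x hx => ?_).trans (by linarith)
  by_contra! hc
  linarith [abs_add_le (X n x) (Y n x), hc.1, hc.2]

lemma BoundedInProb.neg (hX : BoundedInProb s θ₀ X) : BoundedInProb s θ₀ (fun n x => -X n x) := by
  intro δ hδ
  simpa using hX δ hδ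

lemma BoundedInProb.of_abs_le (hX : BoundedInProb s θ₀ X)
    {A : (n : ℕ) → (Fin n → ℕ) → Prop} (hA : HighProb s θ₀ A) {C : ℝ}
    (h : ∀ᶠ n in atTop, ∀ x, A n x → |Y n x| ≤ C * |X n x|) : BoundedInProb s θ₀ Y := by
  intro δ hδ
  obtain ⟨K, hK⟩ := hX (δ / 2) (by positivity)
  refine ⟨|C| * |K|, ?_⟩
  filter_upwards [hK, hA.eventually (gt_mem_nhds (half_pos hδ)), h] with n h1 h2 h3
  refine (prob_le_add (Q := fun x => K < |X n x|) (R := fun x => ¬ A n x)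
    fun x hx => ?_).trans (by linarith)
  by_contra! hc
  obtain ⟨h4, h5⟩ := hc
  have h6 : C * |X n x| ≤ |C| * |K| :=
    mul_le_mul (le_abs_self C) (h4.trans (le_abs_self K)) (abs_nonneg _) (abs_nonneg _)
  linarith [h3 x h5]

lemma boundedInProb_const (c : ℝ) : BoundedInProb s θ₀ (fun _ _ => c) := by
  intro δ hδ
  refine ⟨|c|, Eventually.of_forall fun n => ?_⟩
  simp [hδ.le]

/-- The Chebyshev inequality. -/
lemma prob_le_integral_sq {n : ℕ} {Z : (Fin n → ℕ) → ℝ} (hZ : DataGrowth Z) {t : ℝ} (ht : 0 < t) :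
    (law s n θ₀).real {x | t ≤ |Z x|} ≤ (∫ x, Z x ^ 2 ∂(law s n θ₀)) / t ^ 2 := by
  have h := mul_meas_ge_le_integral_of_nonneg (μ := law s n θ₀) (f := fun x => Z x ^ 2)
    (Eventually.of_forall fun x => sq_nonneg _) ((hZ.pow 2).integrable s θ₀) (t ^ 2)
  rw [le_div_iff₀ (by positivity), mul_comm]
  refine le_trans ?_ h
  have hsub : {x | t ≤ |Z x|} ⊆ {x | t ^ 2 ≤ Z x ^ 2} := fun x (hx : t ≤ |Z x|) => by
    change t ^ 2 ≤ Z x ^ 2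
    rw [← sq_abs (Z x)]; gcongr
  exact mul_le_mul_of_nonneg_left (measureReal_mono hsub) (by positivity)

end inProb

/-! ### Consequences of asymptotic normality for truncated second moments -/

section weak

variable {d : ℕ} {Θ : Set (Param d)} {s : ℕ → Param d → ℝ} {θ₀ : Param d}
  {θhat : (n : ℕ) → (Fin n → ℕ) → Param d}

/-- The rescaled estimation error. -/
noncomputable def scaledError (θ₀ : Param d) (θhat : (n : ℕ) → (Fin n → ℕ) → Param d) (n : ℕ)
    (x : Fin n → ℕ) : Param d := Real.sqrt (n : ℝ) • (θhat n x - θ₀)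

open scoped BoundedContinuousFunction in
lemma tendsto_integral_of_b1 {I : Matrix (Fin d) (Fin d) ℝ}
    (h : TendstoInDistribution
      (fun (n : ℕ) (x : Fin n → ℕ) => Real.sqrt (n : ℝ) • (θhat n x - θ₀)) atTop
      (fun y : Param d => y) (fun n => law s n θ₀) (multivariateGaussian 0 I⁻¹))
    {f : Param d → ℝ} (hf : Continuous f) {C : ℝ} (hC : ∀ y, |f y| ≤ C) :
    Tendsto (fun n => ∫ x, f (scaledError θ₀ θhat n x) ∂(law s n θ₀)) atTop
      (𝓝 (∫ y, f y ∂(multivariateGaussian 0 I⁻¹))) := by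
  have h1 := ProbabilityMeasure.tendsto_iff_forall_integral_tendsto.1 h.tendsto
  have h2 := h1 (BoundedContinuousFunction.ofNormedAddCommGroup f hf C hC)
  simp only [ProbabilityMeasure.coe_mk, BoundedContinuousFunction.coe_ofNormedAddCommGroup] at h2
  have e : ∀ n, ∫ y, f y ∂((law s n θ₀).map fun x => Real.sqrt (n : ℝ) • (θhat n x - θ₀))
      = ∫ x, f (scaledError θ₀ θhat n x) ∂(law s n θ₀) := fun n => by
    rw [integral_map (h.forall_aemeasurable n) hf.aestronglyMeasurable]
    rfl
  simp only [e] at h2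
  rwa [integral_map aemeasurable_id' hf.aestronglyMeasurable] at h2

/-- The bounded continuous function min(‖y‖/K, 1) dominates the indicator of ‖y‖ > K, and its
Gaussian mean is at most E‖y‖/K < δ. -/
lemma scaledError_tight {I : Matrix (Fin d) (Fin d) ℝ}
    (h : TendstoInDistribution
      (fun (n : ℕ) (x : Fin n → ℕ) => Real.sqrt (n : ℝ) • (θhat n x - θ₀)) atTop
      (fun y : Param d => y) (fun n => law s n θ₀) (multivariateGaussian 0 I⁻¹)) :
    BoundedInProb s θ₀ (fun n x => ‖scaledError θ₀ θhat n x‖) := by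
  intro δ hδ
  set γ := multivariateGaussian (0 : Param d) I⁻¹
  set E := ∫ y, ‖y‖ ∂γ with hE
  have hE0 : 0 ≤ E := integral_nonneg fun y => norm_nonneg _
  have hint : Integrable (fun y : Param d => ‖y‖) γ := IsGaussian.integrable_id.norm
  set K := 2 * (E + 1) / δ with hK
  have hK0 : 0 < K := by positivity
  have hf : Continuous fun y : Param d => min (‖y‖ / K) 1 := by fun_prop
  have h0 : ∀ y : Param d, 0 ≤ min (‖y‖ / K) 1 := fun y => by positivity
  have hb : ∀ y : Param d, |min (‖y‖ / K) 1| ≤ 1 := fun y => by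
    rw [abs_of_nonneg (h0 y)]; exact min_le_right _ _
  have hlim := tendsto_integral_of_b1 h hf hb
  have hle : ∫ y, min (‖y‖ / K) 1 ∂γ < δ := by
    calc ∫ y, min (‖y‖ / K) 1 ∂γ ≤ ∫ y, ‖y‖ / K ∂γ :=
          integral_mono_of_nonneg (Eventually.of_forall h0) (hint.div_const K)
            (Eventually.of_forall fun y => min_le_left _ _)
      _ = E / K := integral_div _ _
      _ < δ := by
          rw [div_lt_iff₀ hK0, hK]
          field_simp
          linarith
  refine ⟨K, ?_⟩
  filter_upwards [hlim.eventually (gt_mem_nhds hle)] with n hn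
  have hi : Integrable (fun x => min (‖scaledError θ₀ θhat n x‖ / K) 1) (law s n θ₀) :=
    Integrable.of_bound Measurable.of_discrete.aestronglyMeasurable 1
      (Eventually.of_forall fun x => hb _)
  have hm := mul_meas_ge_le_integral_of_nonneg (μ := law s n θ₀)
    (f := fun x => min (‖scaledError θ₀ θhat n x‖ / K) 1)
    (Eventually.of_forall fun x => h0 _) hi 1
  rw [one_mul] at hm
  refine le_trans ?_ (hm.trans hn.le)
  refine measureReal_mono fun x hx => ?_
  have hx' : K < |‖scaledError θ₀ θhat n x‖| := hx
  rw [abs_norm] at hx'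
  have h1 : 1 ≤ min (‖scaledError θ₀ θhat n x‖ / K) 1 := le_min ((one_le_div hK0).2 hx'.le) le_rfl
  exact h1

/-- The truncated square is the square of min(|x|, √M), and squaring is 2√M-Lipschitz on [0, √M]. -/
lemma abs_min_sq_sub_le {M x y : ℝ} (hM : 0 ≤ M) :
    |min (x ^ 2) M - min (y ^ 2) M| ≤ 2 * Real.sqrt M * |x - y| := by
  wlog hxy : |y| ≤ |x| generalizing x y
  · rw [abs_sub_comm, abs_sub_comm x]
    exact this (le_of_not_ge hxy)
  have hsq : y ^ 2 ≤ x ^ 2 := sq_le_sq.2 hxy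
  rw [abs_of_nonneg (sub_nonneg.2 (min_le_min_right M hsq))]
  have hr := Real.sqrt_nonneg M
  have hrM := Real.sq_sqrt hM
  set r := Real.sqrt M
  have htri : |x| - |y| ≤ |x - y| := abs_sub_abs_le_abs_sub x y
  have hy0 := abs_nonneg y
  rw [← sq_abs x, ← sq_abs y, ← hrM]
  rcases le_or_gt |x| r with h1 | h1
  · rw [min_eq_left (by gcongr), min_eq_left (by gcongr; exact hxy.trans h1)]
    nlinarith
  · rw [min_eq_right (by gcongr)]
    rcases le_or_gt |y| r with h2 | h2
    · rw [min_eq_left (by gcongr)]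
      nlinarith
    · rw [min_eq_right (by gcongr), sub_self]; positivity

/-- The second moment of a linear form under the limit law. -/
lemma integral_linear_sq {I : Matrix (Fin d) (Fin d) ℝ} (hI : I.PosDef) (u : Fin d → ℝ) :
    Integrable (fun y : Param d => (∑ j, u j * y j) ^ 2) (multivariateGaussian 0 I⁻¹) ∧
    ∫ y : Param d, (∑ j, u j * y j) ^ 2 ∂(multivariateGaussian 0 I⁻¹) = u ⬝ᵥ (I⁻¹ *ᵥ u) := by
  set γ := multivariateGaussian (0 : Param d) I⁻¹ with hγ
  have hS : (I⁻¹).PosSemidef := hI.inv.posSemidef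
  have hL2 : ∀ j : Fin d, MemLp (fun y : Param d => y j) 2 γ := fun j => by
    have := (IsGaussian.memLp_two_id (μ := γ)).norm
    refine this.mono (by fun_prop) (Eventually.of_forall fun y => ?_)
    simpa using PiLp.norm_apply_le y j
  have hmean : ∀ j : Fin d, ∫ y : Param d, y j ∂γ = 0 := fun j => by
    have h1 := (EuclideanSpace.proj j : Param d →L[ℝ] ℝ).integral_comp_comm
      (IsGaussian.integrable_id (μ := γ))
    simp only [id] at h1
    rw [integral_id_multivariateGaussian] at h1
    simpa using h1
  have hprod : ∀ j k : Fin d, Integrable (fun y : Param d => y j * y k) γ := fun j k =>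
    (hL2 j).integrable_mul (hL2 k)
  have hcov : ∀ j k : Fin d, ∫ y : Param d, y j * y k ∂γ = I⁻¹ j k := fun j k => by
    have h1 := covariance_eval_multivariateGaussian (μ := (0 : Param d)) hS j k
    rw [covariance_eq_sub (hL2 j) (hL2 k), hmean j, zero_mul, sub_zero] at h1
    exact h1
  have e : ∀ y : Param d, (∑ j, u j * y j) ^ 2 = ∑ j, ∑ k, u j * u k * (y j * y k) := fun y => by
    rw [pow_two, Finset.sum_mul_sum]
    exact Finset.sum_congr rfl fun j _ => Finset.sum_congr rfl fun k _ => by ring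
  simp only [e]
  constructor
  · exact integrable_finsetSum _ fun j _ => integrable_finsetSum _ fun k _ =>
      (hprod j k).const_mul _
  · rw [integral_finsetSum _ fun j _ => integrable_finsetSum _ fun k _ =>
      (hprod j k).const_mul _]
    simp only [dotProduct, Matrix.mulVec, Finset.mul_sum]
    refine Finset.sum_congr rfl fun j _ => ?_
    rw [integral_finsetSum _ fun k _ => (hprod j k).const_mul _]
    refine Finset.sum_congr rfl fun k _ => ?_
    rw [integral_const_mul, hcov]; ring

/-- If `X` is asymptotically a fixed linear form of the rescaled error, then its truncated second
moments converge to those of the limit law. -/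
lemma tendsto_integral_min_sq {I : Matrix (Fin d) (Fin d) ℝ}
    (h : TendstoInDistribution
      (fun (n : ℕ) (x : Fin n → ℕ) => Real.sqrt (n : ℝ) • (θhat n x - θ₀)) atTop
      (fun y : Param d => y) (fun n => law s n θ₀) (multivariateGaussian 0 I⁻¹))
    {φ : ℕ → ℕ} (hφ : Tendsto φ atTop atTop) {u : Fin d → ℝ} {X : (n : ℕ) → (Fin n → ℕ) → ℝ}
    (hX : VanishesInProb s θ₀ φ (fun n x => X n x - ∑ j, u j * scaledError θ₀ θhat n x j))
    {M : ℝ} (hM : 0 < M) :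
    Tendsto (fun k => ∫ x, min (X (φ k) x ^ 2) M ∂(law s (φ k) θ₀)) atTop
      (𝓝 (∫ y : Param d, min ((∑ j, u j * y j) ^ 2) M ∂(multivariateGaussian 0 I⁻¹))) := by
  have hf : Continuous fun y : Param d => min ((∑ j, u j * y j) ^ 2) M := by fun_prop
  have h0 : ∀ r : ℝ, 0 ≤ min (r ^ 2) M := fun r => by positivity
  have hb : ∀ r : ℝ, |min (r ^ 2) M| ≤ M := fun r => by
    rw [abs_of_nonneg (h0 r)]; exact min_le_right _ _
  have hlim := (tendsto_integral_of_b1 h hf fun y => hb _).comp hφ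
  refine hlim.congr_dist ?_
  rw [Metric.tendsto_nhds]
  intro η hη
  set r := Real.sqrt M with hr
  have hr0 : 0 < r := Real.sqrt_pos.2 hM
  -- Off the exceptional event the integrands differ by at most 2rδ = η/4. On it they differ by at
  -- most 2M, with probability below η/(4M).
  set δ := η / (8 * r) with hδ
  have hδ0 : 0 < δ := by positivity
  filter_upwards [(hX δ hδ0).eventually (gt_mem_nhds (show 0 < η / (4 * M) by positivity))] with k hk
  set A : (Fin (φ k) → ℕ) → ℝ := fun x => X (φ k) x
  set B : (Fin (φ k) → ℕ) → ℝ := fun x => ∑ j, u j * scaledError θ₀ θhat (φ k) x j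
  set F : Set (Fin (φ k) → ℕ) := {x | δ ≤ |A x - B x|} with hF
  have hFm : MeasurableSet F := MeasurableSet.of_discrete
  have hiA : Integrable (fun x => min (A x ^ 2) M) (law s (φ k) θ₀) :=
    Integrable.of_bound Measurable.of_discrete.aestronglyMeasurable M
      (Eventually.of_forall fun x => hb _)
  have hiB : Integrable (fun x => min (B x ^ 2) M) (law s (φ k) θ₀) :=
    Integrable.of_bound Measurable.of_discrete.aestronglyMeasurable M
      (Eventually.of_forall fun x => hb _)
  have hptw : ∀ x, |min (B x ^ 2) M - min (A x ^ 2) M|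
      ≤ 2 * r * δ + F.indicator (fun _ => 2 * M) x := by
    intro x
    by_cases hx : x ∈ F
    · rw [Set.indicator_of_mem hx]
      have h1 := abs_sub (min (B x ^ 2) M) (min (A x ^ 2) M)
      have h2 := hb (A x)
      have h3 := hb (B x)
      have : 0 ≤ 2 * r * δ := by positivity
      linarith
    · rw [Set.indicator_of_notMem hx, add_zero]
      refine (abs_min_sq_sub_le hM.le).trans ?_
      rw [← hr, abs_sub_comm]
      gcongr
      exact (not_le.1 hx).le
  have hiF : Integrable (F.indicator fun _ => 2 * M) (law s (φ k) θ₀) :=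
    (integrable_const _).indicator hFm
  rw [Real.dist_eq, sub_zero, abs_of_nonneg dist_nonneg, Real.dist_eq]
  change |(∫ x, min (B x ^ 2) M ∂(law s (φ k) θ₀)) - ∫ x, min (A x ^ 2) M ∂(law s (φ k) θ₀)| < η
  rw [← integral_sub hiB hiA]
  calc _ ≤ ∫ x, |min (B x ^ 2) M - min (A x ^ 2) M| ∂(law s (φ k) θ₀) :=
        abs_integral_le_integral_abs
    _ ≤ ∫ x, (2 * r * δ + F.indicator (fun _ => 2 * M) x) ∂(law s (φ k) θ₀) :=
        integral_mono (hiB.sub hiA).abs ((integrable_const _).add hiF) hptw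
    _ = 2 * r * δ + (law s (φ k) θ₀).real F * (2 * M) := by
        rw [integral_add (integrable_const _) hiF, integral_const, integral_indicator_const _ hFm]
        simp
    _ < η := by
        have h1 : 2 * r * δ = η / 4 := by rw [hδ]; field_simp; norm_num
        have h2 : (law s (φ k) θ₀).real F * (2 * M) ≤ η / (4 * M) * (2 * M) := by
          gcongr
        have h3 : η / (4 * M) * (2 * M) = η / 2 := by field_simp; norm_num
        linarith

lemma integral_min_sq_le {I : Matrix (Fin d) (Fin d) ℝ} (hI : I.PosDef) (u : Fin d → ℝ) {M : ℝ}
    (hM : 0 < M) : ∫ y : Param d, min ((∑ j, u j * y j) ^ 2) M ∂(multivariateGaussian 0 I⁻¹)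
      ≤ u ⬝ᵥ (I⁻¹ *ᵥ u) := by
  obtain ⟨h1, h2⟩ := integral_linear_sq hI u
  rw [← h2]
  exact integral_mono_of_nonneg (Eventually.of_forall fun y => by positivity) h1
    (Eventually.of_forall fun y => min_le_left _ _)

end weak

/-! ### Inverse square roots -/

section algebra

lemma inv_sqrt_sub_inv_sqrt {a b : ℝ} (ha : 0 < a) (hb : 0 < b) :
    (Real.sqrt a)⁻¹ - (Real.sqrt b)⁻¹
      = (b - a) / (Real.sqrt a * Real.sqrt b * (Real.sqrt a + Real.sqrt b)) := by
  have h1 := Real.sqrt_pos.2 ha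
  have h2 := Real.sqrt_pos.2 hb
  have e : b - a = Real.sqrt b ^ 2 - Real.sqrt a ^ 2 := by
    rw [Real.sq_sqrt ha.le, Real.sq_sqrt hb.le]
  rw [e]
  field_simp
  ring

/-- The derivative of x^(-1/2) has absolute value x^(-3/2)/2, at most κ^(-3/2)/2 above κ.
`le_inv_sqrt_sub` is the matching lower bound below K. -/
lemma abs_inv_sqrt_sub_le {a b κ : ℝ} (hκ : 0 < κ) (ha : κ ≤ a) (hb : κ ≤ b) :
    |(Real.sqrt a)⁻¹ - (Real.sqrt b)⁻¹| ≤ |a - b| / (2 * Real.sqrt κ ^ 3) := by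
  have h0 := Real.sqrt_pos.2 hκ
  have h1 := Real.sqrt_le_sqrt ha
  have h2 := Real.sqrt_le_sqrt hb
  rw [inv_sqrt_sub_inv_sqrt (hκ.trans_le ha) (hκ.trans_le hb), abs_div, abs_sub_comm b a]
  have h3 := h0.trans_le h1
  have h4 := h0.trans_le h2
  rw [abs_of_pos (a := _ * _) (by positivity)]
  refine div_le_div_of_nonneg_left (abs_nonneg _) (by positivity) ?_
  calc 2 * Real.sqrt κ ^ 3 = Real.sqrt κ * Real.sqrt κ * (Real.sqrt κ + Real.sqrt κ) := by ring
    _ ≤ _ := by gcongr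

lemma le_inv_sqrt_sub {a b K : ℝ} (ha : 0 < a) (hab : a ≤ b) (hb : b ≤ K) :
    (b - a) / (2 * Real.sqrt K ^ 3) ≤ (Real.sqrt a)⁻¹ - (Real.sqrt b)⁻¹ := by
  have h0 := Real.sqrt_pos.2 ha
  have h1 := Real.sqrt_le_sqrt (hab.trans hb)
  have h2 := Real.sqrt_le_sqrt hb
  have h3 := Real.sqrt_le_sqrt hab
  have h4 : 0 < Real.sqrt b := h0.trans_le h3
  have h5 : 0 ≤ b - a := by linarith
  rw [inv_sqrt_sub_inv_sqrt ha (ha.trans_le hab)]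
  refine div_le_div_of_nonneg_left h5 (by positivity) ?_
  calc _ ≤ Real.sqrt K * Real.sqrt K * (Real.sqrt K + Real.sqrt K) := by gcongr
    _ = _ := by ring

lemma div_sqrt_eq_scaled {a b n : ℝ} (hn : 0 < n) :
    a / Real.sqrt b = a / Real.sqrt n * (Real.sqrt (b / n))⁻¹ := by
  have h := Real.sqrt_pos.2 hn
  rw [Real.sqrt_div' _ hn.le, inv_div]
  field_simp

end algebra

/-! ### Consistency, and evaluation of local statements at the estimate -/

section consistency

variable {d : ℕ} {Θ : Set (Param d)} {s : ℕ → Param d → ℝ} {θ₀ : Param d}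
  {θhat : (n : ℕ) → (Fin n → ℕ) → Param d}

lemma Setting.scaledError_bounded (h : Setting Θ s θ₀ θhat) :
    BoundedInProb s θ₀ (fun n x => ‖scaledError θ₀ θhat n x‖) := by
  obtain ⟨I, -, -, hlim⟩ := h.b1
  exact scaledError_tight hlim

/-- The maximum likelihood estimator is consistent. -/
lemma Setting.highProb_nhds (h : Setting Θ s θ₀ θhat) {U : Set (Param d)} (hU : U ∈ 𝓝 θ₀) :
    HighProb s θ₀ (fun n x => θhat n x ∈ U) := by
  obtain ⟨r, hr, hrU⟩ := Metric.mem_nhds_iff.1 hU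
  rw [HighProb, Metric.tendsto_nhds]
  intro δ hδ
  obtain ⟨K, hK⟩ := h.scaledError_bounded (δ / 2) (by positivity)
  have hsq : Tendsto (fun n : ℕ => Real.sqrt (n : ℝ)) atTop atTop :=
    Real.tendsto_sqrt_atTop.comp tendsto_natCast_atTop_atTop
  filter_upwards [hK, hsq.eventually_gt_atTop (K / r)] with n h1 h2
  rw [Real.dist_eq, sub_zero, abs_of_nonneg measureReal_nonneg]
  refine (measureReal_mono fun x hx => ?_).trans_lt (h1.trans_lt (half_lt_self hδ))
  have h3 : r ≤ ‖θhat n x - θ₀‖ := by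
    by_contra! hc
    exact hx (hrU (mem_ball_iff_norm.2 hc))
  change K < |‖scaledError θ₀ θhat n x‖|
  rw [abs_norm, scaledError, norm_smul, Real.norm_of_nonneg (Real.sqrt_nonneg _)]
  rw [div_lt_iff₀ hr] at h2
  exact h2.trans_le (by gcongr)

/-- Consistency transfers what holds for all large n and all θ near θ₀ to θ = θhat with high
probability. -/
lemma Setting.highProb_eventually (h : Setting Θ s θ₀ θhat) {p : ℕ × Param d → Prop}
    (hp : ∀ᶠ q in atTop ×ˢ 𝓝 θ₀, p q) : HighProb s θ₀ (fun n x => p (n, θhat n x)) := by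
  obtain ⟨pa, ha, pb, hb, hab⟩ := eventually_prod_iff.1 hp
  refine squeeze_zero' (Eventually.of_forall fun n => measureReal_nonneg) ?_
    (h.highProb_nhds (U := {θ | pb θ}) hb)
  filter_upwards [ha] with n hn
  refine measureReal_mono fun x hx => ?_
  exact fun hc => hx (hab hn hc)

lemma Setting.vanishes_of_tendsto (h : Setting Θ s θ₀ θhat) {f : ℕ × Param d → ℝ}
    (hf : Tendsto f (atTop ×ˢ 𝓝 θ₀) (𝓝 0)) :
    VanishesInProb s θ₀ id (fun n x => f (n, θhat n x)) := by
  intro δ hδ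
  have h1 : ∀ᶠ q in atTop ×ˢ 𝓝 θ₀, |f q| < δ := by
    have := hf.abs
    rw [abs_zero] at this
    exact this.eventually (gt_mem_nhds hδ)
  refine (h.highProb_eventually h1).congr fun n => ?_
  simp only [not_lt, id]

end consistency

/-! ### The expansion of the numerator W -/

section expansion

variable {d : ℕ} {Θ : Set (Param d)} {s : ℕ → Param d → ℝ} {θ₀ : Param d}
  {θhat : (n : ℕ) → (Fin n → ℕ) → Param d}

/-- The centred and rescaled `C` function at the true parameter. -/
noncomputable def centered (s : ℕ → Param d → ℝ) (θ₀ : Param d) (n : ℕ) (x : Fin n → ℕ) : ℝ :=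
  (cash s n θ₀ x - funMean s n θ₀) / Real.sqrt n

/-- The first-order effect of the estimation error on `μ`. -/
noncomputable def linearPart (s : ℕ → Param d → ℝ) (θ₀ : Param d)
    (θhat : (n : ℕ) → (Fin n → ℕ) → Param d) (n : ℕ) (x : Fin n → ℕ) : ℝ :=
  ∑ j, crossCov s n θ₀ j / n * scaledError θ₀ θhat n x j

/-- The numerator of the correct standardization, rescaled. -/
noncomputable def plugStat (s : ℕ → Param d → ℝ) (θhat : (n : ℕ) → (Fin n → ℕ) → Param d)
    (n : ℕ) (x : Fin n → ℕ) : ℝ :=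
  (cStat s θhat n x - funMean s n (θhat n x)) / Real.sqrt n

lemma growth_centered (s : ℕ → Param d → ℝ) (θ₀ : Param d) (n : ℕ) :
    DataGrowth (centered s θ₀ n) := by
  have h := ((growth_cash (n := n) s θ₀).sub (DataGrowth.const (funMean s n θ₀))).const_mul
    (Real.sqrt n)⁻¹
  have e : centered s θ₀ n
      = fun x => (Real.sqrt n)⁻¹ * (cash s n θ₀ x - funMean s n θ₀) := by
    ext x; rw [centered, div_eq_inv_mul]
  rw [e]; exact h

lemma integral_centered_sq (s : ℕ → Param d → ℝ) (θ₀ : Param d) (n : ℕ) :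
    ∫ x, centered s θ₀ n x ^ 2 ∂(law s n θ₀) = funVar s n θ₀ / n := by
  simp only [centered, div_pow, Real.sq_sqrt (Nat.cast_nonneg n), integral_div]
  rw [funVar, variance_eq_integral Measurable.of_discrete.aemeasurable]
  rfl

lemma integral_centered_pow_four_le {K : ℝ} (hK : 1 ≤ K)
    (hKb : ∀ i : ℕ, Var[dev (s i θ₀); poissonMeasure (s i θ₀).toNNReal] ≤ K ∧
      pmean (s i θ₀) (fun k => (dev (s i θ₀) k - pmean (s i θ₀) (dev (s i θ₀))) ^ 4) ≤ K)
    {n : ℕ} (hn : 1 ≤ n) :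
    ∫ x, centered s θ₀ n x ^ 4 ∂(law s n θ₀) ≤ 3 * K ^ 2 + K := by
  have hn0 : (0 : ℝ) < n := by exact_mod_cast hn
  set f : Fin n → ℕ → ℝ := fun i k => dev (s i θ₀) k - pmean (s i θ₀) (dev (s i θ₀))
  have e : ∀ x, centered s θ₀ n x ^ 4 = (∑ i, f i (x i)) ^ 4 / (n : ℝ) ^ 2 := fun x => by
    have h4 : Real.sqrt (n : ℝ) ^ 4 = (n : ℝ) ^ 2 := by
      calc Real.sqrt (n : ℝ) ^ 4 = (Real.sqrt (n : ℝ) ^ 2) ^ 2 := by ring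
        _ = _ := by rw [Real.sq_sqrt hn0.le]
    rw [centered, div_pow, h4, cash_eq_sum, funMean_eq_sum, ← Finset.sum_sub_distrib]
  simp only [e, integral_div]
  rw [div_le_iff₀ (by positivity)]
  have hg : ∀ i : Fin n, ExpGrowth (dev (s i θ₀)) := fun i => growth_dev _
  refine integral_sum_pow_four_le s θ₀ (fun i => (hg i).sub (ExpGrowth.const _)) (fun i => ?_)
    (by linarith) (fun i => ?_) fun i => (hKb i).2
  · rw [pmean_sub (hg i) (ExpGrowth.const _), pmean_const, sub_self]
  · refine le_trans (le_of_eq ?_) (hKb i).1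
    rw [variance_eq_integral Measurable.of_discrete.aemeasurable]
    rfl

lemma Setting.centered_bounded (h : Setting Θ s θ₀ θhat) :
    BoundedInProb s θ₀ (centered s θ₀) := by
  intro δ hδ
  obtain ⟨K, hK, hV⟩ := h.exists_funVar_le
  have hK0 : 0 < K := by linarith
  set T := Real.sqrt (K / δ)
  have hT : 0 < T := Real.sqrt_pos.2 (by positivity)
  refine ⟨T, ?_⟩
  filter_upwards [eventually_ge_atTop 1] with n hn
  have hn0 : (0 : ℝ) < n := by exact_mod_cast hn
  have h1 := prob_le_integral_sq (s := s) (θ₀ := θ₀) (growth_centered s θ₀ n) hT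
  rw [integral_centered_sq, Real.sq_sqrt (by positivity)] at h1
  have hsub : {x | T < |centered s θ₀ n x|} ⊆ {x | T ≤ |centered s θ₀ n x|} :=
    fun x (hx : T < _) => hx.le
  refine (measureReal_mono hsub).trans (h1.trans ?_)
  have h2 : funVar s n θ₀ / n ≤ K := by
    rw [div_le_iff₀ hn0]; exact hV n θ₀ h.true_mem
  calc _ ≤ K / (K / δ) := by gcongr
    _ = δ := by field_simp

lemma Setting.linearPart_bounded (h : Setting Θ s θ₀ θhat) :
    BoundedInProb s θ₀ (linearPart s θ₀ θhat) := by
  obtain ⟨K, hK, -, hb⟩ := h.crossCov_bound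
  refine h.scaledError_bounded.of_abs_le highProb_true (C := d * K) ?_
  filter_upwards [eventually_ge_atTop 1] with n hn x _
  rw [abs_norm]
  calc |linearPart s θ₀ θhat n x|
      ≤ ∑ j, |crossCov s n θ₀ j / n * scaledError θ₀ θhat n x j| :=
        Finset.abs_sum_le_sum_abs _ _
    _ ≤ ∑ _j : Fin d, K * ‖scaledError θ₀ θhat n x‖ := by
        refine Finset.sum_le_sum fun j _ => ?_
        rw [abs_mul]
        have := PiLp.norm_apply_le (scaledError θ₀ θhat n x) j
        rw [Real.norm_eq_abs] at this
        exact mul_le_mul (hb n hn j) this (abs_nonneg _) hK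
    _ = _ := by simp [mul_assoc]

/-- The asymptotic expansion of the rescaled numerator. -/
lemma Setting.plugStat_expansion (h : Setting Θ s θ₀ θhat) :
    VanishesInProb s θ₀ id
      (fun n x => plugStat s θhat n x - (centered s θ₀ n x - linearPart s θ₀ θhat n x)) := by
  obtain ⟨β, hβ, hb⟩ := h.exists_excess_bound
  obtain ⟨r, hr, K, hK, hΘ, hloc⟩ := h.exists_local
  -- The excess at θ₀ has second moment o(n), so replacing C_n(θhat) by C_n(θ₀) costs o_p(√n).
  have h1 : VanishesInProb s θ₀ id
      (fun n x => (Real.sqrt n)⁻¹ * (cash s n θ₀ x - cStat s θhat n x)) := by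
    intro δ hδ
    have hlim := hβ.div_const (δ ^ 2)
    rw [zero_div] at hlim
    refine squeeze_zero' (Eventually.of_forall fun n => measureReal_nonneg) ?_ hlim
    filter_upwards [eventually_ge_atTop 1] with n hn
    have hD : DataGrowth (fun x => (Real.sqrt n)⁻¹ * (cash s n θ₀ x - cStat s θhat n x)) :=
      ((growth_cash s θ₀).sub (h.growth_cStat n)).const_mul _
    refine (prob_le_integral_sq hD hδ).trans ?_
    simp only [mul_pow, inv_pow, Real.sq_sqrt (Nat.cast_nonneg n), integral_const_mul]
    rw [inv_mul_eq_div]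
    gcongr
    exact hb n hn θ₀ h.true_mem
  have h2 : VanishesInProb s θ₀ id (fun n x => ‖θhat n x - θ₀‖) := by
    refine h.vanishes_of_tendsto (f := fun q => ‖q.2 - θ₀‖)
      (tendsto_of_abs_le_norm_sub (K := 1) (Eventually.of_forall fun q => ?_))
    rw [abs_norm, one_mul]
  -- The Taylor remainder K n‖θhat - θ₀‖²/√n equals K times the rescaled error times ‖θhat - θ₀‖,
  -- that is O_p(1) · o_p(1).
  have h3 : VanishesInProb s θ₀ id (fun n x => (Real.sqrt n)⁻¹ *
      (funMean s n (θhat n x) - funMean s n θ₀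
        - ∑ j, crossCov s n θ₀ j * (θhat n x - θ₀) j)) := by
    refine (h.scaledError_bounded.mul_vanishes tendsto_id h2).of_abs_le tendsto_id
      (h.highProb_nhds (Metric.ball_mem_nhds θ₀ hr)) (C := K) ?_
    filter_upwards [eventually_ge_atTop 1] with n hn x hx
    have hn0 : (0 : ℝ) < n := by exact_mod_cast hn
    have hs := Real.sqrt_pos.2 hn0
    have h4 := ((hloc _ hx).2 n).2.2.2
    rw [abs_mul, abs_of_pos (inv_pos.2 hs), abs_mul, abs_norm, abs_norm, scaledError, norm_smul,
      Real.norm_of_nonneg hs.le, inv_mul_le_iff₀ hs]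
    refine h4.trans (le_of_eq ?_)
    have e := Real.mul_self_sqrt hn0.le
    calc _ = K * (Real.sqrt n * Real.sqrt n) * ‖θhat n x - θ₀‖ ^ 2 := by rw [e]
      _ = _ := by ring
  refine (h1.add h3).neg.congr tendsto_id ?_
  filter_upwards [eventually_ge_atTop 1] with n hn x
  have hn0 : (0 : ℝ) < n := by exact_mod_cast hn
  have hs := Real.sqrt_pos.2 hn0
  have hL : linearPart s θ₀ θhat n x
      = (Real.sqrt n)⁻¹ * ∑ j, crossCov s n θ₀ j * (θhat n x - θ₀) j := by
    rw [linearPart, Finset.mul_sum]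
    refine Finset.sum_congr rfl fun j _ => ?_
    have e := Real.mul_self_sqrt hn0.le
    simp only [scaledError, PiLp.smul_apply, smul_eq_mul]
    nth_rw 1 [← e]
    field_simp
  rw [hL, plugStat, centered]
  ring

lemma Setting.plugStat_bounded (h : Setting Θ s θ₀ θhat) :
    BoundedInProb s θ₀ (plugStat s θhat) := by
  have h1 := h.plugStat_expansion.bounded.add (h.centered_bounded.add h.linearPart_bounded.neg)
  refine h1.of_abs_le highProb_true (C := 1) (Eventually.of_forall fun n x _ => le_of_eq ?_)
  rw [one_mul]
  congr 1
  ring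

end expansion

/-! ### Comparison of the three standardizations -/

section standardized

variable {d : ℕ} {Θ : Set (Param d)} {s : ℕ → Param d → ℝ} {θ₀ : Param d}
  {θhat : (n : ℕ) → (Fin n → ℕ) → Param d}

lemma Setting.eventually_mem (h : Setting Θ s θ₀ θhat) :
    ∀ᶠ q : ℕ × Param d in atTop ×ˢ 𝓝 θ₀, q.2 ∈ Θ :=
  eventually_snd_nhds (mem_interior_iff_mem_nhds.1 h.standing.interior_mem)

/-- If all expected counts are at least `a`, the correct variance per bin is bounded below. -/
lemma le_correct_var {θ : Param d} {n : ℕ} (hn : 1 ≤ n) {a : ℝ} (ha : 0 < a)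
    (hlow : ∀ i, a ≤ s i θ) (hd : ∀ i, DifferentiableAt ℝ (s i) θ) :
    2 / 9 * (a / (a + 1)) ^ 2 ≤ (funVar s n θ - quadQ s n θ) / n := by
  have hn0 : (0 : ℝ) < n := by exact_mod_cast hn
  rw [le_div_iff₀ hn0]
  refine le_trans ?_ (funVar_sub_quadQ_ge (fun i => ha.trans_le (hlow i)) hd)
  calc _ = ∑ _i : Fin n, 2 / 9 * (a / (a + 1)) ^ 2 := by simp [mul_comm]
    _ ≤ _ := by
      refine Finset.sum_le_sum fun i _ => ?_
      have h1 := hlow i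
      have h2 : a / (a + 1) ≤ s i θ / (s i θ + 1) := by
        rw [div_le_div_iff₀ (by linarith) (by linarith)]
        nlinarith
      gcongr

lemma Setting.var_bounds (h : Setting Θ s θ₀ θhat) : ∃ κ : ℝ, 0 < κ ∧ ∃ K : ℝ, 1 ≤ K ∧
    (∀ n : ℕ, 1 ≤ n → κ ≤ (funVar s n θ₀ - quadQ s n θ₀) / n) ∧
    ∀ᶠ q : ℕ × Param d in atTop ×ˢ 𝓝 θ₀, κ ≤ (funVar s q.1 q.2 - quadQ s q.1 q.2) / q.1 ∧
      0 ≤ quadQ s q.1 q.2 / q.1 ∧ funVar s q.1 q.2 / q.1 ≤ K := by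
  obtain ⟨ε, hε, hlow⟩ := h.b2
  obtain ⟨K, hK, hV⟩ := h.exists_funVar_le
  obtain ⟨r, hr, _, -, hΘ, hloc⟩ := h.exists_local
  have h0 := Metric.mem_ball_self (x := θ₀) hr
  refine ⟨2 / 9 * (ε / (ε + 1)) ^ 2, by positivity, K, hK, fun n hn =>
    le_correct_var hn hε (fun i => hlow i θ₀ (hΘ h0)) (hloc θ₀ h0).1, ?_⟩
  filter_upwards [eventually_fst_atTop (eventually_ge_atTop 1),
    eventually_snd_nhds (Metric.ball_mem_nhds θ₀ hr)] with q h1 h2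
  have hn0 : (0 : ℝ) < q.1 := by exact_mod_cast h1
  refine ⟨le_correct_var h1 hε (fun i => hlow i _ (hΘ h2)) (hloc _ h2).1,
    div_nonneg (quadQ_bounds (h.pos _ (hΘ h2)) (hloc _ h2).1).1 hn0.le, ?_⟩
  rw [div_le_iff₀ hn0]
  exact hV _ _ (hΘ h2)

lemma Setting.tendsto_statVar_sub (h : Setting Θ s θ₀ θhat) :
    Tendsto (fun q : ℕ × Param d => (statVar s θhat q.1 q.2 - funVar s q.1 q.2) / q.1)
      (atTop ×ˢ 𝓝 θ₀) (𝓝 0) := by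
  rw [Metric.tendsto_nhds]
  intro δ hδ
  filter_upwards [eventually_fst_atTop (eventually_ge_atTop 1),
    eventually_fst_atTop (h.statVar_sub_funVar (half_pos hδ)), h.eventually_mem] with q h1 h2 h3
  have hn0 : (0 : ℝ) < q.1 := by exact_mod_cast h1
  rw [Real.dist_eq, sub_zero, abs_div, abs_of_pos hn0, div_lt_iff₀ hn0]
  exact (h2 _ h3).trans_lt (by gcongr; linarith)

lemma Setting.tendsto_statMean_sub (h : Setting Θ s θ₀ θhat) :
    Tendsto (fun q : ℕ × Param d => (funMean s q.1 q.2 - statMean s θhat q.1 q.2)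
      / Real.sqrt q.1) (atTop ×ˢ 𝓝 θ₀) (𝓝 0) := by
  rw [Metric.tendsto_nhds]
  intro δ hδ
  filter_upwards [eventually_fst_atTop (eventually_ge_atTop 1),
    eventually_fst_atTop (h.statMean_sub_funMean (half_pos hδ)), h.eventually_mem] with q h1 h2 h3
  have hn0 : (0 : ℝ) < q.1 := by exact_mod_cast h1
  have hs := Real.sqrt_pos.2 hn0
  rw [Real.dist_eq, sub_zero, abs_div, abs_of_pos hs, div_lt_iff₀ hs, abs_sub_comm]
  exact (h2 _ h3).trans_lt (by gcongr; linarith)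

/-- Replacing the bootstrap moments by those of the `C` function at the estimate is harmless. -/
lemma Setting.standardized_sub (h : Setting Θ s θ₀ θhat) {c : ℕ → Param d → ℝ} {κ : ℝ}
    (hκ : 0 < κ)
    (hc : ∀ᶠ q : ℕ × Param d in atTop ×ˢ 𝓝 θ₀, κ ≤ (funVar s q.1 q.2 - c q.1 q.2) / q.1) :
    VanishesInProb s θ₀ id (fun n x =>
      (cStat s θhat n x - statMean s θhat n (θhat n x)) /
        Real.sqrt (statVar s θhat n (θhat n x) - c n (θhat n x)) -
      (cStat s θhat n x - funMean s n (θhat n x)) /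
        Real.sqrt (funVar s n (θhat n x) - c n (θhat n x))) := by
  set v : ℕ × Param d → ℝ := fun q => (statVar s θhat q.1 q.2 - c q.1 q.2) / q.1
  set V : ℕ × Param d → ℝ := fun q => (funVar s q.1 q.2 - c q.1 q.2) / q.1
  set α : ℕ × Param d → ℝ := fun q =>
    (funMean s q.1 q.2 - statMean s θhat q.1 q.2) / Real.sqrt q.1
  have e : ∀ q, v q - V q = (statVar s θhat q.1 q.2 - funVar s q.1 q.2) / q.1 := fun q => by
    simp only [v, V]; ring
  have hvV : Tendsto (fun q => v q - V q) (atTop ×ˢ 𝓝 θ₀) (𝓝 0) := by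
    simp only [e]; exact h.tendsto_statVar_sub
  have habs := hvV.abs
  rw [abs_zero] at habs
  -- The bootstrap variance inherits positivity with half the margin; only V has the lower bound κ
  -- directly.
  have hv : ∀ᶠ q in atTop ×ˢ 𝓝 θ₀, κ / 2 ≤ v q := by
    filter_upwards [hc, habs.eventually (gt_mem_nhds (half_pos hκ))] with q h1 h2
    have h1' : κ ≤ V q := h1
    linarith [(abs_lt.1 h2).1]
  have ha : Tendsto (fun q => (Real.sqrt (v q))⁻¹ - (Real.sqrt (V q))⁻¹) (atTop ×ˢ 𝓝 θ₀)
      (𝓝 0) := by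
    refine squeeze_zero_norm' (a := fun q => |v q - V q| / (2 * Real.sqrt (κ / 2) ^ 3)) ?_ ?_
    · filter_upwards [hv, hc] with q h1 h2
      exact abs_inv_sqrt_sub_le (half_pos hκ) h1 ((half_le_self hκ.le).trans h2)
    · simpa using habs.div_const (2 * Real.sqrt (κ / 2) ^ 3)
  have hb : Tendsto (fun q => α q * (Real.sqrt (v q))⁻¹) (atTop ×ˢ 𝓝 θ₀) (𝓝 0) := by
    have hα := (h.tendsto_statMean_sub.abs).mul_const (Real.sqrt (κ / 2))⁻¹
    rw [abs_zero, zero_mul] at hα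
    refine squeeze_zero_norm' ?_ hα
    filter_upwards [hv] with q h1
    rw [Real.norm_eq_abs, abs_mul]
    have h2 : 0 < Real.sqrt (κ / 2) := Real.sqrt_pos.2 (half_pos hκ)
    rw [abs_of_nonneg (inv_nonneg.2 (Real.sqrt_nonneg _))]
    gcongr
  -- The difference splits as W(v^(-1/2) - V^(-1/2)) + α v^(-1/2), with W the rescaled numerator.
  refine ((h.plugStat_bounded.mul_vanishes tendsto_id (h.vanishes_of_tendsto ha)).add
    (h.vanishes_of_tendsto hb)).congr tendsto_id ?_
  filter_upwards [eventually_ge_atTop 1] with n hn x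
  have hn0 : (0 : ℝ) < n := by exact_mod_cast hn
  rw [div_sqrt_eq_scaled (b := statVar s θhat n (θhat n x) - c n (θhat n x)) hn0,
    div_sqrt_eq_scaled (b := funVar s n (θhat n x) - c n (θhat n x)) hn0]
  simp only [plugStat, v, V, α]
  ring

/-- The difference of the correct and the naive scale factors. -/
noncomputable def gap (s : ℕ → Param d → ℝ) (q : ℕ × Param d) : ℝ :=
  (Real.sqrt ((funVar s q.1 q.2 - quadQ s q.1 q.2) / q.1))⁻¹
    - (Real.sqrt (funVar s q.1 q.2 / q.1))⁻¹

lemma Setting.restored_vanishes (h : Setting Θ s θ₀ θhat) :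
    VanishesInProb s θ₀ id (fun n x => zRestored s θhat n x - zCorrect s θhat n x) := by
  obtain ⟨κ, hκ, K, hK, -, hb⟩ := h.var_bounds
  exact h.standardized_sub hκ (hb.mono fun q hq => hq.1)

/-- The case c = 0 of `standardized_sub` replaces the naive statistic by (C_n(θhat) - μ(θhat))/√V;
subtracting the correct one leaves -W times `gap`. -/
lemma Setting.bias_expansion (h : Setting Θ s θ₀ θhat) :
    VanishesInProb s θ₀ id
      (fun n x => bias s θhat n x + plugStat s θhat n x * gap s (n, θhat n x)) := by
  obtain ⟨κ, hκ, K, hK, -, hb⟩ := h.var_bounds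
  refine (h.standardized_sub (c := fun _ _ => 0) hκ ?_).congr tendsto_id ?_
  · filter_upwards [hb] with q hq
    rw [sub_zero]
    rw [sub_div] at hq
    linarith [hq.1, hq.2.1]
  · filter_upwards [eventually_ge_atTop 1] with n hn x
    have hn0 : (0 : ℝ) < n := by exact_mod_cast hn
    simp only [bias, zNaive, zCorrect, sub_zero, gap]
    rw [div_sqrt_eq_scaled (b := funVar s n (θhat n x)) hn0,
      div_sqrt_eq_scaled (b := funVar s n (θhat n x) - quadQ s n (θhat n x)) hn0]
    simp only [plugStat]
    ring

/-- The arguments V/n and (V - Q)/n of x^(-1/2) differ by Q/n and lie in [κ, K], where the slope is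
bounded above and below. -/
lemma gap_bounds {q : ℕ × Param d} {κ K : ℝ} (hκ : 0 < κ)
    (h1 : κ ≤ (funVar s q.1 q.2 - quadQ s q.1 q.2) / q.1) (h2 : 0 ≤ quadQ s q.1 q.2 / q.1)
    (h3 : funVar s q.1 q.2 / q.1 ≤ K) :
    1 / (2 * Real.sqrt K ^ 3) * (quadQ s q.1 q.2 / q.1) ≤ gap s q ∧
      gap s q ≤ 1 / (2 * Real.sqrt κ ^ 3) * (quadQ s q.1 q.2 / q.1) := by
  have e : funVar s q.1 q.2 / (q.1 : ℝ) - (funVar s q.1 q.2 - quadQ s q.1 q.2) / q.1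
      = quadQ s q.1 q.2 / q.1 := by ring
  have h4 : (funVar s q.1 q.2 - quadQ s q.1 q.2) / (q.1 : ℝ) ≤ funVar s q.1 q.2 / q.1 := by
    linarith
  rw [one_div_mul_eq_div, one_div_mul_eq_div]
  constructor
  · have h5 := le_inv_sqrt_sub (hκ.trans_le h1) h4 h3
    rw [e] at h5
    exact h5
  · have h5 := abs_inv_sqrt_sub_le hκ h1 (h1.trans h4)
    rw [abs_sub_comm ((funVar s q.1 q.2 - quadQ s q.1 q.2) / (q.1 : ℝ)), e, abs_of_nonneg h2] at h5
    exact (le_abs_self _).trans h5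

lemma Setting.exists_gap_bounds (h : Setting Θ s θ₀ θhat) : ∃ c : ℝ, 0 < c ∧ ∃ C : ℝ, 0 < C ∧
    HighProb s θ₀ (fun n x => 0 ≤ quadQ s n (θhat n x) / n ∧
      c * (quadQ s n (θhat n x) / n) ≤ gap s (n, θhat n x) ∧
      gap s (n, θhat n x) ≤ C * (quadQ s n (θhat n x) / n)) := by
  obtain ⟨κ, hκ, K, hK, -, hb⟩ := h.var_bounds
  have hsκ := Real.sqrt_pos.2 hκ
  have hsK : 0 < Real.sqrt K := Real.sqrt_pos.2 (by linarith)
  exact ⟨1 / (2 * Real.sqrt K ^ 3), by positivity, 1 / (2 * Real.sqrt κ ^ 3), by positivity,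
    h.highProb_eventually (p := fun q => 0 ≤ quadQ s q.1 q.2 / q.1 ∧
      1 / (2 * Real.sqrt K ^ 3) * (quadQ s q.1 q.2 / q.1) ≤ gap s q ∧
      gap s q ≤ 1 / (2 * Real.sqrt κ ^ 3) * (quadQ s q.1 q.2 / q.1)) (hb.mono fun q hq =>
        ⟨hq.2.1, gap_bounds hκ hq.1 hq.2.1 hq.2.2⟩)⟩

lemma Setting.quadQ_bounded (h : Setting Θ s θ₀ θhat) :
    BoundedInProb s θ₀ (fun n x => quadQ s n (θhat n x) / (n : ℝ)) := by
  obtain ⟨κ, hκ, K, hK, -, hb⟩ := h.var_bounds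
  refine (boundedInProb_const 1).of_abs_le (h.highProb_eventually hb) (C := K)
    (Eventually.of_forall fun n x hx => ?_)
  obtain ⟨h1, h2, h3⟩ := hx
  rw [abs_one, mul_one, abs_of_nonneg h2]
  rw [sub_div] at h1
  dsimp only at h1 h2 h3
  linarith

lemma Setting.bias_bounded (h : Setting Θ s θ₀ θhat) :
    BoundedInProb s θ₀ (bias s θhat) := by
  obtain ⟨κ, hκ, K, hK, -, hb⟩ := h.var_bounds
  obtain ⟨c, hc, C, hC, hg⟩ := h.exists_gap_bounds
  have hA : HighProb s θ₀ (fun n x => |gap s (n, θhat n x)| ≤ C * K) := by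
    have h0 := hg.add (h.highProb_eventually hb)
    rw [add_zero] at h0
    refine squeeze_zero (fun n => measureReal_nonneg) (fun n => prob_le_add fun x hx => ?_) h0
    by_contra! hh
    obtain ⟨⟨h1, h2, h3⟩, ⟨h4, h5, h6⟩⟩ := hh
    apply hx
    have hQ : quadQ s n (θhat n x) / (n : ℝ) ≤ K := by
      rw [sub_div] at h4
      dsimp only at h4 h6
      linarith
    rw [abs_of_nonneg ((by positivity : (0 : ℝ) ≤ _).trans h2)]
    exact h3.trans (by gcongr)
  have h1 : BoundedInProb s θ₀ (fun n x => plugStat s θhat n x * gap s (n, θhat n x)) := by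
    refine h.plugStat_bounded.of_abs_le hA (C := C * K) (Eventually.of_forall fun n x hx => ?_)
    rw [abs_mul, mul_comm]
    gcongr
  refine (h.bias_expansion.bounded.add h1.neg).of_abs_le highProb_true (C := 1)
    (Eventually.of_forall fun n x _ => le_of_eq ?_)
  rw [one_mul]
  congr 1
  ring

end standardized

/-! ### Nondegeneracy of W and the equivalence along subsequences -/

section subsequences

variable {d : ℕ} {Θ : Set (Param d)} {s : ℕ → Param d → ℝ} {θ₀ : Param d}
  {θhat : (n : ℕ) → (Fin n → ℕ) → Param d}

/-- The vector c(θ₀)/n is bounded but need not converge, so limits are identified along further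
subsequences. -/
lemma Setting.exists_subseq (h : Setting Θ s θ₀ θhat) {φ : ℕ → ℕ} (hφ : Tendsto φ atTop atTop) :
    ∃ ψ : ℕ → ℕ, StrictMono ψ ∧ ∃ u : Fin d → ℝ,
      ∀ j, Tendsto (fun k => crossCov s (φ (ψ k)) θ₀ j / (φ (ψ k) : ℝ)) atTop (𝓝 (u j)) := by
  obtain ⟨K, hK, -, hb⟩ := h.crossCov_bound
  have hc : IsCompact (Set.pi Set.univ fun _ : Fin d => Set.Icc (-K) K) :=
    isCompact_univ_pi fun _ => isCompact_Icc
  obtain ⟨u, -, ψ, hψ, hu⟩ := hc.tendsto_subseq'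
    (x := fun k j => crossCov s (φ k) θ₀ j / (φ k : ℝ))
    ((hφ.eventually (eventually_ge_atTop 1)).mono fun k hk j _ => abs_le.1 (hb _ hk j)).frequently
  exact ⟨ψ, hψ, u, fun j => tendsto_pi_nhds.1 hu j⟩

lemma vanishes_of_tendsto_const {φ : ℕ → ℕ} {a : ℕ → ℝ}
    (ha : Tendsto (fun k => a (φ k)) atTop (𝓝 0)) :
    VanishesInProb s θ₀ φ (fun n _ => a n) := by
  intro δ hδ
  have h1 := ha.abs
  rw [abs_zero] at h1
  refine tendsto_const_nhds.congr' ?_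
  filter_upwards [h1.eventually (gt_mem_nhds hδ)] with k hk
  simp [not_le.2 hk]

lemma Setting.linearPart_sub_vanishes (h : Setting Θ s θ₀ θhat) {φ : ℕ → ℕ}
    (hφ : Tendsto φ atTop atTop) {u : Fin d → ℝ}
    (hu : ∀ j, Tendsto (fun k => crossCov s (φ k) θ₀ j / (φ k : ℝ)) atTop (𝓝 (u j))) :
    VanishesInProb s θ₀ φ
      (fun n x => linearPart s θ₀ θhat n x - ∑ j, u j * scaledError θ₀ θhat n x j) := by
  have ha : Tendsto (fun k => ∑ j, |crossCov s (φ k) θ₀ j / (φ k : ℝ) - u j|) atTop (𝓝 0) := by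
    have h1 := tendsto_finsetSum Finset.univ fun j (_ : j ∈ Finset.univ) =>
      ((hu j).sub_const (u j)).abs
    simpa using h1
  refine (h.scaledError_bounded.mul_vanishes hφ (vanishes_of_tendsto_const
    (a := fun n => ∑ j, |crossCov s n θ₀ j / (n : ℝ) - u j|) ha)).of_abs_le hφ highProb_true
    (C := 1) (Eventually.of_forall fun n x _ => ?_)
  rw [one_mul, linearPart, ← Finset.sum_sub_distrib, abs_mul, abs_norm,
    Finset.abs_sum_of_nonneg' (fun j => abs_nonneg _), Finset.mul_sum]
  refine (Finset.abs_sum_le_sum_abs _ _).trans (Finset.sum_le_sum fun j _ => ?_)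
  rw [← sub_mul, abs_mul, mul_comm]
  have := PiLp.norm_apply_le (scaledError θ₀ θhat n x) j
  rw [Real.norm_eq_abs] at this
  gcongr

/-- The variance of the centred `C` function is not exhausted by the truncated second moments of
the linear part, so the numerator does not vanish along any subsequence. -/
lemma Setting.not_plugStat_vanishes (h : Setting Θ s θ₀ θhat) {φ : ℕ → ℕ}
    (hφ : Tendsto φ atTop atTop) : ¬ VanishesInProb s θ₀ φ (plugStat s θhat) := by
  intro hW
  obtain ⟨I, hI, hpd, hlim⟩ := h.b1
  obtain ⟨κ, hκ, -, -, hκb, -⟩ := h.var_bounds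
  obtain ⟨ε, hε, hlow⟩ := h.b2
  obtain ⟨K, hK, hKb⟩ := exists_var_dev_le hε
  obtain ⟨χ, hχ, u, hu⟩ := h.exists_subseq hφ
  set ψ := φ ∘ χ with hψd
  have hψ : Tendsto ψ atTop atTop := hφ.comp hχ.tendsto_atTop
  -- If W vanished, the centred C function would be asymptotically a fixed linear form of the
  -- rescaled error.
  have hX : VanishesInProb s θ₀ ψ
      (fun n x => centered s θ₀ n x - ∑ j, u j * scaledError θ₀ θhat n x j) := by
    refine (((hW.comp hχ.tendsto_atTop).sub (h.plugStat_expansion.of_id hψ)).add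
      (h.linearPart_sub_vanishes hψ hu)).congr hψ (Eventually.of_forall fun n x => ?_)
    ring
  set K₄ := 3 * K ^ 2 + K with hK₄
  have hK₄0 : 0 < K₄ := by positivity
  -- Truncation of X² at M loses at most E[X⁴]/M ≤ κ/2, half of the margin by which V/n exceeds Q/n.
  set M := 2 * K₄ / κ with hM
  have hM0 : 0 < M := by positivity
  have hmin := tendsto_integral_min_sq hlim hψ hX hM0
  have hQ := tendsto_quadQ_subseq hpd hI hψ hu
  have hle : ∀ᶠ k in atTop, quadQ s (ψ k) θ₀ / (ψ k : ℝ) + κ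
      ≤ (∫ x, min (centered s θ₀ (ψ k) x ^ 2) M ∂(law s (ψ k) θ₀)) + κ / 2 := by
    filter_upwards [hψ.eventually (eventually_ge_atTop 1)] with k hk
    set n := ψ k
    have h1 := hκb n hk
    rw [sub_div, ← integral_centered_sq] at h1
    have h4 := integral_centered_pow_four_le hK (fun i => hKb _ (hlow i θ₀ h.true_mem)) hk
    have g := growth_centered s θ₀ n
    have hmi : Integrable (fun x => min (centered s θ₀ n x ^ 2) M) (law s n θ₀) :=
      Integrable.of_bound Measurable.of_discrete.aestronglyMeasurable M
        (Eventually.of_forall fun x => by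
          rw [Real.norm_of_nonneg (by positivity)]; exact min_le_right _ _)
    have h5 : ∫ x, centered s θ₀ n x ^ 2 ∂(law s n θ₀) ≤
        ∫ x, (min (centered s θ₀ n x ^ 2) M + centered s θ₀ n x ^ 4 / M) ∂(law s n θ₀) := by
      refine integral_mono ((g.pow 2).integrable s θ₀)
        (hmi.add (((g.pow 4).integrable s θ₀).div_const M)) fun x => ?_
      dsimp only
      rcases le_total (centered s θ₀ n x ^ 2) M with h6 | h6
      · rw [min_eq_left h6]
        have : 0 ≤ centered s θ₀ n x ^ 4 / M := by positivity
        linarith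
      · rw [min_eq_right h6]
        have : centered s θ₀ n x ^ 2 ≤ centered s θ₀ n x ^ 4 / M := by
          rw [le_div_iff₀ hM0]
          nlinarith [sq_nonneg (centered s θ₀ n x)]
        linarith
    rw [integral_add hmi (((g.pow 4).integrable s θ₀).div_const M), integral_div] at h5
    have h7 : (∫ x, centered s θ₀ n x ^ 4 ∂(law s n θ₀)) / M ≤ κ / 2 := by
      rw [div_le_iff₀ hM0]
      refine h4.trans (le_of_eq ?_)
      rw [← hK₄, hM]; field_simp
    linarith
  -- In the limit uᵀI⁻¹u + κ is at most a truncated moment plus κ/2, hence at most uᵀI⁻¹u + κ/2: a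
  -- contradiction.
  have hfin := le_of_tendsto_of_tendsto (hQ.add_const κ) (hmin.add_const (κ / 2)) hle
  have := integral_min_sq_le hpd u hM0
  linarith

/-- The naive bias is negligible along a subsequence exactly when `Q` is. -/
lemma Setting.bias_vanishes_iff (h : Setting Θ s θ₀ θhat) {φ : ℕ → ℕ}
    (hφ : Tendsto φ atTop atTop) :
    VanishesInProb s θ₀ φ (bias s θhat) ↔
      VanishesInProb s θ₀ φ (fun n x => quadQ s n (θhat n x) / (n : ℝ)) := by
  obtain ⟨c, hc, C, hC, hg⟩ := h.exists_gap_bounds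
  have hexp := h.bias_expansion.of_id hφ
  have hsub := (h.vanishes_of_tendsto h.tendsto_quadQ_sub).of_id hφ
  constructor
  · intro hB
    have h1 : VanishesInProb s θ₀ φ (fun n x => plugStat s θhat n x * gap s (n, θhat n x)) :=
      (hexp.sub hB).congr hφ (Eventually.of_forall fun n x => by ring)
    have h2 : VanishesInProb s θ₀ φ
        (fun n x => plugStat s θhat n x * (quadQ s n (θhat n x) / n)) := by
      refine h1.of_abs_le hφ hg (C := 1 / c) (Eventually.of_forall fun n x hx => ?_)
      obtain ⟨h3, h4, -⟩ := hx
      have h5 := (mul_nonneg hc.le h3).trans h4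
      rw [abs_mul, abs_mul, abs_of_nonneg h3, abs_of_nonneg h5]
      calc |plugStat s θhat n x| * (quadQ s n (θhat n x) / n)
          = 1 / c * (|plugStat s θhat n x| * (c * (quadQ s n (θhat n x) / n))) := by field_simp
        _ ≤ _ := by gcongr
    -- Q at θhat is replaced by the deterministic Q at θ₀, so that a nonzero limit can be divided
    -- out.
    have h3 : VanishesInProb s θ₀ φ
        (fun n x => plugStat s θhat n x * (quadQ s n θ₀ / n)) :=
      (h2.sub (h.plugStat_bounded.mul_vanishes hφ hsub)).congr hφ
        (Eventually.of_forall fun n x => by ring)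
    have h4 : Tendsto (fun k => quadQ s (φ k) θ₀ / (φ k : ℝ)) atTop (𝓝 0) := by
      obtain ⟨I, hI, hpd, -⟩ := h.b1
      refine tendsto_of_subseq_tendsto fun ns hns => ?_
      obtain ⟨χ, hχ, u, hu⟩ := h.exists_subseq (hφ.comp hns)
      have hns' : Tendsto (fun k => ns (χ k)) atTop atTop := hns.comp hχ.tendsto_atTop
      have hψ : Tendsto (fun k => φ (ns (χ k))) atTop atTop := hφ.comp hns'
      have hQ := tendsto_quadQ_subseq hpd hI hψ hu
      refine ⟨χ, ?_⟩
      suffices hq : u ⬝ᵥ (I⁻¹ *ᵥ u) = 0 by rwa [hq] at hQ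
      by_contra hq
      have habs := hQ.abs
      have hq0 : 0 < |u ⬝ᵥ (I⁻¹ *ᵥ u)| := abs_pos.2 hq
      -- Where |Q/n| stays above half of a nonzero limit, the vanishing of W · Q/n would force W
      -- itself to vanish.
      refine h.not_plugStat_vanishes hψ fun δ hδ => ?_
      refine squeeze_zero' (Eventually.of_forall fun k => measureReal_nonneg) ?_
        ((h3.comp hns') (δ * (|u ⬝ᵥ (I⁻¹ *ᵥ u)| / 2)) (by positivity))
      filter_upwards [habs.eventually (lt_mem_nhds (half_lt_self hq0))] with k hk
      refine measureReal_mono fun x hx => ?_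
      have hx' : δ ≤ |plugStat s θhat (φ (ns (χ k))) x| := hx
      change _ ≤ |plugStat s θhat (φ (ns (χ k))) x
        * (quadQ s (φ (ns (χ k))) θ₀ / (φ (ns (χ k)) : ℝ))|
      rw [abs_mul]
      gcongr
    exact (hsub.add (vanishes_of_tendsto_const (a := fun n => quadQ s n θ₀ / (n : ℝ)) h4)).congr hφ
      (Eventually.of_forall fun n x => by ring)
  · intro hQ
    have h1 : VanishesInProb s θ₀ φ (fun n x => gap s (n, θhat n x)) := by
      refine hQ.of_abs_le hφ hg (C := C) (Eventually.of_forall fun n x hx => ?_)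
      obtain ⟨h3, h4, h5⟩ := hx
      rwa [abs_of_nonneg h3, abs_of_nonneg ((mul_nonneg hc.le h3).trans h4)]
    exact (hexp.sub (h.plugStat_bounded.mul_vanishes hφ h1)).congr hφ
      (Eventually.of_forall fun n x => by ring)

/-- A tail bound for the linear part of the expansion. -/
lemma Setting.linearPart_tail (h : Setting Θ s θ₀ θhat) {q : ℝ}
    (hq : ∀ᶠ n : ℕ in atTop, quadQ s n θ₀ / (n : ℝ) ≤ q) {τ : ℝ} (hτ : 0 < τ) :
    ∀ᶠ n in atTop, (law s n θ₀).real {x | τ ≤ |linearPart s θ₀ θhat n x|} ≤ (q + 1) / τ ^ 2 := by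
  obtain ⟨I, hI, hpd, hlim⟩ := h.b1
  by_contra hcon
  obtain ⟨φ, hφ, hbad⟩ := extraction_of_frequently_atTop (not_eventually.1 hcon)
  obtain ⟨χ, hχ, u, hu⟩ := h.exists_subseq hφ.tendsto_atTop
  have hψ : Tendsto (fun k => φ (χ k)) atTop atTop := hφ.tendsto_atTop.comp hχ.tendsto_atTop
  have hM : 0 < τ ^ 2 := by positivity
  -- Truncation at τ² loses nothing in Markov's inequality for the event |X| ≥ τ, and the limiting
  -- truncated moment is at most q < q + 1.
  have hmin := tendsto_integral_min_sq hlim hψ (h.linearPart_sub_vanishes hψ hu) hM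
  have hQ := le_of_tendsto (tendsto_quadQ_subseq hpd hI hψ hu) (hψ.eventually hq)
  have hlt : ∫ y : Param d, min ((∑ j, u j * y j) ^ 2) (τ ^ 2) ∂(multivariateGaussian 0 I⁻¹)
      < q + 1 := by
    linarith [integral_min_sq_le hpd u hM]
  obtain ⟨k, hk⟩ := (hmin.eventually (gt_mem_nhds hlt)).exists
  apply hbad (χ k)
  set n := φ (χ k)
  have hmi : Integrable (fun x => min (linearPart s θ₀ θhat n x ^ 2) (τ ^ 2)) (law s n θ₀) :=
    Integrable.of_bound Measurable.of_discrete.aestronglyMeasurable (τ ^ 2)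
      (Eventually.of_forall fun x => by
        rw [Real.norm_of_nonneg (by positivity)]; exact min_le_right _ _)
  have h1 := mul_meas_ge_le_integral_of_nonneg (μ := law s n θ₀)
    (f := fun x => min (linearPart s θ₀ θhat n x ^ 2) (τ ^ 2))
    (Eventually.of_forall fun x => le_min (sq_nonneg _) hM.le) hmi (τ ^ 2)
  rw [le_div_iff₀ hM, mul_comm]
  refine le_trans ?_ (h1.trans hk.le)
  have hsub : {x | τ ≤ |linearPart s θ₀ θhat n x|}
      ⊆ {x | τ ^ 2 ≤ min (linearPart s θ₀ θhat n x ^ 2) (τ ^ 2)} := fun x hx => by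
    have hx' : τ ≤ |linearPart s θ₀ θhat n x| := hx
    change τ ^ 2 ≤ min (linearPart s θ₀ θhat n x ^ 2) (τ ^ 2)
    refine le_min ?_ le_rfl
    rw [← sq_abs (linearPart s θ₀ θhat n x)]
    gcongr
  exact mul_le_mul_of_nonneg_left (measureReal_mono hsub) hM.le

end subsequences

/-! ### Large expected counts -/

section largeCounts

variable {d : ℕ} {Θ : Set (Param d)} {s : ℕ → Param d → ℝ} {θ₀ : Param d}
  {θhat : (n : ℕ) → (Fin n → ℕ) → Param d}

lemma sum_fin_le {n N : ℕ} {f : ℕ → ℝ} {A B : ℝ} (hA : 0 ≤ A) (hB : 0 ≤ B) (h : ∀ i, f i ≤ A)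
    (h' : ∀ i, N ≤ i → f i ≤ B) : ∑ i : Fin n, f i ≤ A * N + B * n := by
  rw [Fin.sum_univ_eq_sum_range f n]
  have h1 : ∀ i, f i ≤ (if i < N then A else 0) + B := fun i => by
    split_ifs with hi
    · linarith [h i]
    · linarith [h' i (not_lt.1 hi)]
  refine (Finset.sum_le_sum fun i _ => h1 i).trans ?_
  rw [Finset.sum_add_distrib, Finset.sum_const, Finset.card_range, nsmul_eq_mul, mul_comm B,
    ← Finset.sum_filter, Finset.sum_const, nsmul_eq_mul, mul_comm A]
  gcongr
  refine (Finset.card_le_card (t := Finset.range N) fun i hi => ?_).trans_eq (Finset.card_range N)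
  exact Finset.mem_range.2 (Finset.mem_filter.1 hi).2

/-- Expected counts that are large at the true parameter are large near it. -/
lemma Setting.eventually_large (h : Setting Θ s θ₀ θhat) {S : ℝ} (hS : 4 ≤ S) :
    ∀ᶠ θ in 𝓝 θ₀, ∀ i, S ≤ s i θ₀ → S / 4 ≤ s i θ := by
  obtain ⟨L, hL⟩ := h.standing.lipschitz
  have h1 : Tendsto (fun θ : Param d => L * ‖θ₀ - θ‖) (𝓝 θ₀) (𝓝 (L * ‖θ₀ - θ₀‖)) :=
    (continuous_const.mul (continuous_const.sub continuous_id).norm).tendsto θ₀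
  rw [sub_self, norm_zero, mul_zero] at h1
  filter_upwards [h1.eventually (gt_mem_nhds one_pos),
    mem_interior_iff_mem_nhds.1 h.standing.interior_mem] with θ h2 h3 i hi
  have h4 := (abs_le.1 (hL i θ₀ h.true_mem θ h3)).2
  have h5 : Real.sqrt S ≤ Real.sqrt (s i θ₀) := Real.sqrt_le_sqrt hi
  -- The root moves by less than 1 ≤ √S/2, so at least half of it remains.
  have h6 : 2 ≤ Real.sqrt S := Real.le_sqrt_of_sq_le (by linarith)
  have h7 : Real.sqrt S / 2 ≤ Real.sqrt (s i θ) := by linarith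
  calc S / 4 = (Real.sqrt S / 2) ^ 2 := by rw [div_pow, Real.sq_sqrt (by linarith)]; norm_num
    _ ≤ Real.sqrt (s i θ) ^ 2 := by gcongr
    _ = s i θ := Real.sq_sqrt (h.pos θ h3 i).le

/-- Bounds on the variances per bin when all but finitely many expected counts are large. -/
lemma Setting.large_bounds (h : Setting Θ s θ₀ θhat) {S : ℝ} (hS : 4 ≤ S)
    (hlarge : ∀ᶠ i : ℕ in atTop, S ≤ s i θ₀) :
    ∀ᶠ q : ℕ × Param d in atTop ×ˢ 𝓝 θ₀,
      1 / 25 ≤ (funVar s q.1 q.2 - quadQ s q.1 q.2) / q.1 ∧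
      0 ≤ quadQ s q.1 q.2 / q.1 ∧ quadQ s q.1 q.2 / q.1 ≤ 17 / S := by
  obtain ⟨ε, hε, hlow⟩ := h.b2
  obtain ⟨r, hr, _, -, hΘ, hloc⟩ := h.exists_local
  obtain ⟨N, hN⟩ := eventually_atTop.1 hlarge
  have hS0 : 0 < S := by linarith
  filter_upwards [eventually_fst_atTop (eventually_ge_atTop 1),
    eventually_fst_atTop (tendsto_natCast_atTop_atTop.eventually_ge_atTop (4 / ε * N * S)),
    eventually_fst_atTop (tendsto_natCast_atTop_atTop.eventually_ge_atTop (10 * (N : ℝ))),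
    eventually_snd_nhds (Metric.ball_mem_nhds θ₀ hr),
    eventually_snd_nhds (h.eventually_large hS)] with q h1 h2 h3 h4 h5
  obtain ⟨n, θ⟩ := q
  dsimp only at h1 h2 h3 h4 h5 ⊢
  have hn0 : (0 : ℝ) < n := by exact_mod_cast h1
  have hpos := h.pos θ (hΘ h4)
  have hd := (hloc θ h4).1
  have hbig : ∀ i, N ≤ i → S / 4 ≤ s i θ := fun i hi => h5 i (hN i hi)
  refine ⟨?_, div_nonneg (quadQ_bounds hpos hd).1 hn0.le, ?_⟩
  · rw [le_div_iff₀ hn0]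
    refine le_trans ?_ (funVar_sub_quadQ_ge hpos hd)
    -- A mean of at least 1 contributes at least (2/9)(1/2)² = 1/18. Losing N bins out of n ≥ 10N
    -- still leaves n/20 ≥ n/25.
    have h6 := sum_fin_le (n := n) (N := N)
      (f := fun i => 1 / 18 - 2 / 9 * (s i θ / (s i θ + 1)) ^ 2) (A := 1 / 18) (B := 0)
      (by norm_num) le_rfl (fun i => by
        have : 0 ≤ 2 / 9 * (s i θ / (s i θ + 1)) ^ 2 := by positivity
        linarith) fun i hi => by
        have h7 : 1 ≤ s i θ := by linarith [hbig i hi]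
        have h8 : 1 / 2 ≤ s i θ / (s i θ + 1) := by
          rw [div_le_div_iff₀ (by norm_num) (by linarith)]; linarith
        nlinarith
    rw [Finset.sum_sub_distrib] at h6
    simp only [Finset.sum_const, Finset.card_univ, Fintype.card_fin, nsmul_eq_mul] at h6
    linarith
  · rw [div_le_iff₀ hn0]
    -- Large bins contribute 4/(S/4) = 16/S each; the exceptional ones together at most 4N/ε ≤ n/S.
    have h6 := sum_fin_le (n := n) (N := N) (f := fun i => 4 / s i θ) (A := 4 / ε) (B := 16 / S)
      (by positivity) (by positivity) (fun i => by
        have := hlow i θ (hΘ h4)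
        gcongr) fun i hi => by
        rw [div_le_div_iff₀ (hpos i) hS0]
        linarith [hbig i hi]
    refine ((quadQ_le hpos hd).trans h6).trans ?_
    rw [← le_div_iff₀ hS0] at h2
    have e : 17 / S * (n : ℝ) = n / S + 16 / S * n := by ring
    linarith

/-- The finitely many exceptional bins have bounded variance and add at most n for large n, so the
bound keeps no trace of the setting's own ε. -/
lemma Setting.funVar_large (h : Setting Θ s θ₀ θhat) {K : ℝ}
    (hK : ∀ r : ℝ, 1 ≤ r → Var[dev r; poissonMeasure r.toNNReal] ≤ K) (hK0 : 0 ≤ K)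
    (hlarge : ∀ᶠ i : ℕ in atTop, 1 ≤ s i θ₀) : ∀ᶠ n : ℕ in atTop, funVar s n θ₀ / n ≤ K + 1 := by
  obtain ⟨ε, hε, hlow⟩ := h.b2
  obtain ⟨K', hK', hb⟩ := exists_var_dev_le hε
  obtain ⟨N, hN⟩ := eventually_atTop.1 hlarge
  filter_upwards [eventually_ge_atTop 1,
    tendsto_natCast_atTop_atTop.eventually_ge_atTop (K' * N)] with n h1 h2
  have hn0 : (0 : ℝ) < n := by exact_mod_cast h1
  rw [div_le_iff₀ hn0, funVar_eq_sum]
  have h3 := sum_fin_le (n := n) (N := N)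
    (f := fun i => Var[dev (s i θ₀); poissonMeasure (s i θ₀).toNNReal]) (A := K') (B := K)
    (by linarith) hK0 (fun i => (hb _ (hlow i θ₀ h.true_mem)).1) fun i hi => hK _ (hN i hi)
  linarith

/-- The naive bias is small when the expected counts are large. -/
lemma exists_large_bias_le {δ : ℝ} (hδ : 0 < δ) : ∃ S : ℝ,
    ∀ (d : ℕ) (Θ : Set (Param d)) (s : ℕ → Param d → ℝ) (θ₀ : Param d)
      (θhat : (n : ℕ) → (Fin n → ℕ) → Param d), Setting Θ s θ₀ θhat →
      (∀ᶠ i : ℕ in atTop, S ≤ s i θ₀) →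
        ∀ᶠ n : ℕ in atTop, (law s n θ₀).real {x | δ < |bias s θhat n x|} ≤ δ := by
  obtain ⟨K, hK, hKb⟩ := exists_var_dev_le one_pos
  have hK0 : 0 < K := by linarith
  -- Makes both Chebyshev tails at most δ/8: the second-moment bounds are K + 1 for the centred part
  -- and 17 + 1 for the linear part.
  set τ := Real.sqrt (8 * (K + 18) / δ) with hτ
  have hτ0 : 0 < τ := Real.sqrt_pos.2 (by positivity)
  have hτ2 : τ ^ 2 = 8 * (K + 18) / δ := Real.sq_sqrt (by positivity)
  have htail : ∀ a, a ≤ K + 18 → a / τ ^ 2 ≤ δ / 8 := fun a ha => by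
    rw [div_le_iff₀ (by positivity), hτ2]
    refine ha.trans (le_of_eq ?_)
    field_simp
  -- S is fixed before d and the setting. Up to small probability |W| ≤ 3τ and the gap is at most
  -- 1100/S, so 6600 τ ≤ S δ suffices for |W · gap| ≤ δ/2.
  refine ⟨max 4 (7000 * τ / δ), fun d Θ s θ₀ θhat h hlarge => ?_⟩
  set S := max 4 (7000 * τ / δ)
  have hS : 4 ≤ S := le_max_left _ _
  have hS0 : 0 < S := by linarith
  have hSτ : 7000 * τ ≤ S * δ := by
    rw [← div_le_iff₀ hδ]; exact le_max_right _ _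
  have hlb := h.large_bounds hS hlarge
  have hV := h.funVar_large (fun r hr => (hKb r hr).1) hK0.le (hlarge.mono fun i hi => by linarith)
  have hq : ∀ᶠ n : ℕ in atTop, quadQ s n θ₀ / (n : ℝ) ≤ 17 := by
    filter_upwards [(tendsto_diag θ₀ tendsto_id).eventually hlb] with n hn
    refine hn.2.2.trans ?_
    rw [div_le_iff₀ hS0]
    linarith
  have hsq : Real.sqrt (1 / 25) = 1 / 5 := by
    rw [show (1 : ℝ) / 25 = (1 / 5) ^ 2 by norm_num, Real.sqrt_sq (by norm_num)]
  have hgap : HighProb s θ₀ (fun n x => |gap s (n, θhat n x)| ≤ 1100 / S) := by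
    refine h.highProb_eventually (p := fun q => |gap s q| ≤ 1100 / S) (hlb.mono fun q hq => ?_)
    obtain ⟨h1, h2, h3⟩ := hq
    obtain ⟨h4, h5⟩ := gap_bounds (by norm_num) h1 h2 le_rfl
    rw [hsq] at h5
    rw [abs_of_nonneg ((by positivity : (0 : ℝ) ≤ _).trans h4)]
    refine h5.trans ?_
    calc _ ≤ 1 / (2 * (1 / 5) ^ 3) * (17 / S) := by gcongr
      _ = 1062.5 / S := by ring
      _ ≤ _ := by gcongr; norm_num
  filter_upwards [hV, h.linearPart_tail hq hτ0,
    (h.bias_expansion (δ / 2) (half_pos hδ)).eventually (gt_mem_nhds (show 0 < δ / 8 by positivity)),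
    (h.plugStat_expansion τ hτ0).eventually (gt_mem_nhds (show 0 < δ / 8 by positivity)),
    hgap.eventually (gt_mem_nhds (show 0 < δ / 8 by positivity))] with n h1 h2 h3 h4 h5
  have h6 := prob_le_integral_sq (s := s) (θ₀ := θ₀) (growth_centered s θ₀ n) hτ0
  rw [integral_centered_sq] at h6
  have h7 := h6.trans (htail _ (by linarith))
  have h8 := h2.trans (htail _ (by linarith))
  -- Five exceptional events, each of probability at most δ/8: expansion of the bias, gap, centred
  -- part, linear part, and expansion of W.
  refine (prob_le_add
    (Q := fun x => δ / 2 ≤ |bias s θhat n x + plugStat s θhat n x * gap s (n, θhat n x)|)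
    (R := fun x => ¬ |gap s (n, θhat n x)| ≤ 1100 / S ∨ τ ≤ |centered s θ₀ n x| ∨
      τ ≤ |linearPart s θ₀ θhat n x| ∨
      τ ≤ |plugStat s θhat n x - (centered s θ₀ n x - linearPart s θ₀ θhat n x)|)
    fun x hx => ?_).trans ?_
  · by_contra! hc
    obtain ⟨g1, g2, g3, g4, g5⟩ := hc
    set W := plugStat s θhat n x
    have hW : |W| ≤ 3 * τ := by
      have e1 := abs_lt.1 g3
      have e2 := abs_lt.1 g4
      have e3 := abs_lt.1 g5
      rw [abs_le]
      constructor <;> linarith [e1.1, e1.2, e2.1, e2.2, e3.1, e3.2]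
    have hWg : |W * gap s (n, θhat n x)| ≤ δ / 2 := by
      rw [abs_mul]
      calc _ ≤ 3 * τ * (1100 / S) := by gcongr
        _ = 3300 * τ / S := by ring
        _ ≤ δ / 2 := by
            rw [div_le_iff₀ hS0]
            linarith
    have e1 := abs_lt.1 g1
    have e2 := abs_le.1 hWg
    have hx' : |bias s θhat n x| ≤ δ := by
      rw [abs_le]
      constructor <;> linarith [e1.1, e1.2, e2.1, e2.2]
    exact absurd hx (not_lt.2 hx')
  · have a1 := prob_le_add (s := s) (θ₀ := θ₀)
      (P := fun x => ¬ |gap s (n, θhat n x)| ≤ 1100 / S ∨ τ ≤ |centered s θ₀ n x| ∨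
        τ ≤ |linearPart s θ₀ θhat n x| ∨
        τ ≤ |plugStat s θhat n x - (centered s θ₀ n x - linearPart s θ₀ θhat n x)|) fun x hx => hx
    have a2 := prob_le_add (s := s) (θ₀ := θ₀)
      (P := fun x => τ ≤ |centered s θ₀ n x| ∨ τ ≤ |linearPart s θ₀ θhat n x| ∨
        τ ≤ |plugStat s θhat n x - (centered s θ₀ n x - linearPart s θ₀ θhat n x)|) fun x hx => hx
    have a3 := prob_le_add (s := s) (θ₀ := θ₀)
      (P := fun x => τ ≤ |linearPart s θ₀ θhat n x| ∨
        τ ≤ |plugStat s θhat n x - (centered s θ₀ n x - linearPart s θ₀ θhat n x)|) fun x hx => hx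
    simp only [id] at h3 h4
    linarith

end largeCounts

end CStat

theorem proposition2 (d : ℕ) :
    (∀ (Θ : Set (CStat.Param d)) (s : ℕ → CStat.Param d → ℝ) (θ₀ : CStat.Param d)
      (θhat : (n : ℕ) → (Fin n → ℕ) → CStat.Param d),
      CStat.Setting Θ s θ₀ θhat →
        -- the omitted term is of order `O_p(n)`
        CStat.BoundedInProb s θ₀ (fun n x => CStat.quadQ s n (θhat n x) / (n : ℝ)) ∧
        -- the bias of the naive statistic is of order `O_p(1)`
        CStat.BoundedInProb s θ₀ (CStat.bias s θhat) ∧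
        -- the bias comes from omitting `Q(θhat)`: it disappears when `Q(θhat)` is put back
        CStat.VanishesInProb s θ₀ id
          (fun n x => CStat.zRestored s θhat n x - CStat.zCorrect s θhat n x) ∧
        -- along any subsequence, the bias is asymptotically negligible
        -- exactly when the omitted term is `o_p(n)`
        (∀ φ : ℕ → ℕ, StrictMono φ →
          (CStat.VanishesInProb s θ₀ φ (CStat.bias s θhat) ↔
            CStat.VanishesInProb s θ₀ φ (fun n x => CStat.quadQ s n (θhat n x) / (n : ℝ))))) ∧
    -- the bias decreases to `0` as the expected counts tend to infinity uniformly
    (∀ δ : ℝ, 0 < δ → ∃ S : ℝ,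
      ∀ (Θ : Set (CStat.Param d)) (s : ℕ → CStat.Param d → ℝ) (θ₀ : CStat.Param d)
        (θhat : (n : ℕ) → (Fin n → ℕ) → CStat.Param d),
        CStat.Setting Θ s θ₀ θhat →
        (∀ᶠ i : ℕ in atTop, S ≤ s i θ₀) →
          ∀ᶠ n : ℕ in atTop,
            (CStat.law s n θ₀).real {x | δ < |CStat.bias s θhat n x|} ≤ δ) := by
  refine ⟨fun Θ s θ₀ θhat h => ⟨h.quadQ_bounded, h.bias_bounded, h.restored_vanishes,
    fun φ hφ => h.bias_vanishes_iff hφ.tendsto_atTop⟩, fun δ hδ => ?_⟩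
  obtain ⟨S, hS⟩ := CStat.exists_large_bias_le hδ
  exact ⟨S, hS d⟩
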